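/- **Setting.** Let $\mathcal T=\{\mathcal T_1,\dots,\mathcal T_N\}$ be finitely many oriented tetrahedra whose faces are glued in pairs by orientation-reversing face pairings (no face is glued to itself), and let $M$ be the resulting oriented 3-manifold obtained by gluing the tetrahedra with their vertices removed; $\mathcal T$ is an ideal triangulation of $M$. For $c\in\mathbb R$ let $\mathcal B_c=\mathbb R+\mathbb R\kappa$ be the commutative algebra with $\kappa^2=c$, with $\overline{a+b\kappa}=a-b\kappa$ and $|w|^2=w\bar w\in\mathbb R$; write $i,\tau,\sigma$ for $\kappa$ when $c=-1,1,0$. The matrices $\begin{pmatrix}x_1+x_2&x_3-x_4\kappa\\x_3+x_4\kappa&x_1-x_2\end{pmatrix}$ identify the Hermitian $2\times2$ matrices over $\mathcal B_c$ with $\mathbb R^4$, and $-\det$ defines an inner product $\langle\cdot,\cdot\rangle$ on them. Let $\mathbb X_c\subset\mathbb{RP}^3$ be the set of its negative lines, on which $\mathrm{PGL}^+(2,\mathcal B_c)=\{A:|\det A|^2>0\}/\!\sim$ acts by $X\mapsto AXA^*$. A hyperbolic, AdS or half-pipe structure on $M$ is a $(\mathrm{PGL}^+(2,\mathcal B_c),\mathbb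 X_c)$-structure with $c=-1$, $c=1$ or $c=0$ respectively; a projective structure is an (oriented) $(\mathrm{PGL}^+(4,\mathbb R),\mathbb{RP}^3)$-structure, where $\mathrm{PGL}^+(4,\mathbb R)$ is induced by the matrices of positive determinant. A projective structure is conjugate to a hyperbolic, AdS or half-pipe structure if an element of $\mathrm{PGL}^+(4,\mathbb R)$ takes the charts of the latter to charts of the former. A path of projective structures is continuous if, locally in $M$ and in the parameter, it has charts with a common domain that depend jointly continuously on the parameter and the point. An ideal tetrahedron in $\mathbb X_c$ has vertices represented by $Z_1,\dots,Z_4$ with $\langle Z_k,Z_k\rangle=0$ and $\langle Z_k,Z_l\rangle<0$ for $k\ne l$; it is positively oriented if $\det(Z_1,\dots,Z_4)>0$. Identifying the line of $uu^*$ with $[u]$, its shape parameter is the $w\in\mathcal B_c$ for which some element of $\mathrm{PGL}^+(2,\mathcal B_c)$ takes the ordered vertices to $\infty,0,1,w$. The shape parameter $w$ is assigned to the edge joining the first two vertices and to the opposite edge; the other two pairs of opposite edges (those containing the edges joining the first vertex to the third and to the fourth) have parameters $\frac1{1-w}$ and $\frac{w-1}{w}$. The triangulation is realized in a structure by given tetrahedra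 if each $\mathcal T_j$ is developed homeomorphically, each face to the corresponding face, onto the straight tetrahedron with its given vertices. Thurston's equations for $(M,\mathcal T)$ require that, at each edge of $\mathcal T$, the product of the shape parameters of the tetrahedra at that edge be $1$ and the total dihedral angle be $2\pi$. The second condition means that the arguments of the parameters at the edge add up to $2\pi$ if $c=-1$, and that exactly two of them have negative real part if $c=1$. A positively oriented solution is one with $|w_j|^2>0$, $|1-w_j|^2>0$ and $\operatorname{Im}w_j>0$ for all $j$. The real deformation variety $\mathscr D_{\mathbb R}\subset\mathbb R^N$ is the set of real solutions: $z_j\ne0,1$ for all $j$, and at each edge the product of the parameters is $1$ and exactly two of them are negative. **Proposition.** Let $\mathscr D_{\mathbb R}$ be smooth at $z=(z_j)$, that is, a real-analytic submanifold of $\mathbb R^N$ near $z\in\mathscr D_{\mathbb R}$, and let $v=(v_j)$ be a tangent vector to $\mathscr D_{\mathbb R}$ at $z$ with $v_j>0$ for all $j$. Then: (a) There are $\delta>0$ and continuous paths $\zeta:[0,\delta)\to\mathbb C^N$ and $\xi:[0,\delta)\to(\mathbb R+\mathbb R\tau)^N$ with $\zeta(0)=\xi(0)=z$ and one-sided derivatives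 $\zeta'(0)=iv$, $\xi'(0)=\tau v$, such that $\zeta(t)$ and $\xi(t)$ are positively oriented solutions of Thurston's equations for $0<t<\delta$. (b) For every $\delta>0$ and all paths $\zeta,\xi$ as in (a) there is a continuous path $(\mathscr P_t)_{-\delta<t<\delta}$ of projective structures on $M$ such that * for $0<t<\delta$, $\mathscr P_t$ is conjugate to a hyperbolic structure $\mathscr H_t$ on $M$ in which $\mathcal T$ is realized by positively oriented ideal tetrahedra with shape parameters $\zeta_j(t)$; * for $-\delta<t<0$, $\mathscr P_t$ is conjugate to an AdS structure $\mathscr A_{|t|}$ on $M$ in which $\mathcal T$ is realized by positively oriented ideal tetrahedra with shape parameters $\xi_j(|t|)$; * $\mathscr P_0$ is conjugate to a half-pipe structure on $M$ in which $\mathcal T$ is realized by positively oriented ideal tetrahedra; * for every $t\in(-\delta,\delta)$, $\mathcal T$ is realized in $\mathscr P_t$ by positively oriented tetrahedra. -/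

import Mathlib

open scoped LinearAlgebra.Projectivization ContDiff Topology Matrix

noncomputable section

/-! ## The algebras `ℝ + ℝκ`, Hermitian matrices and the model spaces -/

/-- The two-dimensional real algebra `ℝ + ℝκ` with `κ² = c`, with its conjugation `star`, its
real part `re`, its imaginary part `im` and its square-norm `QuadraticAlgebra.norm`. For `c = -1`
these are the complex numbers, for `c = 1` the pseudo-complex numbers `ℝ + ℝτ`, and for `c = 0`
the dual numbers `ℝ + ℝσ`. -/
abbrev ShapeAlg (c : ℝ) : Type := QuadraticAlgebra ℝ c 0

/-- The ambient vector space, with coordinates `(x₁, x₂, x₃, x₄)` (indexed from `0`). -/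
abbrev V4 : Type := Fin 4 → ℝ

/-- The Hermitian `2 × 2` matrix over `ℝ + ℝκ` with coordinates `x`, that is
`[[x₁ + x₂, x₃ - x₄ κ], [x₃ + x₄ κ, x₁ - x₂]]`. -/
def herm (c : ℝ) (x : V4) : Matrix (Fin 2) (Fin 2) (ShapeAlg c) :=
  !![⟨x 0 + x 1, 0⟩, ⟨x 2, -x 3⟩; ⟨x 2, x 3⟩, ⟨x 0 - x 1, 0⟩]

/-- The inner product on Hermitian matrices in coordinates: the polarisation of `-det`. -/
def form (c : ℝ) (x y : V4) : ℝ :=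
  -(x 0 * y 0) + x 1 * y 1 + x 2 * y 2 - c * (x 3 * y 3)

theorem det_herm (c : ℝ) (x : V4) :
    (herm c x).det = algebraMap ℝ (ShapeAlg c) (-form c x x) := by
  rw [Matrix.det_fin_two]
  ext <;> simp [herm, form] <;> ring

theorem form_eq_trace (c : ℝ) (x y : V4) :
    algebraMap ℝ (ShapeAlg c) (-2 * form c x y) =
      (herm c x * (herm c y).adjugate).trace := by
  rw [Matrix.trace_fin_two]
  ext <;> simp [herm, form, Matrix.adjugate_fin_two, Matrix.mul_apply, Fin.sum_univ_two] <;> ring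

/-- Real projective 3-space. -/
abbrev RP3 : Type := ℙ ℝ V4

/-- The quotient topology on projective space. -/
instance : TopologicalSpace RP3 :=
  TopologicalSpace.coinduced (Projectivization.mk' ℝ : {v : V4 // v ≠ 0} → RP3) inferInstance

/-- The group `GL(4, ℝ)`, acting on `RP3`. -/
abbrev GL4 : Type := LinearMap.GeneralLinearGroup ℝ V4

/-- The subgroup of `GL(4, ℝ)` that preserves the orientation of `ℝ⁴` (and of `RP3`). -/
def GL4pos : Subgroup GL4 where
  carrier := {g | 0 < LinearMap.det (g : V4 →ₗ[ℝ] V4)}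
  mul_mem' := by
    intro a b ha hb
    simp only [Set.mem_ofPred_eq, Units.val_mul, map_mul] at *
    exact mul_pos ha hb
  one_mem' := by simp
  inv_mem' := by
    intro a ha
    simp only [Set.mem_ofPred_eq] at *
    have h : LinearMap.det (a : V4 →ₗ[ℝ] V4) * LinearMap.det ((a⁻¹ : GL4) : V4 →ₗ[ℝ] V4) = 1 := by
      rw [← map_mul, ← Units.val_mul]; simp
    by_contra hn
    nlinarith [mul_nonneg ha.le (neg_nonneg.mpr (not_lt.mp hn))]

/-- The model space: the negative lines of the inner product. It is the projective model of
hyperbolic space for `c = -1`, of anti de Sitter space for `c = 1`, and of half-pipe space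
for `c = 0`. -/
def modelSpace (c : ℝ) : Set RP3 :=
  {p | ∃ (x : V4) (hx : x ≠ 0), p = Projectivization.mk ℝ x hx ∧ form c x x < 0}

/-- `g` acts on Hermitian matrices, up to a real factor, by `X ↦ A X A*`. -/
def ActsAs (c : ℝ) (g : GL4) (A : Matrix (Fin 2) (Fin 2) (ShapeAlg c)) : Prop :=
  ∃ r : ℝ, r ≠ 0 ∧ ∀ x : V4, herm c (g • x) = r • (A * herm c x * Aᴴ)

/-- The structure group `PGL⁺(2, ℝ + ℝκ)` of the model space: all linear maps that induce on
projective space the action `X ↦ A X A*` of some matrix `A` with `|det A|² > 0`. -/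
def modelGroup (c : ℝ) : Subgroup GL4 where
  carrier := {g | ∃ A : Matrix (Fin 2) (Fin 2) (ShapeAlg c),
    0 < QuadraticAlgebra.norm A.det ∧ ActsAs c g A}
  mul_mem' := by
    rintro a b ⟨A, hA, r, hr, ha⟩ ⟨B, hB, s, hs, hb⟩
    refine ⟨A * B, ?_, r * s, mul_ne_zero hr hs, fun x => ?_⟩
    · rw [Matrix.det_mul, map_mul]; exact mul_pos hA hB
    · rw [mul_smul, ha, hb, Matrix.conjTranspose_mul, mul_smul, Matrix.mul_smul, Matrix.smul_mul]
      simp only [Matrix.mul_assoc]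
  one_mem' := ⟨1, by simp, 1, one_ne_zero, fun x => by simp⟩
  inv_mem' := by
    rintro a ⟨A, hA, r, hr, ha⟩
    have hu : IsUnit A.det :=
      QuadraticAlgebra.isUnit_iff_norm_isUnit.mpr (isUnit_iff_ne_zero.mpr hA.ne')
    have h1 : A⁻¹ * A = 1 := Matrix.nonsing_inv_mul A hu
    have h2 : Aᴴ * (A⁻¹)ᴴ = 1 := by rw [← Matrix.conjTranspose_mul, h1, Matrix.conjTranspose_one]
    refine ⟨A⁻¹, ?_, r⁻¹, inv_ne_zero hr, fun x => ?_⟩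
    · have h3 : QuadraticAlgebra.norm (A⁻¹).det * QuadraticAlgebra.norm A.det = 1 := by
        rw [← map_mul, ← Matrix.det_mul, h1]; simp
      by_contra hn
      nlinarith [mul_nonneg hA.le (neg_nonneg.mpr (not_lt.mp hn))]
    · have h4 := ha (a⁻¹ • x)
      rw [smul_inv_smul] at h4
      rw [h4, Matrix.mul_smul, Matrix.smul_mul, smul_smul, inv_mul_cancel₀ hr, one_smul]
      calc herm c (a⁻¹ • x) = (A⁻¹ * A) * herm c (a⁻¹ • x) * (Aᴴ * (A⁻¹)ᴴ) := by
            rw [h1, h2, Matrix.one_mul, Matrix.mul_one]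
        _ = _ := by simp only [Matrix.mul_assoc]

/-! ## Geometric structures -/

/-- A `(G, X)`-structure on a space `M`, for `X` a region of projective space and `G` a group of
projective transformations: a maximal atlas of charts with values in `X` whose transition maps
are locally restrictions of elements of `G`. -/
structure GXStructure (G : Subgroup GL4) (X : Set RP3) (M : Type) [TopologicalSpace M] where
  /-- the maximal atlas -/
  charts : Set (OpenPartialHomeomorph M RP3)
  target_subset : ∀ φ ∈ charts, φ.target ⊆ X
  covers : ∀ x : M, ∃ φ ∈ charts, x ∈ φ.source
  compatible : ∀ φ ∈ charts, ∀ ψ ∈ charts, ∀ x ∈ φ.source ∩ ψ.source,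
    ∃ g ∈ G, ∀ᶠ y in 𝓝 x, ψ y = g • φ y
  maximal : ∀ φ : OpenPartialHomeomorph M RP3, φ.target ⊆ X →
    (∀ ψ ∈ charts, ∀ x ∈ φ.source ∩ ψ.source, ∃ g ∈ G, ∀ᶠ y in 𝓝 x, ψ y = g • φ y) →
    φ ∈ charts

/-- Real projective structures. Projective 3-space carries its standard orientation and the
charts are oriented, so that it makes sense to say that a tetrahedron is positively oriented. -/
abbrev ProjStructure (M : Type) [TopologicalSpace M] : Type :=
  GXStructure GL4pos Set.univ M

/-- Structures modelled on the model space of `ℝ + ℝκ`, `κ² = c`. -/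
abbrev ModelStructure (c : ℝ) (M : Type) [TopologicalSpace M] : Type :=
  GXStructure (modelGroup c) (modelSpace c) M

/-- Hyperbolic structures. -/
abbrev HypStructure (M : Type) [TopologicalSpace M] : Type := ModelStructure (-1) M

/-- Anti de Sitter structures. -/
abbrev AdSStructure (M : Type) [TopologicalSpace M] : Type := ModelStructure 1 M

/-- Half-pipe structures. -/
abbrev HPStructure (M : Type) [TopologicalSpace M] : Type := ModelStructure 0 M

/-- The projective structure `P` is conjugate to the `(G, X)`-structure `S`: an (orientation
preserving) projective transformation takes the charts of `S` to charts of `P`. -/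
def IsConjugate {G : Subgroup GL4} {X : Set RP3} {M : Type} [TopologicalSpace M]
    (P : ProjStructure M) (S : GXStructure G X M) : Prop :=
  ∃ g ∈ GL4pos, ∀ φ ∈ S.charts, ∃ ψ ∈ P.charts,
    ψ.source = φ.source ∧ ∀ y ∈ φ.source, ψ y = g • φ y

/-- A family of projective structures is a continuous path over the parameter set `I` if around
every point of `M` and for every parameter it has charts that are defined on a common
neighbourhood for all nearby parameters and are jointly continuous. -/
def IsContinuousPath {M : Type} [TopologicalSpace M] (I : Set ℝ) (P : ℝ → ProjStructure M) :
    Prop :=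
  ∀ t₀ ∈ I, ∀ x₀ : M, ∃ J ∈ 𝓝 t₀, ∃ U ∈ 𝓝 x₀, ∃ Φ : ℝ → OpenPartialHomeomorph M RP3,
    (∀ t ∈ J ∩ I, Φ t ∈ (P t).charts ∧ U ⊆ (Φ t).source) ∧
    ContinuousOn (fun q : ℝ × M => Φ q.1 q.2) ((J ∩ I) ×ˢ U)

/-! ## Ideal triangulations -/

/-- The standard 3-simplex with its vertices removed. -/
def IdealSimplex : Type := {s : V4 // (∀ i, 0 ≤ s i ∧ s i < 1) ∧ ∑ i, s i = 1}

instance : TopologicalSpace IdealSimplex := inferInstanceAs (TopologicalSpace (Subtype _))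

/-- An oriented ideal triangulation with `N` tetrahedra. Each tetrahedron has its vertices
labelled by `Fin 4` compatibly with the orientation; its face `a` is the one opposite to the
vertex `a`. The face `a` of the tetrahedron `j` is glued to a face of the tetrahedron `adj j a`
by sending the vertex `i ≠ a` to the vertex `glue j a i`; the face of `adj j a` used is the one
opposite to `glue j a a`. The gluing maps reverse the orientation of the faces, that is, the
permutations are odd. -/
structure IdealTriangulation (N : ℕ) where
  /-- the tetrahedron on the other side of a face -/
  adj : Fin N → Fin 4 → Fin N
  /-- the gluing permutation of a face -/
  glue : Fin N → Fin 4 → Equiv.Perm (Fin 4)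
  adj_adj : ∀ j a, adj (adj j a) (glue j a a) = j
  glue_glue : ∀ j a, glue (adj j a) (glue j a a) = (glue j a)⁻¹
  glue_odd : ∀ j a, Equiv.Perm.sign (glue j a) = -1
  not_self : ∀ j a, ¬ (adj j a = j ∧ glue j a a = a)

namespace IdealTriangulation

variable {N : ℕ} (T : IdealTriangulation N)

/-- The identification of the points of two glued faces. -/
def FaceRel (p q : Fin N × IdealSimplex) : Prop :=
  ∃ a : Fin 4, p.2.1 a = 0 ∧ q.1 = T.adj p.1 a ∧ ∀ i, q.2.1 (T.glue p.1 a i) = p.2.1 i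

/-- The triangulated 3-manifold `M`: the union of the tetrahedra, with vertices removed, glued
along their faces. -/
def Space : Type := Quot T.FaceRel

instance : TopologicalSpace T.Space := inferInstanceAs (TopologicalSpace (Quot _))

/-- The characteristic map of the tetrahedron `j`. -/
def toSpace (j : Fin N) (s : IdealSimplex) : T.Space := Quot.mk _ (j, s)

/-- The edges of the individual tetrahedra: a tetrahedron and a pair of its vertices. -/
abbrev TetEdge (N : ℕ) : Type := Fin N × {s : Finset (Fin 4) // s.card = 2}

/-- Two edges of tetrahedra correspond to each other under the gluing of one face. -/
def EdgeRel (x y : TetEdge N) : Prop :=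
  ∃ a : Fin 4, a ∉ x.2.1 ∧ y.1 = T.adj x.1 a ∧ y.2.1 = x.2.1.map (T.glue x.1 a).toEmbedding

open Classical in
/-- All edges of tetrahedra that are identified in `M` with the given one. -/
def edgeClass (e : TetEdge N) : Finset (TetEdge N) :=
  {x | Relation.EqvGen T.EdgeRel e x}

end IdealTriangulation

/-! ## Shape parameters and Thurston's equations -/

/-- The shape parameter at the edge `s` of a tetrahedron whose shape parameter at the edge `{0, 1}`
is `z`: opposite edges have the same parameter, and the three parameters are
`z`, `1 / (1 - z)` and `(z - 1) / z`. -/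
def edgeShape {R : Type} [CommRing R] (z : R) (s : Finset (Fin 4)) : R :=
  if s = {0, 1} ∨ s = {2, 3} then z
  else if s = {0, 2} ∨ s = {1, 3} then Ring.inverse (1 - z)
  else (z - 1) * Ring.inverse z

/-- The dihedral angle at an edge with shape parameter `z`, for a positively oriented tetrahedron:
the argument of `z` if `κ² < 0`, and, if `κ² ≥ 0`, the discrete rotational part of `z`, which
is `π` if the real part of `z` is negative and `0` otherwise. -/
def dihedralAngle {c : ℝ} (z : ShapeAlg c) : ℝ :=
  if c < 0 then Complex.arg ⟨z.re, √(-c) * z.im⟩ else if z.re < 0 then Real.pi else 0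

namespace IdealTriangulation

variable {N : ℕ} (T : IdealTriangulation N)

/-- The real deformation variety: real shape parameters, different from `0` and `1`, such that
the product of the shape parameters at each edge is `1` and exactly two of them are negative
(total dihedral angle `2π`). -/
def realDeformationVariety : Set (Fin N → ℝ) :=
  {z | (∀ j, z j ≠ 0 ∧ z j ≠ 1) ∧
    ∀ e : TetEdge N, ∏ x ∈ T.edgeClass e, edgeShape (z x.1) x.2.1 = 1 ∧
      ((T.edgeClass e).filter (fun x => edgeShape (z x.1) x.2.1 < 0)).card = 2}

/-- A solution over `ℝ + ℝκ` of Thurston's equations (edge equations and total dihedral angle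
`2π`) by shape parameters of positively oriented ideal tetrahedra. -/
def IsPositiveSolution {c : ℝ} (w : Fin N → ShapeAlg c) : Prop :=
  (∀ j, 0 < QuadraticAlgebra.norm (w j) ∧ 0 < QuadraticAlgebra.norm (1 - w j) ∧ 0 < (w j).im) ∧
  ∀ e : TetEdge N, ∏ x ∈ T.edgeClass e, edgeShape (w x.1) x.2.1 = 1 ∧
    ∑ x ∈ T.edgeClass e, dihedralAngle (edgeShape (w x.1) x.2.1) = 2 * Real.pi

/-- `w` is a path, defined for `0 ≤ t < δ`, of shape parameters over `ℝ + ℝκ` that starts at the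
real solution `z` with initial velocity `κ v` and that, for `0 < t < δ`, consists of positively
oriented solutions of Thurston's equations. -/
structure IsRegeneration {c : ℝ} (z v : Fin N → ℝ) (δ : ℝ) (w : ℝ → Fin N → ShapeAlg c) :
    Prop where
  continuousOn_re : ∀ j, ContinuousOn (fun t => (w t j).re) (Set.Ico 0 δ)
  continuousOn_im : ∀ j, ContinuousOn (fun t => (w t j).im) (Set.Ico 0 δ)
  start : ∀ j, w 0 j = ⟨z j, 0⟩
  hasDeriv_re : ∀ j, HasDerivWithinAt (fun t => (w t j).re) 0 (Set.Ici 0) 0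
  hasDeriv_im : ∀ j, HasDerivWithinAt (fun t => (w t j).im) (v j) (Set.Ici 0) 0
  solution : ∀ t ∈ Set.Ioo 0 δ, T.IsPositiveSolution (w t)

end IdealTriangulation

/-! ## Geometric realization of a triangulation -/

/-- `Z₀, …, Z₃` are representatives of the vertices of an ideal tetrahedron: they are null
vectors with negative mutual inner products. -/
def IsIdealTetrahedron (c : ℝ) (Z : Fin 4 → V4) : Prop :=
  (∀ i, form c (Z i) (Z i) = 0) ∧ ∀ i k, i ≠ k → form c (Z i) (Z k) < 0

/-- The tetrahedron is positively oriented in projective space with its standard orientation. -/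
def IsPositivelyOriented (Z : Fin 4 → V4) : Prop := 0 < (Matrix.of Z).det

/-- The ordered vertices `Z₀, …, Z₃` have the shape parameter (generalized cross ratio) `w`:
some `A ∈ PGL⁺(2, ℝ + ℝκ)` takes them to `∞ = [1 : 0]`, `0 = [0 : 1]`, `1 = [1 : 1]` and
`w = [w : 1]`, where `[v]` stands for the line of `v v*`. -/
def HasShape (c : ℝ) (Z : Fin 4 → V4) (w : ShapeAlg c) : Prop :=
  ∃ A : Matrix (Fin 2) (Fin 2) (ShapeAlg c), 0 < QuadraticAlgebra.norm A.det ∧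
    ∀ i, ∃ r : ℝ, r ≠ 0 ∧ A * herm c (Z i) * Aᴴ =
      r • Matrix.vecMulVec ((![![1, 0], ![0, 1], ![1, 1], ![w, 1]] : Fin 4 → Fin 2 → ShapeAlg c) i)
        (star ((![![1, 0], ![0, 1], ![1, 1], ![w, 1]] : Fin 4 → Fin 2 → ShapeAlg c) i))

namespace IdealTriangulation

variable {N : ℕ} (T : IdealTriangulation N)

/-- In the structure `S` on `M`, the tetrahedron `j` is realized as the straight simplex with
vertices `Z₀, …, Z₃` (without the vertices): `F` is a developing map of the tetrahedron, and `F`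
is, up to a face-preserving reparametrization `h` of the standard simplex, the map
`s ↦ [s₀ Z₀ + s₁ Z₁ + s₂ Z₂ + s₃ Z₃]`. -/
def IsRealizedAs {G : Subgroup GL4} {X : Set RP3} (S : GXStructure G X T.Space) (j : Fin N)
    (Z : Fin 4 → V4) : Prop :=
  ∃ (h : IdealSimplex ≃ₜ IdealSimplex) (F : IdealSimplex → RP3),
    (∀ s a, (h s).1 a = 0 ↔ s.1 a = 0) ∧
    (∀ s, ∃ hs : ∑ i, (h s).1 i • Z i ≠ 0,
      F s = Projectivization.mk ℝ (∑ i, (h s).1 i • Z i) hs) ∧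
    ∀ s, ∀ φ ∈ S.charts, T.toSpace j s ∈ φ.source →
      ∃ g ∈ G, ∀ᶠ s' in 𝓝 s, φ (T.toSpace j s') = g • F s'

/-- The triangulation is realized in `S` by positively oriented ideal tetrahedra with shape
parameters `w`. -/
def IsTriangulatedWithShapes {c : ℝ} (S : ModelStructure c T.Space) (w : Fin N → ShapeAlg c) :
    Prop :=
  ∀ j, ∃ Z : Fin 4 → V4, IsIdealTetrahedron c Z ∧ IsPositivelyOriented Z ∧ HasShape c Z (w j) ∧
    T.IsRealizedAs S j Z

/-- The triangulation is realized in the projective structure `P` by positively oriented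
tetrahedra. -/
def IsPositivelyRealized (P : ProjStructure T.Space) : Prop :=
  ∀ j, ∃ Z : Fin 4 → V4, IsPositivelyOriented Z ∧ T.IsRealizedAs P j Z

end IdealTriangulation

/-! ## Smooth points and tangent vectors -/

/-- `D` is smooth at its point `z`: near `z` it is a (real-analytic) submanifold, that is, an
analytic change of coordinates flattens `D` to a linear subspace. -/
def IsSmoothAt {n : ℕ} (D : Set (Fin n → ℝ)) (z : Fin n → ℝ) : Prop :=
  z ∈ D ∧ ∃ (Φ : OpenPartialHomeomorph (Fin n → ℝ) (Fin n → ℝ)) (W : Submodule ℝ (Fin n → ℝ)),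
    z ∈ Φ.source ∧ ContDiffOn ℝ ω Φ Φ.source ∧ ContDiffOn ℝ ω Φ.symm Φ.target ∧
    ∀ x ∈ Φ.source, x ∈ D ↔ Φ x ∈ W

/-- `v` is a tangent vector to `D` at `z`: the velocity of a curve in `D` through `z`. -/
def IsTangentVector {n : ℕ} (D : Set (Fin n → ℝ)) (z v : Fin n → ℝ) : Prop :=
  ∃ γ : ℝ → Fin n → ℝ, γ 0 = z ∧ (∀ᶠ t in 𝓝 0, γ t ∈ D) ∧ HasDerivAt γ v 0

end

open scoped LinearAlgebra.Projectivization ContDiff Topology Matrix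

noncomputable section

/-! ## The action of `2 × 2` matrices on Hermitian matrices -/

section HermitianAction

variable {c : ℝ}

/-! The construction is uniform in the real number c, so that the transition becomes one continuous
family. If c = t²c', sending κ to tκ' identifies `ShapeAlg c` with `ShapeAlg c'`. On ℝ⁴ this
multiplies the last coordinate by t, which for t > 0 preserves orientation. At the parameter y put
κ² = -y|y|. The hyperbolic solution ζ(y) becomes Re ζ + (Im ζ / y)κ, the AdS solution ξ(|y|) becomes
Re ξ + (Im ξ / |y|)κ, and both tend to z + vσ as y → 0, by the prescribed initial value and
velocity. The limit is again a positive solution: the edge products are 1 by continuity, and the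
angles are right because the real part is a ring homomorphism on the dual numbers and exactly two
edge parameters of z are negative. So (b) follows (`exists_transition`) once a positive solution
over any c yields a structure that depends continuously on the solution and is only conjugated by
rescaling.

The structure of a solution: a flag is a tetrahedron with an even ordering of its vertices. Its
first two vertices are developed to ∞ and 0, its third to the product u_f of the parameters passed
so far (`turn`). The edge equation makes the placement consistent, and total angle 2π makes the
sectors from u_f to u_{f+1} tile the plane exactly once
(`exists_unique_sector_of_sum_dihedralAngle`). For c ≥ 0 an angle is lifted as the arctangent of the
slope plus π for every change of sign of the real part. Developing around an edge therefore embeds a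
neighbourhood of the edge, of a face or of an interior point as an open set. These charts are
compatible by rigidity: a transformation that fixes three vertices of an ideal tetrahedron is
trivial (`exists_smul_of_fixes_face`).

The faces of M are glued by barycentric coordinates, but vectors representing the vertices of a face
agree on its two sides only up to scalings l_i. Each simplex is therefore reparametrized by s_i ↦
s_i exp(∑ s_k r_ki), normalized, with antisymmetric r that changes by log l_k - log l_i across a
face. Such r comes from the scalings of the two ends of an edge under development
(`edgeRatio_across`). For any antisymmetric r the map is a face-preserving homeomorphism
(`simplexMap_injective`, `simplexMap_surjective`). Since r depends only on norms and inner products,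
it varies continuously and is unchanged by rescaling.

For (a), the flattening chart gives an analytic curve γ in the deformation variety with velocity v,
into which it and τt are substituted. The first uses the holomorphic extension of γ and the identity
theorem; the arguments at an edge then sum to a multiple of 2π close to 2π. The second uses ℝ + ℝτ ≅
ℝ × ℝ, where γ(τt) is the pair (γ(t), γ(-t)) of real solutions. -/

theorem herm_injective (c : ℝ) : Function.Injective (herm c) := by
  intro x y h
  have h00 := congrArg QuadraticAlgebra.re (congrFun (congrFun h 0) 0)
  have h11 := congrArg QuadraticAlgebra.re (congrFun (congrFun h 1) 1)
  have h10 := congrFun (congrFun h 1) 0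
  have h2 := congrArg QuadraticAlgebra.re h10
  have h3 := congrArg QuadraticAlgebra.im h10
  simp [herm] at h00 h11 h2 h3
  ext i
  fin_cases i <;> simp <;> linarith

theorem herm_add (x y : V4) : herm c (x + y) = herm c x + herm c y := by
  ext i j <;> fin_cases i <;> fin_cases j <;> simp [herm] <;> ring

theorem herm_smul (r : ℝ) (x : V4) : herm c (r • x) = r • herm c x := by
  ext i j <;> fin_cases i <;> fin_cases j <;> simp [herm] <;> ring

theorem conjTranspose_herm (x : V4) : (herm c x)ᴴ = herm c x := by
  ext i j <;> fin_cases i <;> fin_cases j <;> simp [herm, Matrix.conjTranspose_apply]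

/-- The coordinates of a Hermitian matrix. -/
def hermCoord (c : ℝ) : Matrix (Fin 2) (Fin 2) (ShapeAlg c) →ₗ[ℝ] V4 where
  toFun M := ![((M 0 0).re + (M 1 1).re) / 2, ((M 0 0).re - (M 1 1).re) / 2, (M 1 0).re, (M 1 0).im]
  map_add' M M' := by ext i; fin_cases i <;> simp <;> ring
  map_smul' r M := by ext i; fin_cases i <;> simp <;> ring

theorem herm_hermCoord {M : Matrix (Fin 2) (Fin 2) (ShapeAlg c)} (h : Mᴴ = M) :
    herm c (hermCoord c M) = M := by
  have h00 := congrArg QuadraticAlgebra.im (congrFun (congrFun h 0) 0)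
  have h11 := congrArg QuadraticAlgebra.im (congrFun (congrFun h 1) 1)
  have h01 := congrFun (congrFun h 0) 1
  have h2 := congrArg QuadraticAlgebra.re h01
  have h3 := congrArg QuadraticAlgebra.im h01
  simp [Matrix.conjTranspose_apply] at h00 h11 h2 h3
  ext i j <;> fin_cases i <;> fin_cases j <;> simp [herm, hermCoord] <;> linarith

/-- The linear map `X ↦ A X A*` in coordinates. -/
def hermAct (A : Matrix (Fin 2) (Fin 2) (ShapeAlg c)) : V4 →ₗ[ℝ] V4 where
  toFun x := hermCoord c (A * herm c x * Aᴴ)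
  map_add' x y := by rw [herm_add, Matrix.mul_add, Matrix.add_mul, map_add]
  map_smul' r x := by
    rw [herm_smul, Matrix.mul_smul, Matrix.smul_mul, map_smul, RingHom.id_apply]

theorem herm_hermAct (A : Matrix (Fin 2) (Fin 2) (ShapeAlg c)) (x : V4) :
    herm c (hermAct A x) = A * herm c x * Aᴴ := by
  apply herm_hermCoord
  rw [Matrix.conjTranspose_mul, Matrix.conjTranspose_mul, Matrix.conjTranspose_conjTranspose,
    conjTranspose_herm, Matrix.mul_assoc]

theorem hermAct_mul (A B : Matrix (Fin 2) (Fin 2) (ShapeAlg c)) :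
    hermAct (A * B) = hermAct A * hermAct B := by
  refine LinearMap.ext fun x => ?_
  apply herm_injective c
  simp only [Module.End.mul_apply, herm_hermAct, Matrix.conjTranspose_mul, Matrix.mul_assoc]

theorem hermAct_one : hermAct (1 : Matrix (Fin 2) (Fin 2) (ShapeAlg c)) = 1 := by
  refine LinearMap.ext fun x => ?_
  apply herm_injective c
  simp [herm_hermAct]

theorem form_comm (x y : V4) : form c x y = form c y x := by
  simp only [form]; ring

/-- Passing from X to A X A* multiplies the determinant by det A times its conjugate; polarisation
extends this to the bilinear form. When |det A|² > 0, negative vectors stay negative. -/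
theorem form_hermAct (A : Matrix (Fin 2) (Fin 2) (ShapeAlg c)) (x y : V4) :
    form c (hermAct A x) (hermAct A y) = QuadraticAlgebra.norm A.det * form c x y := by
  have hq : ∀ x : V4, form c (hermAct A x) (hermAct A x) =
      QuadraticAlgebra.norm A.det * form c x x := by
    intro x
    have h := det_herm c (hermAct A x)
    rw [herm_hermAct, Matrix.det_mul, Matrix.det_mul, Matrix.det_conjTranspose, det_herm,
      mul_right_comm, ← QuadraticAlgebra.algebraMap_norm_eq_mul_star, ← map_mul,
      QuadraticAlgebra.algebraMap_inj] at h
    linarith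
  have h1 := hq (x + y)
  have h2 := hq x
  have h3 := hq y
  rw [map_add] at h1
  have hp : ∀ x y : V4, form c (x + y) (x + y) = form c x x + form c y y + 2 * form c x y := by
    intro x y; simp only [form, Pi.add_apply]; ring
  rw [hp, hp] at h1
  linarith

/-- The null vector that represents the Hermitian matrix `p p*`. -/
def nullVec (p : Fin 2 → ShapeAlg c) : V4 := hermCoord c (Matrix.vecMulVec p (star p))

theorem herm_nullVec (p : Fin 2 → ShapeAlg c) :
    herm c (nullVec p) = Matrix.vecMulVec p (star p) := by
  apply herm_hermCoord
  rw [Matrix.conjTranspose_vecMulVec, star_star]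

theorem hermAct_nullVec (A : Matrix (Fin 2) (Fin 2) (ShapeAlg c)) (p : Fin 2 → ShapeAlg c) :
    hermAct A (nullVec p) = nullVec (A *ᵥ p) := by
  apply herm_injective c
  rw [herm_hermAct, herm_nullVec, herm_nullVec, Matrix.mul_vecMulVec, Matrix.vecMulVec_mul,
    Matrix.star_mulVec]

theorem nullVec_smul (a : ShapeAlg c) (p : Fin 2 → ShapeAlg c) :
    nullVec (a • p) = QuadraticAlgebra.norm a • nullVec p := by
  apply herm_injective c
  rw [herm_smul, herm_nullVec, herm_nullVec]
  ext i j <;> simp [Matrix.vecMulVec_apply, QuadraticAlgebra.norm_def] <;> ring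

/-- This turns the conditions on the vertices of an ideal tetrahedron into positivity of norms of 2
× 2 determinants. -/
theorem form_nullVec (p q : Fin 2 → ShapeAlg c) :
    form c (nullVec p) (nullVec q) =
      -(1 / 2) * QuadraticAlgebra.norm (p 0 * q 1 - p 1 * q 0) := by
  simp only [form, nullVec, hermCoord, LinearMap.coe_mk, AddHom.coe_mk, Matrix.vecMulVec_apply,
    QuadraticAlgebra.norm_def, Pi.star_apply]
  simp
  ring

theorem nullVec_apply (a b : ShapeAlg c) :
    nullVec ![a, b] = ![(QuadraticAlgebra.norm a + QuadraticAlgebra.norm b) / 2,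
      (QuadraticAlgebra.norm a - QuadraticAlgebra.norm b) / 2,
      (b * star a).re, (b * star a).im] := by
  ext i
  fin_cases i <;> simp [nullVec, hermCoord, QuadraticAlgebra.norm_def] <;> ring

theorem nullVec_pair (u : ShapeAlg c) :
    nullVec ![u, 1] = ![(QuadraticAlgebra.norm u + 1) / 2, (QuadraticAlgebra.norm u - 1) / 2,
      u.re, -u.im] := by
  rw [nullVec_apply]
  simp

theorem nullVec_infinity : nullVec (![1, 0] : Fin 2 → ShapeAlg c) = ![1 / 2, 1 / 2, 0, 0] := by
  rw [nullVec_apply]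
  simp

theorem nullVec_zero : nullVec (![0, 1] : Fin 2 → ShapeAlg c) = ![1 / 2, -1 / 2, 0, 0] := by
  rw [nullVec_apply]
  simp

/-- The action of the matrices with invertible determinant, as a homomorphism to `GL(4, ℝ)`. -/
def hermActUnits : (Matrix (Fin 2) (Fin 2) (ShapeAlg c))ˣ →* GL4 :=
  Units.map { toFun := hermAct, map_one' := hermAct_one, map_mul' := hermAct_mul }

theorem hermActUnits_smul (A : (Matrix (Fin 2) (Fin 2) (ShapeAlg c))ˣ) (x : V4) :
    hermActUnits A • x = hermAct A.1 x := rfl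

theorem isUnit_of_norm_pos {a : ShapeAlg c} (h : 0 < QuadraticAlgebra.norm a) : IsUnit a :=
  QuadraticAlgebra.isUnit_iff_norm_isUnit.mpr (isUnit_iff_ne_zero.mpr h.ne')

theorem hermActUnits_mem {A : (Matrix (Fin 2) (Fin 2) (ShapeAlg c))ˣ}
    (h : 0 < QuadraticAlgebra.norm A.1.det) : hermActUnits A ∈ modelGroup c :=
  ⟨A.1, h, 1, one_ne_zero, fun x => by rw [hermActUnits_smul, herm_hermAct, one_smul]⟩

theorem exists_hermAct_of_mem_modelGroup {g : GL4} (hg : g ∈ modelGroup c) :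
    ∃ A : Matrix (Fin 2) (Fin 2) (ShapeAlg c), 0 < QuadraticAlgebra.norm A.det ∧
      ∃ r : ℝ, r ≠ 0 ∧ ∀ x : V4, g • x = r • hermAct A x := by
  obtain ⟨A, hA, r, hr, h⟩ := hg
  refine ⟨A, hA, r, hr, fun x => herm_injective c ?_⟩
  rw [h, herm_smul, herm_hermAct]

-- A polynomial identity in c and the eight real coordinates of A, so neither invertibility nor a
-- sign of c matters. The value is a square, which is why the structure groups preserve the
-- orientation of ℝ⁴.
set_option maxHeartbeats 4000000 in
theorem det_hermAct (A : Matrix (Fin 2) (Fin 2) (ShapeAlg c)) :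
    LinearMap.det (hermAct A) = QuadraticAlgebra.norm A.det ^ 2 := by
  rw [← LinearMap.det_toMatrix', Matrix.det_succ_row_zero]
  simp only [Matrix.det_fin_three, Fin.sum_univ_four, Matrix.submatrix_apply,
    LinearMap.toMatrix'_apply, Matrix.det_fin_two, QuadraticAlgebra.norm_def]
  have h : ∀ x, hermAct A x = hermCoord c (A * herm c x * Aᴴ) := fun x => rfl
  generalize hp : A 0 0 = p 
  generalize hq : A 0 1 = q
  generalize hr : A 1 0 = r
  generalize hs : A 1 1 = s
  simp [h, hermCoord, Matrix.mul_apply, herm, Fin.sum_univ_two, hp, hq, hr, hs, Fin.succAbove, Matrix.conjTranspose_apply]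
  generalize p.re = p1, p.im = p2, q.re = q1, q.im = q2, r.re = r1, r.im = r2, s.re = s1, s.im = s2
  ring

theorem modelGroup_le_GL4pos (c : ℝ) : modelGroup c ≤ GL4pos := by
  intro g hg
  obtain ⟨A, hA, r, hr, h⟩ := exists_hermAct_of_mem_modelGroup hg
  have h1 : (g : V4 →ₗ[ℝ] V4) = r • hermAct A := LinearMap.ext h
  change 0 < LinearMap.det (g : V4 →ₗ[ℝ] V4)
  rw [h1, LinearMap.det_smul, det_hermAct]
  simp only [Module.finrank_fintype_fun_eq_card, Fintype.card_fin]
  have := (even_two_mul 2).pow_pos hr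
  positivity

end HermitianAction

/-! ## Ideal tetrahedra in standard position -/

section StandardTetrahedra

variable {c : ℝ}

/-- The points `∞, 0, 1, w`. -/
def idealPoint (w : ShapeAlg c) : Fin 4 → Fin 2 → ShapeAlg c :=
  ![![1, 0], ![0, 1], ![1, 1], ![w, 1]]

/-- The vertices of the ideal tetrahedron `∞, 0, 1, w`. -/
def tetVertex (w : ShapeAlg c) (i : Fin 4) : V4 := nullVec (idealPoint w i)

/-- The shape parameters of positively oriented ideal tetrahedra. -/
def IsPositiveShape (w : ShapeAlg c) : Prop :=
  0 < QuadraticAlgebra.norm w ∧ 0 < QuadraticAlgebra.norm (1 - w) ∧ 0 < w.im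

/-- The determinant of two vectors. -/
def pairDet (p q : Fin 2 → ShapeAlg c) : ShapeAlg c := p 0 * q 1 - p 1 * q 0

/-- Up to sign, the determinants of pairs among ∞, 0, 1, w are 1 (four times), w and 1 - w. -/
theorem norm_pairDet_pos {w : ShapeAlg c} (hw : IsPositiveShape w) {i k : Fin 4} (hik : i ≠ k) :
    0 < QuadraticAlgebra.norm (pairDet (idealPoint w i) (idealPoint w k)) := by
  have h1 : QuadraticAlgebra.norm (w - 1) = QuadraticAlgebra.norm (1 - w) := by
    rw [← QuadraticAlgebra.norm_neg, neg_sub]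
  obtain ⟨h2, h3, -⟩ := hw
  fin_cases i <;> fin_cases k <;> simp_all [pairDet, idealPoint]

theorem isIdealTetrahedron_tetVertex {w : ShapeAlg c} (hw : IsPositiveShape w) :
    IsIdealTetrahedron c (tetVertex w) := by
  refine ⟨fun i => ?_, fun i k hik => ?_⟩
  · rw [tetVertex, form_nullVec, mul_comm (idealPoint w i 0), sub_self,
      QuadraticAlgebra.norm_zero, mul_zero]
  · have := norm_pairDet_pos hw hik
    rw [tetVertex, tetVertex, form_nullVec]
    rw [pairDet] at this
    linarith

/-- The determinant of the four vertices is Im w / 2, whatever c is. -/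
theorem isPositivelyOriented_tetVertex {w : ShapeAlg c} (hw : 0 < w.im) :
    IsPositivelyOriented (tetVertex w) := by
  have h : Matrix.of (tetVertex w) = Matrix.of ![![1 / 2, 1 / 2, 0, 0], ![1 / 2, -1 / 2, 0, 0],
      ![1, 0, 1, 0], ![(QuadraticAlgebra.norm w + 1) / 2, (QuadraticAlgebra.norm w - 1) / 2,
        w.re, -w.im]] := by
    congr 1
    funext i
    fin_cases i
    · exact nullVec_infinity
    · exact nullVec_zero
    · refine (nullVec_pair 1).trans ?_
      simp [QuadraticAlgebra.re_one, QuadraticAlgebra.im_one]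
    · exact nullVec_pair w
  rw [IsPositivelyOriented, h, Matrix.det_succ_row_zero]
  simp [Fin.sum_univ_four, Matrix.det_fin_three, Fin.succAbove]
  linarith

theorem hasShape_tetVertex (w : ShapeAlg c) : HasShape c (tetVertex w) w := by
  refine ⟨1, by simp, fun i => ⟨1, one_ne_zero, ?_⟩⟩
  rw [Matrix.conjTranspose_one, Matrix.one_mul, Matrix.mul_one, tetVertex, herm_nullVec, one_smul]
  rfl

/-! ### Moving an edge of a tetrahedron to standard position -/

theorem even_perm_cases : ∀ σ : Equiv.Perm (Fin 4), Equiv.Perm.sign σ = 1 →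
    (σ 0, σ 1, σ 2, σ 3) ∈ [((0, 1, 2, 3) : Fin 4 × Fin 4 × Fin 4 × Fin 4), (0, 2, 3, 1),
      (0, 3, 1, 2), (1, 0, 3, 2), (1, 2, 0, 3), (1, 3, 2, 0), (2, 0, 1, 3), (2, 1, 3, 0),
      (2, 3, 0, 1), (3, 0, 2, 1), (3, 1, 0, 2), (3, 2, 1, 0)] := by
  decide

/-- The shape parameter of a tetrahedron at the edge joining its vertices `σ 0` and `σ 1`. -/
def flagShape {R : Type} [CommRing R] (w : R) (σ : Equiv.Perm (Fin 4)) : R :=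
  edgeShape w {σ 0, σ 1}

/-- The edge parameter is the cross ratio of the reordered vertices, with denominators cleared.
Evenness of σ is essential: exchanging the last two vertices inverts the cross ratio but keeps the
edge. -/
theorem flagShape_mul {w : ShapeAlg c} (hw : IsPositiveShape w) {σ : Equiv.Perm (Fin 4)}
    (hσ : Equiv.Perm.sign σ = 1) :
    flagShape w σ * (pairDet (idealPoint w (σ 3)) (idealPoint w (σ 0)) *
        pairDet (idealPoint w (σ 2)) (idealPoint w (σ 1))) =
      pairDet (idealPoint w (σ 3)) (idealPoint w (σ 1)) *
        pairDet (idealPoint w (σ 2)) (idealPoint w (σ 0)) := by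
  have h1 : w * Ring.inverse w = 1 := Ring.mul_inverse_cancel _ (isUnit_of_norm_pos hw.1)
  have h2 : (1 - w) * Ring.inverse (1 - w) = 1 :=
    Ring.mul_inverse_cancel _ (isUnit_of_norm_pos hw.2.1)
  have h := even_perm_cases σ hσ
  simp only [List.mem_cons, Prod.mk.injEq, List.not_mem_nil, or_false] at h
  have e1 : edgeShape w {1, 0} = edgeShape w {0, 1} := by rw [Finset.pair_comm]
  have e2 : edgeShape w {0, 1} = w := by simp [edgeShape]
  have e3 : edgeShape w {2, 3} = w := by simp [edgeShape]
  have e4 : edgeShape w {0, 2} = Ring.inverse (1 - w) := by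
    rw [edgeShape, if_neg (by decide), if_pos (by decide)]
  have e5 : edgeShape w {1, 3} = Ring.inverse (1 - w) := by
    rw [edgeShape, if_neg (by decide), if_pos (by decide)]
  have e6 : edgeShape w {0, 3} = (w - 1) * Ring.inverse w := by
    rw [edgeShape, if_neg (by decide), if_neg (by decide)]
  have e7 : edgeShape w {1, 2} = (w - 1) * Ring.inverse w := by
    rw [edgeShape, if_neg (by decide), if_neg (by decide)]
  rw [flagShape]
  rcases h with h | h | h | h | h | h | h | h | h | h | h | h <;> obtain ⟨a, b, d, e⟩ := h <;>
    rw [a, b, d, e]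
  · rw [e2]; simp [pairDet, idealPoint]
  · rw [e4]; simp [pairDet, idealPoint]; linear_combination h2
  · rw [e6]; simp [pairDet, idealPoint]; linear_combination (w - 1) * h1
  · rw [e1, e2]; simp [pairDet, idealPoint]
  · rw [e7]; simp [pairDet, idealPoint]; linear_combination (w - 1) * h1
  · rw [e5]; simp [pairDet, idealPoint]; linear_combination h2
  · rw [Finset.pair_comm, e4]; simp [pairDet, idealPoint]; linear_combination h2
  · rw [Finset.pair_comm, e7]; simp [pairDet, idealPoint]; linear_combination (w - 1) * h1
  · rw [e3]; simp [pairDet, idealPoint]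
  · rw [Finset.pair_comm, e6]; simp [pairDet, idealPoint]; linear_combination (w - 1) * h1
  · rw [Finset.pair_comm, e5]; simp [pairDet, idealPoint]; linear_combination h2
  · rw [Finset.pair_comm, e3]; simp [pairDet, idealPoint]

/-- The null vector of the point `∞`. -/
def vecInf : V4 := ![1 / 2, 1 / 2, 0, 0]

/-- The null vector of the point `0`. -/
def vecZero : V4 := ![1 / 2, -1 / 2, 0, 0]

/-- The vertices of a tetrahedron with edge `∞, 0` and further vertices `u, u'`. -/
def frameVec (u u' : ShapeAlg c) : Fin 4 → V4 := ![vecInf, vecZero, nullVec ![u, 1], nullVec ![u', 1]]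

theorem hermAct_diagonal_vecInf (u : ShapeAlg c) :
    hermAct (Matrix.diagonal ![u, 1]) vecInf = QuadraticAlgebra.norm u • vecInf := by
  have h := nullVec_smul u (![1, 0] : Fin 2 → ShapeAlg c)
  rw [nullVec_infinity] at h
  rw [vecInf, ← h, ← nullVec_infinity (c := c), hermAct_nullVec]
  congr 1
  ext i <;> fin_cases i <;> simp [Matrix.mulVec_diagonal]

theorem hermAct_diagonal_vecZero (u : ShapeAlg c) :
    hermAct (Matrix.diagonal ![u, 1]) vecZero = vecZero := by
  rw [vecZero, ← nullVec_zero (c := c), hermAct_nullVec]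
  congr 1
  ext i <;> fin_cases i <;> simp [Matrix.mulVec_diagonal]

theorem hermAct_diagonal_nullVec (u x : ShapeAlg c) :
    hermAct (Matrix.diagonal ![u, 1]) (nullVec ![x, 1]) = nullVec ![u * x, 1] := by
  rw [hermAct_nullVec]
  congr 1
  ext i <;> fin_cases i <;> simp [Matrix.mulVec_diagonal]

/-- The matrix that takes the vertices `σ 0, σ 1, σ 2` of the tetrahedron `∞, 0, 1, w` to
`∞, 0, 1`. -/
def flagMatrix (w : ShapeAlg c) (σ : Equiv.Perm (Fin 4)) : Matrix (Fin 2) (Fin 2) (ShapeAlg c) :=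
  let x := idealPoint w (σ 0)
  let y := idealPoint w (σ 1)
  let z := idealPoint w (σ 2)
  !![y 1 * pairDet z x, -(y 0 * pairDet z x); x 1 * pairDet z y, -(x 0 * pairDet z y)]

theorem flagMatrix_mulVec (w : ShapeAlg c) (σ : Equiv.Perm (Fin 4)) (p : Fin 2 → ShapeAlg c) :
    flagMatrix w σ *ᵥ p =
      ![pairDet p (idealPoint w (σ 1)) * pairDet (idealPoint w (σ 2)) (idealPoint w (σ 0)),
        pairDet p (idealPoint w (σ 0)) * pairDet (idealPoint w (σ 2)) (idealPoint w (σ 1))] := by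
  ext1 i
  fin_cases i <;> simp [flagMatrix, Matrix.mulVec, dotProduct, Fin.sum_univ_two, pairDet] <;> ring

theorem norm_det_flagMatrix_pos {w : ShapeAlg c} (hw : IsPositiveShape w)
    (σ : Equiv.Perm (Fin 4)) : 0 < QuadraticAlgebra.norm (flagMatrix w σ).det := by
  have h : (flagMatrix w σ).det =
      pairDet (idealPoint w (σ 2)) (idealPoint w (σ 0)) *
        pairDet (idealPoint w (σ 2)) (idealPoint w (σ 1)) *
          pairDet (idealPoint w (σ 1)) (idealPoint w (σ 0)) := by
    rw [Matrix.det_fin_two]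
    simp [flagMatrix, pairDet]
    ring
  rw [h, map_mul, map_mul]
  exact mul_pos (mul_pos (norm_pairDet_pos hw (by simp)) (norm_pairDet_pos hw (by simp)))
    (norm_pairDet_pos hw (by simp))

theorem pairDet_self (p : Fin 2 → ShapeAlg c) : pairDet p p = 0 := by
  rw [pairDet, mul_comm, sub_self]

/-- The scalars are norms of products of two determinants of vertices, hence positive; the later
convexity arguments rest on this sign. The parameter enters only at the fourth vertex, through
`flagShape_mul`. -/
theorem exists_hermAct_flagMatrix {w : ShapeAlg c} (hw : IsPositiveShape w)
    {σ : Equiv.Perm (Fin 4)} (hσ : Equiv.Perm.sign σ = 1) :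
    ∃ μ : Fin 4 → ℝ, (∀ i, 0 < μ i) ∧ ∀ i,
      hermAct (flagMatrix w σ) (tetVertex w (σ i)) = μ i • frameVec 1 (flagShape w σ) i := by
  have hpos : ∀ i k i' k' : Fin 4, i ≠ k → i' ≠ k' → 0 < QuadraticAlgebra.norm
      (pairDet (idealPoint w (σ i)) (idealPoint w (σ k)) *
        pairDet (idealPoint w (σ i')) (idealPoint w (σ k'))) := by
    intro i k i' k' h h'
    rw [map_mul]
    exact mul_pos (norm_pairDet_pos hw (by simpa)) (norm_pairDet_pos hw (by simpa))
  suffices h : ∀ i, ∃ a : ℝ, 0 < a ∧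
      hermAct (flagMatrix w σ) (tetVertex w (σ i)) = a • frameVec 1 (flagShape w σ) i by
    choose μ hμ using h
    exact ⟨μ, fun i => (hμ i).1, fun i => (hμ i).2⟩
  intro i
  have hact : ∀ (a : ShapeAlg c) (q : Fin 2 → ShapeAlg c),
      flagMatrix w σ *ᵥ idealPoint w (σ i) = a • q →
      hermAct (flagMatrix w σ) (tetVertex w (σ i)) = QuadraticAlgebra.norm a • nullVec q := by
    intro a q h
    rw [tetVertex, hermAct_nullVec, h, nullVec_smul]
  have hm := flagMatrix_mulVec w σ (idealPoint w (σ i))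
  fin_cases i
  · refine ⟨_, hpos 0 1 2 0 (by decide) (by decide),
      (hact (pairDet (idealPoint w (σ 0)) (idealPoint w (σ 1)) *
        pairDet (idealPoint w (σ 2)) (idealPoint w (σ 0))) ![1, 0] ?_).trans ?_⟩
    · rw [hm]
      ext1 k
      fin_cases k <;> simp [pairDet_self]
    · rw [nullVec_infinity]; rfl
  · refine ⟨_, hpos 1 0 2 1 (by decide) (by decide),
      (hact (pairDet (idealPoint w (σ 1)) (idealPoint w (σ 0)) *
        pairDet (idealPoint w (σ 2)) (idealPoint w (σ 1))) ![0, 1] ?_).trans ?_⟩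
    · rw [hm]
      ext1 k
      fin_cases k <;> simp [pairDet_self]
    · rw [nullVec_zero]; rfl
  · refine ⟨_, hpos 2 1 2 0 (by decide) (by decide),
      (hact (pairDet (idealPoint w (σ 2)) (idealPoint w (σ 1)) *
        pairDet (idealPoint w (σ 2)) (idealPoint w (σ 0))) ![1, 1] ?_).trans rfl⟩
    rw [hm]
    ext1 k
    fin_cases k <;> simp [mul_comm]
  · refine ⟨_, hpos 3 0 2 1 (by decide) (by decide),
      (hact (pairDet (idealPoint w (σ 3)) (idealPoint w (σ 0)) *
        pairDet (idealPoint w (σ 2)) (idealPoint w (σ 1))) ![flagShape w σ, 1] ?_).trans rfl⟩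
    rw [hm]
    ext1 k
    fin_cases k
    · simp [← flagShape_mul hw hσ, mul_comm]
    · simp

theorem norm_flagShape_pos {w : ShapeAlg c} (hw : IsPositiveShape w)
    {σ : Equiv.Perm (Fin 4)} (hσ : Equiv.Perm.sign σ = 1) :
    0 < QuadraticAlgebra.norm (flagShape w σ) := by
  have h := congrArg QuadraticAlgebra.norm (flagShape_mul hw hσ)
  have h1 : ∀ i k i' k' : Fin 4, i ≠ k → i' ≠ k' → 0 < QuadraticAlgebra.norm
      (pairDet (idealPoint w (σ i)) (idealPoint w (σ k)) *
        pairDet (idealPoint w (σ i')) (idealPoint w (σ k'))) := by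
    intro i k i' k' h h'
    rw [map_mul]
    exact mul_pos (norm_pairDet_pos hw (by simpa)) (norm_pairDet_pos hw (by simpa))
  rw [map_mul] at h
  have h2 := h1 3 1 2 0 (by decide) (by decide)
  rw [← h] at h2
  exact pos_of_mul_pos_left h2 (h1 3 0 2 1 (by decide) (by decide)).le

theorem norm_mul_inverse {a : ShapeAlg c} (ha : 0 < QuadraticAlgebra.norm a) :
    Ring.inverse a = (QuadraticAlgebra.norm a)⁻¹ • star a := by
  have h1 : a * Ring.inverse a = 1 := Ring.mul_inverse_cancel _ (isUnit_of_norm_pos ha)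
  have h2 : a * ((QuadraticAlgebra.norm a)⁻¹ • star a) = 1 := by
    rw [mul_smul_comm, ← QuadraticAlgebra.algebraMap_norm_eq_mul_star, Algebra.smul_def,
      ← map_mul, inv_mul_cancel₀ ha.ne', map_one]
  exact (isUnit_of_norm_pos ha).mul_left_cancel (h1.trans h2.symm)

theorem edgeShape_cases {R : Type} [CommRing R] (w : R) (s : Finset (Fin 4)) :
    edgeShape w s = w ∨ edgeShape w s = Ring.inverse (1 - w) ∨
      edgeShape w s = (w - 1) * Ring.inverse w := by
  unfold edgeShape
  split_ifs <;> simp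

/-- The imaginary parts of 1/(1-w) and (w-1)/w are Im w / |1-w|² and Im w / |w|². -/
theorem im_edgeShape_pos {w : ShapeAlg c} (hw : IsPositiveShape w) (s : Finset (Fin 4)) :
    0 < (edgeShape w s).im := by
  obtain ⟨h1, h2, h3⟩ := hw
  rcases edgeShape_cases w s with h | h | h <;> rw [h]
  · exact h3
  · rw [norm_mul_inverse h2]
    simp [QuadraticAlgebra.im_one]
    positivity
  · rw [norm_mul_inverse h1]
    have : ((w - 1) * (QuadraticAlgebra.norm w)⁻¹ • star w).im =
        (QuadraticAlgebra.norm w)⁻¹ * w.im := by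
      simp only [QuadraticAlgebra.im_mul, QuadraticAlgebra.re_sub, QuadraticAlgebra.im_sub,
        QuadraticAlgebra.re_one, QuadraticAlgebra.im_one, QuadraticAlgebra.re_smul,
        QuadraticAlgebra.im_smul, QuadraticAlgebra.re_star, QuadraticAlgebra.im_star, smul_eq_mul]
      ring
    rw [this]
    positivity

/-- The matrix that takes the edge `σ 0, σ 1` of the tetrahedron `∞, 0, 1, w` to `∞, 0` and the
vertex `σ 2` to `u`. -/
def devMatrix (u w : ShapeAlg c) (σ : Equiv.Perm (Fin 4)) : Matrix (Fin 2) (Fin 2) (ShapeAlg c) :=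
  Matrix.diagonal ![u, 1] * flagMatrix w σ

theorem norm_det_devMatrix_pos {u w : ShapeAlg c} (hu : 0 < QuadraticAlgebra.norm u)
    (hw : IsPositiveShape w) (σ : Equiv.Perm (Fin 4)) :
    0 < QuadraticAlgebra.norm (devMatrix u w σ).det := by
  rw [devMatrix, Matrix.det_mul, map_mul]
  refine mul_pos ?_ (norm_det_flagMatrix_pos hw σ)
  simpa [Matrix.det_diagonal, Fin.prod_univ_two]

theorem exists_hermAct_devMatrix {u w : ShapeAlg c} (hu : 0 < QuadraticAlgebra.norm u)
    (hw : IsPositiveShape w) {σ : Equiv.Perm (Fin 4)} (hσ : Equiv.Perm.sign σ = 1) :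
    ∃ μ : Fin 4 → ℝ, (∀ i, 0 < μ i) ∧ ∀ i,
      hermAct (devMatrix u w σ) (tetVertex w (σ i)) =
        μ i • frameVec u (u * flagShape w σ) i := by
  obtain ⟨μ, hμ, h⟩ := exists_hermAct_flagMatrix hw hσ
  refine ⟨![QuadraticAlgebra.norm u * μ 0, μ 1, μ 2, μ 3], ?_, ?_⟩
  · intro i
    fin_cases i
    · exact mul_pos hu (hμ 0)
    · exact hμ 1
    · exact hμ 2
    · exact hμ 3
  · intro i
    rw [devMatrix, hermAct_mul, Module.End.mul_apply, h, map_smul]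
    fin_cases i
    · refine (congrArg _ (hermAct_diagonal_vecInf u)).trans ?_
      rw [smul_smul, mul_comm]; rfl
    · exact congrArg _ (hermAct_diagonal_vecZero u)
    · refine (congrArg _ (hermAct_diagonal_nullVec u 1)).trans ?_
      rw [mul_one]; rfl
    · exact congrArg _ (hermAct_diagonal_nullVec u _)

/-! ### Transformations that fix three ideal points -/

/-- Fixing the lines of ∞ and 0 makes A diagonal, fixing that of 1 makes its diagonal entries equal.
The algebra may have zero divisors; cancellation is possible because the diagonal entries have the
nonzero norms a and b and so are units. -/
theorem hermAct_eq_smul_of_fixes {A : Matrix (Fin 2) (Fin 2) (ShapeAlg c)} {a b d : ℝ}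
    (ha : a ≠ 0) (hb : b ≠ 0) (h0 : hermAct A vecInf = a • vecInf)
    (h1 : hermAct A vecZero = b • vecZero)
    (h2 : hermAct A (nullVec (![1, 1] : Fin 2 → ShapeAlg c)) = d • nullVec (![1, 1] : Fin 2 → ShapeAlg c)) :
    hermAct A = a • 1 := by
  have key : ∀ (p : Fin 2 → ShapeAlg c) (r : ℝ), hermAct A (nullVec p) = r • nullVec p →
      ∀ i j, (A *ᵥ p) i * star ((A *ᵥ p) j) = r • (p i * star (p j)) := by
    intro p r h i j
    have h' := congrArg (herm c) h
    rw [hermAct_nullVec, herm_smul, herm_nullVec, herm_nullVec] at h'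
    exact congrFun (congrFun h' i) j
  rw [vecInf, ← nullVec_infinity (c := c)] at h0
  rw [vecZero, ← nullVec_zero (c := c)] at h1
  have k0 := key _ _ h0
  have k1 := key _ _ h1
  have k2 := key _ _ h2
  have e0 : ∀ i, (A *ᵥ ![1, 0]) i = A i 0 := fun i => by simp [Matrix.mulVec, dotProduct]
  have e1 : ∀ i, (A *ᵥ ![0, 1]) i = A i 1 := fun i => by simp [Matrix.mulVec, dotProduct]
  have e2 : ∀ i, (A *ᵥ ![1, 1]) i = A i 0 + A i 1 := fun i => by
    simp [Matrix.mulVec, dotProduct]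
  simp only [e0, e1, e2] at k0 k1 k2
  have u0 : A 0 0 * star (A 0 0) = algebraMap ℝ _ a := by
    rw [k0 0 0]; simp [Algebra.smul_def]
  have u1 : A 1 1 * star (A 1 1) = algebraMap ℝ _ b := by
    rw [k1 1 1]; simp [Algebra.smul_def]
  have hu0 : IsUnit (A 0 0) := by
    refine isUnit_of_mul_isUnit_left (y := star (A 0 0)) ?_
    rw [u0]
    exact (isUnit_iff_ne_zero.mpr ha).map _
  have hu1 : IsUnit (A 1 1) := by
    refine isUnit_of_mul_isUnit_left (y := star (A 1 1)) ?_
    rw [u1]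
    exact (isUnit_iff_ne_zero.mpr hb).map _
  have z1 : A 1 0 = 0 := by
    have h := k0 1 0
    simp only [Matrix.cons_val_one, Matrix.cons_val_zero, zero_mul, smul_zero] at h
    exact hu0.star.mul_left_eq_zero.mp h
  have z0 : A 0 1 = 0 := by
    have h := k1 0 1
    simp only [Matrix.cons_val_one, Matrix.cons_val_zero, zero_mul, smul_zero] at h
    exact hu1.star.mul_left_eq_zero.mp h
  have hs : A 0 0 = A 1 1 := by
    have h := (k2 0 0).trans (k2 0 1).symm
    rw [z0, z1, add_zero, zero_add] at h
    exact star_injective (hu0.mul_left_cancel h)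
  refine LinearMap.ext fun x => herm_injective c ?_
  have hA : A = algebraMap (ShapeAlg c) _ (A 0 0) := by
    ext1 i j
    fin_cases i <;> fin_cases j <;> simp [Matrix.algebraMap_matrix_apply, z0, z1, hs]
  rw [herm_hermAct, LinearMap.smul_apply, Module.End.one_apply, herm_smul, hA]
  rw [Matrix.algebraMap_eq_diagonal]
  ext1 i j
  have hmul : ∀ y : ShapeAlg c, A 0 0 * y * star (A 0 0) = a • y := by
    intro y
    rw [mul_right_comm, u0, Algebra.smul_def]
  simp [Matrix.diagonal_conjTranspose, Matrix.diagonal_mul, Matrix.mul_diagonal, hmul]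

theorem even_perm_with_last : ∀ a : Fin 4, ∃ σ : Equiv.Perm (Fin 4),
    Equiv.Perm.sign σ = 1 ∧ σ 3 = a := by
  decide

/-- An element of the structure group that fixes three vertices of an ideal tetrahedron acts
trivially on projective space. -/
theorem exists_smul_of_fixes_face {w : ShapeAlg c} (hw : IsPositiveShape w) {g : GL4}
    (hg : g ∈ modelGroup c) (a : Fin 4)
    (h : ∀ i, i ≠ a → ∃ r : ℝ, r ≠ 0 ∧ g • tetVertex w i = r • tetVertex w i) :
    ∃ r : ℝ, r ≠ 0 ∧ ∀ x : V4, g • x = r • x := by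
  obtain ⟨A, hA, r, hr, hgA⟩ := exists_hermAct_of_mem_modelGroup hg
  obtain ⟨σ, hσ, hσa⟩ := even_perm_with_last a
  obtain ⟨μ, hμ, hfm⟩ := exists_hermAct_flagMatrix hw hσ
  set B := flagMatrix w σ with hB
  have hBu : IsUnit B.det := isUnit_of_norm_pos (norm_det_flagMatrix_pos hw σ)
  have hBB : hermAct B * hermAct B⁻¹ = 1 := by
    rw [← hermAct_mul, Matrix.mul_nonsing_inv _ hBu, hermAct_one]
  have hBB' : hermAct B⁻¹ * hermAct B = 1 := by
    rw [← hermAct_mul, Matrix.nonsing_inv_mul _ hBu, hermAct_one]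
  -- Since σ 3 = a, conjugation by the flag matrix moves the fixed face to ∞, 0, 1.
  have fix : ∀ i : Fin 4, i ≠ 3 → ∃ s : ℝ, s ≠ 0 ∧
      hermAct (B * A * B⁻¹) (frameVec 1 (flagShape w σ) i) =
        s • frameVec 1 (flagShape w σ) i := by
    intro i hi
    obtain ⟨s, hs, h1⟩ := h (σ i) (by rw [← hσa]; exact fun h => hi (σ.injective h))
    have h2 : frameVec 1 (flagShape w σ) i = (μ i)⁻¹ • hermAct B (tetVertex w (σ i)) := by
      rw [hfm, smul_smul, inv_mul_cancel₀ (hμ i).ne', one_smul]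
    have h3 : hermAct A (tetVertex w (σ i)) = (r⁻¹ * s) • tetVertex w (σ i) := by
      rw [mul_smul, ← h1, hgA, smul_smul, inv_mul_cancel₀ hr, one_smul]
    refine ⟨r⁻¹ * s, mul_ne_zero (inv_ne_zero hr) hs, ?_⟩
    have h4 : hermAct B⁻¹ (hermAct B (tetVertex w (σ i))) = tetVertex w (σ i) :=
      congrArg (fun f => f (tetVertex w (σ i))) hBB'
    rw [hermAct_mul, hermAct_mul, Module.End.mul_apply, Module.End.mul_apply, h2, map_smul,
      map_smul, map_smul, h4, h3, map_smul, smul_comm]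
  obtain ⟨s0, hs0, f0⟩ := fix 0 (by decide)
  obtain ⟨s1, hs1, f1⟩ := fix 1 (by decide)
  obtain ⟨s2, hs2, f2⟩ := fix 2 (by decide)
  have hscal := hermAct_eq_smul_of_fixes hs0 hs1 f0 f1 f2
  have hA' : hermAct A = s0 • 1 := by
    have h5 : hermAct A = hermAct B⁻¹ * hermAct (B * A * B⁻¹) * hermAct B := by
      rw [hermAct_mul, hermAct_mul, ← mul_assoc, ← mul_assoc, hBB', one_mul, mul_assoc, hBB',
        mul_one]
    rw [h5, hscal, mul_smul_comm, mul_one, smul_mul_assoc, hBB']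
  refine ⟨r * s0, mul_ne_zero hr hs0, fun x => ?_⟩
  rw [hgA, hA', LinearMap.smul_apply, Module.End.one_apply, smul_smul]

end StandardTetrahedra

/-! ## Flags of a triangulation -/

/-- The flags of a triangulation: a tetrahedron with an ordering `σ 0, …, σ 3` of its vertices that
is compatible with the orientation. -/
abbrev EdgeFlag (N : ℕ) : Type := Fin N × {σ : Equiv.Perm (Fin 4) // Equiv.Perm.sign σ = 1}

namespace IdealTriangulation

variable {N : ℕ} (T : IdealTriangulation N)

/-- The permutation that labels the tetrahedron on the other side of the face `a`. -/
def crossPerm (j : Fin N) (a : Fin 4) (σ : {σ : Equiv.Perm (Fin 4) // Equiv.Perm.sign σ = 1}) :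
    {σ : Equiv.Perm (Fin 4) // Equiv.Perm.sign σ = 1} :=
  ⟨T.glue j a * σ.1 * Equiv.swap 2 3, by
    rw [map_mul, map_mul, T.glue_odd, σ.2, Equiv.Perm.sign_swap (by decide)]; simp⟩

/-- Turning a flag around its edge `σ 0, σ 1` into the next tetrahedron, across the face opposite
to `σ 2`. -/
def flagNext : Equiv.Perm (EdgeFlag N) where
  toFun f := (T.adj f.1 (f.2.1 2), T.crossPerm f.1 (f.2.1 2) f.2)
  invFun f := (T.adj f.1 (f.2.1 3), T.crossPerm f.1 (f.2.1 3) f.2)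
  left_inv f := by
    refine Prod.ext ?_ (Subtype.ext ?_)
    · simp [crossPerm, T.adj_adj]
    · simp [crossPerm, T.glue_glue, ← mul_assoc]
  right_inv f := by
    refine Prod.ext ?_ (Subtype.ext ?_)
    · simp [crossPerm, T.adj_adj]
    · simp [crossPerm, T.glue_glue, ← mul_assoc]

theorem flagNext_apply (f : EdgeFlag N) :
    T.flagNext f = (T.adj f.1 (f.2.1 2), T.crossPerm f.1 (f.2.1 2) f.2) := rfl

theorem flagNext_symm_apply (f : EdgeFlag N) :
    T.flagNext.symm f = (T.adj f.1 (f.2.1 3), T.crossPerm f.1 (f.2.1 3) f.2) := rfl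

/-- Reversing the edge of a flag. -/
def flagRev : Equiv.Perm (EdgeFlag N) :=
  Function.Involutive.toPerm
    (fun f => (f.1, ⟨f.2.1 * Equiv.swap 0 1 * Equiv.swap 2 3, by
      rw [map_mul, map_mul, f.2.2, Equiv.Perm.sign_swap (by decide),
        Equiv.Perm.sign_swap (by decide)]; simp⟩)) (by
    intro f
    refine Prod.ext rfl (Subtype.ext ?_)
    have h : (Equiv.swap 0 1 * Equiv.swap 2 3 * (Equiv.swap 0 1 * Equiv.swap 2 3) :
      Equiv.Perm (Fin 4)) = 1 := by decide
    simp only [mul_assoc] at h ⊢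
    rw [h, mul_one])

theorem flagRev_apply (f : EdgeFlag N) :
    (flagRev f).1 = f.1 ∧ (flagRev f).2.1 = f.2.1 * Equiv.swap 0 1 * Equiv.swap 2 3 := ⟨rfl, rfl⟩

theorem flagRev_mul_self : (flagRev * flagRev : Equiv.Perm (EdgeFlag N)) = 1 := by
  ext1 f
  exact Function.Involutive.toPerm_involutive _ f

/-- Reversing the edge exchanges the faces opposite to σ 2 and σ 3, and with them the two senses of
rotation. -/
theorem flagRev_conj_flagNext : flagRev * T.flagNext * flagRev⁻¹ = T.flagNext⁻¹ := by
  have h1 : (flagRev⁻¹ : Equiv.Perm (EdgeFlag N)) = flagRev := inv_eq_of_mul_eq_one_left flagRev_mul_self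
  rw [h1]
  ext1 f
  change flagRev (T.flagNext (flagRev f)) = T.flagNext.symm f
  have h2 : (flagRev f).2.1 2 = f.2.1 3 := by
    rw [(flagRev_apply f).2]
    simp [Equiv.Perm.mul_apply, Equiv.swap_apply_of_ne_of_ne]
  refine Prod.ext ?_ (Subtype.ext ?_)
  · rw [(flagRev_apply _).1, flagNext_apply, flagNext_symm_apply, (flagRev_apply f).1, h2]
  · rw [(flagRev_apply _).2, flagNext_apply, flagNext_symm_apply, (flagRev_apply f).1, h2]
    simp only [crossPerm, (flagRev_apply f).2]
    have h : (Equiv.swap 0 1 * Equiv.swap 2 3 * Equiv.swap 2 3 * Equiv.swap 0 1 * Equiv.swap 2 3 :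
      Equiv.Perm (Fin 4)) = Equiv.swap 2 3 := by decide
    simp only [mul_assoc] at h ⊢
    rw [h]

theorem flagRev_zpow (k : ℤ) (f : EdgeFlag N) :
    flagRev ((T.flagNext ^ k) f) = (T.flagNext ^ (-k)) (flagRev f) := by
  have h := congrArg (fun g => g ^ k) T.flagRev_conj_flagNext
  simp only [conj_zpow, inv_zpow'] at h
  rw [← h]
  simp [Equiv.Perm.mul_apply]

/-- No edge of the triangulation is folded onto itself. -/
theorem flagRev_ne_zpow (k : ℤ) (f : EdgeFlag N) : flagRev f ≠ (T.flagNext ^ k) f := by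
  intro h
  have key : ∀ m : ℤ, flagRev ((T.flagNext ^ m) f) = (T.flagNext ^ (k - m)) f := by
    intro m
    rw [T.flagRev_zpow, h, ← Equiv.Perm.mul_apply, ← zpow_add]
    congr 2
    ring
  -- A folded edge has a midpoint, found by halving k. For even k some flag equals its own reversal,
  -- contradicting σ 0 ≠ σ 1. For odd k the reversal of some flag is its successor, so a face is
  -- glued to itself.
  obtain ⟨m, hm | hm⟩ := Int.even_or_odd' k
  · have h1 := key m
    rw [show k - m = m by omega] at h1
    have h2 := congrArg (fun f => f.2.1 0) h1
    simp only [(flagRev_apply _).2] at h2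
    simp [Equiv.Perm.mul_apply, Equiv.swap_apply_of_ne_of_ne] at h2
  · have h1 := key m
    rw [show k - m = 1 + m by omega, zpow_add, zpow_one, Equiv.Perm.mul_apply] at h1
    set y := (T.flagNext ^ m) f
    rw [flagNext_apply] at h1
    have h2 := congrArg (fun f => f.1) h1
    have h3 := congrArg (fun f => f.2.1 3) h1
    simp only [(flagRev_apply _).1, (flagRev_apply _).2] at h2 h3
    simp [crossPerm, Equiv.Perm.mul_apply, Equiv.swap_apply_of_ne_of_ne] at h3
    exact T.not_self y.1 (y.2.1 2) ⟨h2.symm, h3.symm⟩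

/-- The edge of a flag. -/
def flagEdge (f : EdgeFlag N) : TetEdge N :=
  (f.1, ⟨{f.2.1 0, f.2.1 1}, Finset.card_pair (by simp)⟩)

theorem perm_eq_of_apply_zero_one : ∀ σ : Equiv.Perm (Fin 4), Equiv.Perm.sign σ = 1 → σ 0 = 0 →
    σ 1 = 1 → σ = 1 := by
  decide

theorem even_perm_ext {σ τ : Equiv.Perm (Fin 4)} (hσ : Equiv.Perm.sign σ = 1)
    (hτ : Equiv.Perm.sign τ = 1) (h0 : σ 0 = τ 0) (h1 : σ 1 = τ 1) : σ = τ := by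
  have h := perm_eq_of_apply_zero_one (τ⁻¹ * σ) (by simp [hσ, hτ])
    (by simp [Equiv.Perm.mul_apply, h0]) (by simp [Equiv.Perm.mul_apply, h1])
  exact (inv_mul_eq_one.mp h).symm

theorem eq_or_eq_flagRev {f f' : EdgeFlag N} (h : flagEdge f = flagEdge f') :
    f = f' ∨ f = flagRev f' := by
  have h1 : f.1 = f'.1 := congrArg (fun e : TetEdge N => e.1) h
  have h2 : ({f.2.1 0, f.2.1 1} : Finset (Fin 4)) = {f'.2.1 0, f'.2.1 1} :=
    congrArg (fun e : TetEdge N => e.2.1) h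
  have h3 : (f.2.1 0 = f'.2.1 0 ∧ f.2.1 1 = f'.2.1 1) ∨
      (f.2.1 0 = f'.2.1 1 ∧ f.2.1 1 = f'.2.1 0) := by
    have := congrArg ((↑) : Finset (Fin 4) → Set (Fin 4)) h2
    rw [Finset.coe_pair, Finset.coe_pair] at this
    exact Set.pair_eq_pair_iff.mp this
  rcases h3 with ⟨h3, h4⟩ | ⟨h3, h4⟩
  · exact Or.inl (Prod.ext h1 (Subtype.ext (even_perm_ext f.2.2 f'.2.2 h3 h4)))
  · refine Or.inr (Prod.ext h1 (Subtype.ext (even_perm_ext f.2.2 (flagRev f').2.2 ?_ ?_))) <;>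
      rw [(flagRev_apply f').2] <;>
      simpa [Equiv.Perm.mul_apply, Equiv.swap_apply_of_ne_of_ne]

theorem edgeRel_symm {x y : TetEdge N} (h : T.EdgeRel x y) : T.EdgeRel y x := by
  obtain ⟨a, ha, h1, h2⟩ := h
  refine ⟨T.glue x.1 a a, ?_, ?_, ?_⟩
  · rw [h2]
    simpa using ha
  · rw [h1, T.adj_adj]
  · rw [h2, h1, T.glue_glue, Finset.map_map]
    ext i
    simp

theorem flagEdge_flagNext (f : EdgeFlag N) : T.EdgeRel (flagEdge f) (flagEdge (T.flagNext f)) := by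
  refine ⟨f.2.1 2, ?_, rfl, ?_⟩
  · simp [flagEdge]
  · simp [flagEdge, flagNext_apply, crossPerm, Equiv.Perm.mul_apply,
      Equiv.swap_apply_of_ne_of_ne, Finset.map_insert]

/-- Only the faces opposite to σ 2 and σ 3 contain the edge; this is why an edge class is the image
of a single cycle of flags. -/
theorem exists_flagEdge_of_edgeRel {f : EdgeFlag N} {x : TetEdge N} (h : T.EdgeRel (flagEdge f) x) :
    x = flagEdge (T.flagNext f) ∨ x = flagEdge (T.flagNext.symm f) := by
  obtain ⟨a, ha, h1, h2⟩ := h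
  obtain ⟨i, rfl⟩ := f.2.1.surjective a
  have hi : i = 2 ∨ i = 3 := by
    simp [flagEdge] at ha
    fin_cases i <;> simp_all
  rcases hi with rfl | rfl
  · refine Or.inl (Prod.ext h1 (Subtype.ext ?_))
    rw [h2]
    simp [flagEdge, flagNext_apply, crossPerm, Equiv.Perm.mul_apply,
      Equiv.swap_apply_of_ne_of_ne, Finset.map_insert]
  · refine Or.inr (Prod.ext h1 (Subtype.ext ?_))
    rw [h2]
    simp [flagEdge, flagNext_symm_apply, crossPerm, Equiv.Perm.mul_apply,
      Equiv.swap_apply_of_ne_of_ne, Finset.map_insert]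

theorem mem_edgeClass_flagEdge {f : EdgeFlag N} {x : TetEdge N} :
    x ∈ T.edgeClass (flagEdge f) ↔ ∃ f', T.flagNext.SameCycle f f' ∧ flagEdge f' = x := by
  classical
  simp only [edgeClass, Finset.mem_filter, Finset.mem_univ, true_and]
  constructor
  · intro h
    have gen : ∀ y x : TetEdge N, Relation.EqvGen T.EdgeRel y x →
        ((∃ f', T.flagNext.SameCycle f f' ∧ flagEdge f' = y) ↔
          ∃ f', T.flagNext.SameCycle f f' ∧ flagEdge f' = x) := by
      have one : ∀ y x : TetEdge N, T.EdgeRel y x →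
          (∃ f', T.flagNext.SameCycle f f' ∧ flagEdge f' = y) →
          ∃ f', T.flagNext.SameCycle f f' ∧ flagEdge f' = x := by
        rintro y x h ⟨f', hf', rfl⟩
        rcases T.exists_flagEdge_of_edgeRel h with rfl | rfl
        · exact ⟨_, Equiv.Perm.sameCycle_apply_right.mpr hf', rfl⟩
        · exact ⟨_, (Equiv.Perm.sameCycle_symm_apply_right.mpr hf'), rfl⟩
      intro y x h
      induction h with
      | rel y x h => exact ⟨one _ _ h, one _ _ (T.edgeRel_symm h)⟩
      | refl => rfl
      | symm _ _ _ ih => exact ih.symm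
      | trans _ _ _ _ _ ih1 ih2 => exact ih1.trans ih2
    exact (gen _ _ h).mp ⟨f, Equiv.Perm.SameCycle.refl _ _, rfl⟩
  · rintro ⟨f', ⟨k, rfl⟩, rfl⟩
    induction k using Int.induction_on with
    | zero => exact Relation.EqvGen.refl _
    | succ n ih =>
      refine ih.trans _ _ _ (Relation.EqvGen.rel _ _ ?_)
      rw [add_comm, zpow_add, zpow_one, Equiv.Perm.mul_apply]
      exact T.flagEdge_flagNext _
    | pred n ih =>
      refine ih.trans _ _ _ (Relation.EqvGen.symm _ _ (Relation.EqvGen.rel _ _ ?_))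
      have := T.flagEdge_flagNext ((T.flagNext ^ (-(n : ℤ) - 1)) f)
      rwa [← Equiv.Perm.mul_apply, ← zpow_one_add, add_sub_cancel] at this

/-- Two flags with the same edge are equal or reversed, and reversal leaves the cycle by
`flagRev_ne_zpow`. Hence products and sums over an edge class are taken over one period without
repetition. -/
theorem flagEdge_injOn {f f₁ f₂ : EdgeFlag N} (h₁ : T.flagNext.SameCycle f f₁)
    (h₂ : T.flagNext.SameCycle f f₂) (h : flagEdge f₁ = flagEdge f₂) : f₁ = f₂ := by
  rcases eq_or_eq_flagRev h with h | h
  · exact h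
  · obtain ⟨k, hk⟩ := h₂.symm.trans h₁
    exact absurd (hk.trans h).symm (T.flagRev_ne_zpow k f₂)

/-- The number of tetrahedra at the edge of a flag. -/
def flagPeriod (f : EdgeFlag N) : ℕ := Function.minimalPeriod T.flagNext f

theorem flagPeriod_pos (f : EdgeFlag N) : 0 < T.flagPeriod f :=
  Function.minimalPeriod_pos_of_mem_periodicPts
    (T.flagNext.injective.mem_periodicPts f)

theorem iterate_flagPeriod (f : EdgeFlag N) : T.flagNext^[T.flagPeriod f] f = f :=
  Function.isPeriodicPt_minimalPeriod _ _

theorem exists_iterate_of_sameCycle {f f' : EdgeFlag N} (h : T.flagNext.SameCycle f f') :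
    ∃ k < T.flagPeriod f, T.flagNext^[k] f = f' := by
  obtain ⟨k, hk⟩ := h
  refine ⟨(k % T.flagPeriod f).toNat, ?_, ?_⟩
  · have := Int.emod_lt_of_pos k (Int.natCast_pos.mpr (T.flagPeriod_pos f))
    have := Int.emod_nonneg k (Int.natCast_pos.mpr (T.flagPeriod_pos f)).ne'
    omega
  · have h0 := Int.emod_nonneg k (Int.natCast_pos.mpr (T.flagPeriod_pos f)).ne'
    have h1 : (T.flagNext ^ (T.flagPeriod f : ℤ)) f = f := by
      rw [zpow_natCast, Equiv.Perm.coe_pow]; exact T.iterate_flagPeriod f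
    have h2 : (T.flagNext ^ ((T.flagPeriod f : ℤ) * (k / T.flagPeriod f))) f = f := by
      rw [zpow_mul]
      exact Equiv.Perm.zpow_apply_eq_self_of_apply_eq_self h1 _
    rw [← Equiv.Perm.coe_pow, ← zpow_natCast, Int.toNat_of_nonneg h0, ← hk]
    conv_rhs => rw [← Int.emod_add_mul_ediv k (T.flagPeriod f), zpow_add, Equiv.Perm.mul_apply, h2]

theorem sameCycle_iterate (f : EdgeFlag N) (k : ℕ) : T.flagNext.SameCycle f (T.flagNext^[k] f) :=
  ⟨k, by rw [zpow_natCast, Equiv.Perm.coe_pow]⟩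

theorem edgeClass_flagEdge (f : EdgeFlag N) [DecidableEq (TetEdge N)] : T.edgeClass (flagEdge f) =
    (Finset.range (T.flagPeriod f)).image fun k => flagEdge (T.flagNext^[k] f) := by
  ext x
  rw [mem_edgeClass_flagEdge, Finset.mem_image]
  constructor
  · rintro ⟨f', h, rfl⟩
    obtain ⟨k, hk, rfl⟩ := T.exists_iterate_of_sameCycle h
    exact ⟨k, Finset.mem_range.mpr hk, rfl⟩
  · rintro ⟨k, -, rfl⟩
    exact ⟨_, T.sameCycle_iterate f k, rfl⟩

theorem flagEdge_iterate_injOn (f : EdgeFlag N) : Set.InjOn (fun k => flagEdge (T.flagNext^[k] f))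
    (Finset.range (T.flagPeriod f)) := by
  intro k hk l hl h
  have h1 := T.flagEdge_injOn (T.sameCycle_iterate f k) (T.sameCycle_iterate f l) h
  rw [Finset.coe_range, Set.mem_Iio] at hk hl
  exact (Function.iterate_eq_iterate_iff_of_lt_minimalPeriod hk hl).mp h1

open Classical in
theorem prod_edgeClass_flagEdge {R : Type} [CommMonoid R] (f : EdgeFlag N) (φ : TetEdge N → R) :
    ∏ x ∈ T.edgeClass (flagEdge f), φ x =
      ∏ k ∈ Finset.range (T.flagPeriod f), φ (flagEdge (T.flagNext^[k] f)) := by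
  rw [edgeClass_flagEdge, Finset.prod_image (T.flagEdge_iterate_injOn f)]

open Classical in
theorem sum_edgeClass_flagEdge {R : Type} [AddCommMonoid R] (f : EdgeFlag N) (φ : TetEdge N → R) :
    ∑ x ∈ T.edgeClass (flagEdge f), φ x =
      ∑ k ∈ Finset.range (T.flagPeriod f), φ (flagEdge (T.flagNext^[k] f)) := by
  rw [edgeClass_flagEdge, Finset.sum_image (T.flagEdge_iterate_injOn f)]

end IdealTriangulation

/-! ## Fans of sectors in the plane -/

section Fans

/-- The half-open intervals between consecutive angles partition one period. As each is shorter than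
π, membership modulo 2π amounts to two inequalities between sines. -/
theorem exists_unique_sector {θ : ℕ → ℝ} {n : ℕ} (hstep : ∀ k < n, 0 < θ (k + 1) - θ k ∧
    θ (k + 1) - θ k < Real.pi) (hn : θ n = θ 0 + 2 * Real.pi) (φ : ℝ) :
    ∃! k, k < n ∧ 0 ≤ Real.sin (φ - θ k) ∧ 0 < Real.sin (θ (k + 1) - φ) := by
  have hpi := Real.pi_pos
  wlog hφ : φ ∈ Set.Ico (θ 0) (θ 0 + 2 * Real.pi) generalizing φ
  · have h := this _ (toIcoMod_mem_Ico (mul_pos two_pos hpi) (θ 0) φ)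
    have e : ∃ m : ℤ, toIcoMod (mul_pos two_pos hpi) (θ 0) φ = φ - m * (2 * Real.pi) :=
      ⟨toIcoDiv (mul_pos two_pos hpi) (θ 0) φ, by
        rw [toIcoMod, zsmul_eq_mul]⟩
    obtain ⟨m, e⟩ := e
    rw [e] at h
    have e1 : ∀ k, Real.sin (φ - m * (2 * Real.pi) - θ k) = Real.sin (φ - θ k) := by
      intro k
      rw [show φ - m * (2 * Real.pi) - θ k = φ - θ k - m * (2 * Real.pi) by ring,
        Real.sin_sub_int_mul_two_pi]
    have e2 : ∀ k, Real.sin (θ k - (φ - m * (2 * Real.pi))) = Real.sin (θ k - φ) := by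
      intro k
      rw [show θ k - (φ - m * (2 * Real.pi)) = θ k - φ + m * (2 * Real.pi) by ring,
        Real.sin_add_int_mul_two_pi]
    simpa only [e1, e2] using h
  have hmono : ∀ k l, k ≤ l → l ≤ n → θ k ≤ θ l := by
    intro k l hkl
    induction l, hkl using Nat.le_induction with
    | base => exact fun _ => le_rfl
    | succ l _ ih =>
      intro hl
      have := (hstep l (by omega)).1
      linarith [ih (by omega)]
  have hiff : ∀ k < n, (0 ≤ Real.sin (φ - θ k) ∧ 0 < Real.sin (θ (k + 1) - φ)) ↔
      θ k ≤ φ ∧ φ < θ (k + 1) := by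
    intro k hk
    obtain ⟨h1, h2⟩ := hstep k hk
    have hk0 := hmono 0 k (by omega) hk.le
    have hkn := hmono (k + 1) n (by omega) le_rfl
    obtain ⟨hφ1, hφ2⟩ := hφ
    constructor
    · rintro ⟨h3, h4⟩
      -- Here d is the angle from the ray k, normalized to [0, 2π). The first sine restricts it to
      -- [0, π], where the second forces it to lie before the next ray.
      have aux : ∀ d : ℝ, 0 ≤ d → d < 2 * Real.pi → 0 ≤ Real.sin d →
          0 < Real.sin (θ (k + 1) - θ k - d) → d < θ (k + 1) - θ k := by
        intro d hd0 hd1 hs hs'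
        have hd2 : d ≤ Real.pi := by
          by_contra hlt
          have : Real.sin (d - 2 * Real.pi) < 0 :=
            Real.sin_neg_of_neg_of_neg_pi_lt (by linarith) (by linarith)
          rw [Real.sin_sub_two_pi] at this
          linarith
        by_contra hlt
        have := Real.sin_nonpos_of_nonpos_of_neg_pi_le
          (x := θ (k + 1) - θ k - d) (by linarith) (by linarith)
        linarith
      by_cases hle : θ k ≤ φ
      · refine ⟨hle, ?_⟩
        have := aux (φ - θ k) (by linarith) (by linarith) h3
          (by rwa [show θ (k + 1) - θ k - (φ - θ k) = θ (k + 1) - φ by ring])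
        linarith
      · exfalso
        have := aux (φ - θ k + 2 * Real.pi) (by linarith) (by linarith)
          (by rwa [Real.sin_add_two_pi])
          (by rwa [show θ (k + 1) - θ k - (φ - θ k + 2 * Real.pi) =
            θ (k + 1) - φ - 2 * Real.pi by ring, Real.sin_sub_two_pi])
        linarith
    · rintro ⟨h3, h4⟩
      exact ⟨Real.sin_nonneg_of_nonneg_of_le_pi (by linarith) (by linarith),
        Real.sin_pos_of_pos_of_lt_pi (by linarith) (by linarith)⟩
  have hex : ∃ k < n, θ k ≤ φ ∧ φ < θ (k + 1) := by
    by_contra hcon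
    push Not at hcon
    have h : ∀ k, k ≤ n → θ k ≤ φ := by
      intro k
      induction k with
      | zero => exact fun _ => hφ.1
      | succ k ih => exact fun hk => hcon k (by omega) (ih (by omega))
    have := h n le_rfl
    rw [hn] at this
    exact absurd hφ.2 (not_lt.mpr this)
  obtain ⟨k, hk, hk'⟩ := hex
  refine ⟨k, ⟨hk, (hiff k hk).mpr hk'⟩, ?_⟩
  rintro l ⟨hl, hl'⟩
  rw [hiff l hl] at hl'
  by_contra hne
  rcases Nat.lt_or_gt_of_ne hne with h | h
  · linarith [hmono (l + 1) k (by omega) hk.le]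
  · linarith [hmono (k + 1) l (by omega) hl.le]

variable {c : ℝ}

/-- The determinant of two elements of `ℝ + ℝκ` with respect to the basis `1, κ`. -/
def cross (x y : ShapeAlg c) : ℝ := x.re * y.im - x.im * y.re

/-- Multiplication by u is a linear map of the plane whose determinant is the norm of u. -/
theorem cross_mul (u x y : ShapeAlg c) :
    cross (u * x) (u * y) = QuadraticAlgebra.norm u * cross x y := by
  simp only [cross, QuadraticAlgebra.norm_def, QuadraticAlgebra.re_mul, QuadraticAlgebra.im_mul]
  ring

/-- After the κ-axis is stretched by s, `cross` is the product of two Euclidean lengths and the sine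
of the angle between them, up to the factor s. -/
theorem exists_unique_sector_of_polar {u : ℕ → ShapeAlg c} {θ r : ℕ → ℝ} {s : ℝ} (hs : 0 < s)
    (hr : ∀ k, 0 < r k) (hre : ∀ k, (u k).re = r k * Real.cos (θ k))
    (him : ∀ k, s * (u k).im = r k * Real.sin (θ k)) {n : ℕ}
    (hstep : ∀ k < n, 0 < θ (k + 1) - θ k ∧ θ (k + 1) - θ k < Real.pi)
    (hn : θ n = θ 0 + 2 * Real.pi) {x : ShapeAlg c} (hx : x ≠ 0) :
    ∃! k, k < n ∧ 0 ≤ cross (u k) x ∧ 0 < cross x (u (k + 1)) := by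
  set z : ℂ := ⟨x.re, s * x.im⟩ with hz
  have hz0 : z ≠ 0 := by
    intro h
    apply hx
    have h1 := congrArg Complex.re h
    have h2 := congrArg Complex.im h
    simp [hz] at h1 h2
    ext
    · exact h1
    · exact h2.resolve_left hs.ne'
  have hz1 : x.re = ‖z‖ * Real.cos (Complex.arg z) := (Complex.norm_mul_cos_arg z).symm
  have hz2 : s * x.im = ‖z‖ * Real.sin (Complex.arg z) := (Complex.norm_mul_sin_arg z).symm
  have hzn : 0 < ‖z‖ := norm_pos_iff.mpr hz0
  have e1 : ∀ k, s * cross (u k) x = r k * ‖z‖ * Real.sin (Complex.arg z - θ k) := by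
    intro k
    rw [cross, Real.sin_sub]
    linear_combination x.im * s * hre k - x.re * him k + r k * Real.cos (θ k) * hz2 -
      r k * Real.sin (θ k) * hz1
  have e2 : ∀ k, s * cross x (u k) = r k * ‖z‖ * Real.sin (θ k - Complex.arg z) := by
    intro k
    rw [cross, Real.sin_sub]
    linear_combination -x.im * s * hre k + x.re * him k - r k * Real.cos (θ k) * hz2 +
      r k * Real.sin (θ k) * hz1
  have f1 : ∀ k, 0 ≤ cross (u k) x ↔ 0 ≤ Real.sin (Complex.arg z - θ k) := by
    intro k
    rw [← mul_nonneg_iff_of_pos_left hs, e1, mul_nonneg_iff_of_pos_left (mul_pos (hr k) hzn)]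
  have f2 : ∀ k, 0 < cross x (u k) ↔ 0 < Real.sin (θ k - Complex.arg z) := by
    intro k
    rw [← mul_pos_iff_of_pos_left hs, e2, mul_pos_iff_of_pos_left (mul_pos (hr k) hzn)]
  simp only [f1, f2]
  exact exists_unique_sector hstep hn _

theorem sector_step {s r r' θ θ' : ℝ} {u u' : ShapeAlg c} (hs : 0 < s) (hr : 0 < r) (hr' : 0 < r')
    (hre : u.re = r * Real.cos θ) (him : s * u.im = r * Real.sin θ)
    (hre' : u'.re = r' * Real.cos θ') (him' : s * u'.im = r' * Real.sin θ')
    (h : 0 < cross u u') : 0 < Real.sin (θ' - θ) := by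
  have : s * cross u u' = r * r' * Real.sin (θ' - θ) := by
    rw [cross, Real.sin_sub]
    linear_combination u'.im * s * hre - u'.re * him + r * Real.cos θ * him' -
      r * Real.sin θ * hre'
  have h2 : 0 < r * r' * Real.sin (θ' - θ) := this ▸ mul_pos hs h
  exact (mul_pos_iff_of_pos_left (mul_pos hr hr')).mp h2

/-- The sectors between consecutive partial products of elements of `ℝ + ℝκ` with total angle `2π`
cover the plane exactly once. -/
theorem exists_unique_sector_of_sum_dihedralAngle {u w : ℕ → ShapeAlg c} (h0 : u 0 = 1)
    (hu : ∀ k, u (k + 1) = u k * w k) (hw : ∀ k, 0 < QuadraticAlgebra.norm (w k))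
    (hw' : ∀ k, 0 < (w k).im) {n : ℕ} (hun : u n = 1)
    (hsum : ∑ k ∈ Finset.range n, dihedralAngle (w k) = 2 * Real.pi) {x : ShapeAlg c}
    (hx : x ≠ 0) : ∃! k, k < n ∧ 0 ≤ cross (u k) x ∧ 0 < cross x (u (k + 1)) := by
  have hun0 : ∀ k, 0 < QuadraticAlgebra.norm (u k) := by
    intro k
    induction k with
    | zero => rw [h0, map_one]; exact one_pos
    | succ k ih => rw [hu, map_mul]; exact mul_pos ih (hw k)
  have hcross : ∀ k, 0 < cross (u k) (u (k + 1)) := by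
    intro k
    have h := cross_mul (u k) 1 (w k)
    rw [mul_one] at h
    rw [hu, h]
    refine mul_pos (hun0 k) ?_
    simpa [cross, QuadraticAlgebra.re_one, QuadraticAlgebra.im_one] using hw' k
  rcases lt_or_ge c 0 with hc | hc
  -- For negative c, stretching by √(-c) is multiplicative into ℂ, so partial sums of arguments are
  -- angles of the partial products.
  · set s := √(-c) with hs
    have hs0 : 0 < s := Real.sqrt_pos.mpr (by linarith)
    have hss : s * s = -c := Real.mul_self_sqrt (by linarith)
    set ι : ShapeAlg c → ℂ := fun a => ⟨a.re, s * a.im⟩ with hι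
    have hmul : ∀ a b, ι (a * b) = ι a * ι b := by
      intro a b
      apply Complex.ext
      · simp [hι]; linear_combination (a.im * b.im) * hss
      · simp [hι]; ring
    have hang : ∀ k, dihedralAngle (w k) = Complex.arg (ι (w k)) := fun k => by
      rw [dihedralAngle, if_pos hc]
    set θ : ℕ → ℝ := fun k => ∑ i ∈ Finset.range k, dihedralAngle (w i) with hθ
    have hpolar : ∀ k, ι (u k) = ‖ι (u k)‖ * Complex.exp (θ k * Complex.I) := by
      intro k
      induction k with
      | zero =>
        rw [h0, hθ]
        have : ι 1 = 1 := by
          apply Complex.ext <;> simp [hι, QuadraticAlgebra.re_one, QuadraticAlgebra.im_one]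
        simp [this]
      | succ k ih =>
        have e : θ (k + 1) = θ k + Complex.arg (ι (w k)) := by
          rw [hθ]; simp only [Finset.sum_range_succ, hang]
        rw [hu, hmul, norm_mul, e]
        push_cast
        rw [add_mul, Complex.exp_add]
        conv_lhs => rw [ih, ← Complex.norm_mul_exp_arg_mul_I (ι (w k))]
        ring
    have hre : ∀ k, (u k).re = ‖ι (u k)‖ * Real.cos (θ k) := by
      intro k
      have := congrArg Complex.re (hpolar k)
      rwa [Complex.re_ofReal_mul, Complex.exp_ofReal_mul_I_re] at this
    have him : ∀ k, s * (u k).im = ‖ι (u k)‖ * Real.sin (θ k) := by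
      intro k
      have := congrArg Complex.im (hpolar k)
      rwa [Complex.im_ofReal_mul, Complex.exp_ofReal_mul_I_im] at this
    have hr : ∀ k, 0 < ‖ι (u k)‖ := by
      intro k
      rw [norm_pos_iff]
      intro h
      have h1 : (u k).re = 0 := congrArg Complex.re h
      have h2 : s * (u k).im = 0 := congrArg Complex.im h
      have h3 := hun0 k
      rw [QuadraticAlgebra.norm_def, h1, (mul_eq_zero.mp h2).resolve_left hs0.ne'] at h3
      simp at h3
    refine exists_unique_sector_of_polar hs0 hr hre him (fun k _ => ?_) ?_ hx
    · have e : θ (k + 1) - θ k = Complex.arg (ι (w k)) := by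
        rw [hθ]; simp only [Finset.sum_range_succ, hang]; ring
      have hi : 0 < (ι (w k)).im := mul_pos hs0 (hw' k)
      rw [e]
      constructor
      · refine lt_of_le_of_ne (Complex.arg_nonneg_iff.mpr hi.le) fun h => ?_
        exact hi.ne' (Complex.arg_eq_zero_iff.mp h.symm).2
      · exact Complex.arg_lt_pi_iff.mpr (Or.inr hi.ne')
    · simp only [hθ, hsum, Finset.range_zero, Finset.sum_empty, zero_add]
  · set Θ : ℕ → ℝ := fun k => ∑ i ∈ Finset.range k, dihedralAngle (w i) with hΘ
    -- For c ≥ 0 a positive norm keeps the real part nonzero. A lift of the angle is therefore the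
    -- arctangent of the slope plus π for every change of sign of the real part, and Θ collects
    -- these changes.
    set θ : ℕ → ℝ := fun k => Real.arctan ((u k).im / (u k).re) + Θ k with hθ
    have hang : ∀ k, dihedralAngle (w k) = if (w k).re < 0 then Real.pi else 0 := fun k => by
      rw [dihedralAngle, if_neg (not_lt.mpr hc)]
    have hΘs : ∀ k, Θ (k + 1) = Θ k + if (w k).re < 0 then Real.pi else 0 := by
      intro k; rw [hΘ]; simp only [Finset.sum_range_succ, hang]
    have hsq : ∀ a : ShapeAlg c, 0 < QuadraticAlgebra.norm a → c * a.im ^ 2 < a.re ^ 2 := by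
      intro a ha
      rw [QuadraticAlgebra.norm_def] at ha
      linarith
    have hsin : ∀ k, Real.sin (Θ k) = 0 ∧ Real.cos (Θ k) ^ 2 = 1 ∧ 0 < (u k).re * Real.cos (Θ k) := by
      intro k
      induction k with
      | zero => simp [hΘ, h0, QuadraticAlgebra.re_one]
      | succ k ih =>
        obtain ⟨i1, i2, i3⟩ := ih
        have hwk : (w k).re ≠ 0 := by
          intro h
          have := hsq _ (hw k)
          rw [h] at this
          nlinarith [mul_nonneg hc (sq_nonneg (w k).im)]
        have hre : 0 < (u (k + 1)).re * ((u k).re * (w k).re) := by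
          have e : (u (k + 1)).re = (u k).re * (w k).re + c * (u k).im * (w k).im := by
            rw [hu]; simp
          rw [e]
          -- Positivity of both norms makes the κ² contribution too small to change the sign of the
          -- product of the real parts.
          have h1 : (c * (u k).im * (w k).im) ^ 2 < ((u k).re * (w k).re) ^ 2 := by
            calc (c * (u k).im * (w k).im) ^ 2 = c * (u k).im ^ 2 * (c * (w k).im ^ 2) := by ring
              _ ≤ (u k).re ^ 2 * (c * (w k).im ^ 2) :=
                mul_le_mul_of_nonneg_right (hsq _ (hun0 k)).le (mul_nonneg hc (sq_nonneg _))
              _ < (u k).re ^ 2 * (w k).re ^ 2 := by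
                refine mul_lt_mul_of_pos_left (hsq _ (hw k)) ?_
                exact lt_of_le_of_lt (mul_nonneg hc (sq_nonneg _)) (hsq _ (hun0 k))
              _ = _ := by ring
          nlinarith [sq_nonneg ((u k).re * (w k).re + c * (u k).im * (w k).im)]
        have hprod := mul_pos hre i3
        have hx2 : 0 < (u k).re ^ 2 :=
          lt_of_le_of_lt (mul_nonneg hc (sq_nonneg _)) (hsq _ (hun0 k))
        rw [hΘs]
        split_ifs with hneg
        · rw [Real.sin_add_pi, Real.cos_add_pi, i1]
          refine ⟨by simp, by simpa using i2, ?_⟩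
          refine pos_of_mul_pos_left (b := (u k).re ^ 2 * -(w k).re) ?_
            (mul_nonneg hx2.le (by linarith))
          calc 0 < _ := hprod
            _ = _ := by ring
        · rw [add_zero]
          refine ⟨i1, i2, ?_⟩
          refine pos_of_mul_pos_left (b := (u k).re ^ 2 * (w k).re) ?_
            (mul_nonneg hx2.le (not_lt.mp hneg))
          calc 0 < _ := hprod
            _ = _ := by ring
    have hcu : ∀ k, (u k).re ≠ 0 := fun k h => by
      have := (hsin k).2.2
      rw [h, zero_mul] at this
      exact lt_irrefl _ this
    set r : ℕ → ℝ := fun k => (u k).re * Real.cos (Θ k) * √(1 + ((u k).im / (u k).re) ^ 2) with hr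
    have hsq1 : ∀ y : ℝ, 0 < √(1 + y ^ 2) := fun y => Real.sqrt_pos.mpr (by positivity)
    have hr0 : ∀ k, 0 < r k := fun k => mul_pos (hsin k).2.2 (hsq1 _)
    have hre : ∀ k, (u k).re = r k * Real.cos (θ k) := by
      intro k
      obtain ⟨i1, i2, i3⟩ := hsin k
      have := (hsq1 ((u k).im / (u k).re)).ne'
      rw [hθ, hr]
      simp only [Real.cos_add, i1, Real.cos_arctan]
      field_simp
      linear_combination -(u k).re * i2
    have him : ∀ k, 1 * (u k).im = r k * Real.sin (θ k) := by
      intro k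
      obtain ⟨i1, i2, i3⟩ := hsin k
      have := (hsq1 ((u k).im / (u k).re)).ne'
      have := hcu k
      rw [hθ, hr]
      simp only [Real.sin_add, i1, Real.sin_arctan]
      field_simp
      linear_combination -(u k).im * i2
    refine exists_unique_sector_of_polar one_pos hr0 hre him (fun k _ => ?_) ?_ hx
    · have hs := sector_step one_pos (hr0 k) (hr0 (k + 1)) (hre k) (him k) (hre (k + 1))
        (him (k + 1)) (hcross k)
      have a1 := Real.neg_pi_div_two_lt_arctan ((u k).im / (u k).re)
      have a2 := Real.arctan_lt_pi_div_two ((u k).im / (u k).re)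
      have a3 := Real.neg_pi_div_two_lt_arctan ((u (k + 1)).im / (u (k + 1)).re)
      have a4 := Real.arctan_lt_pi_div_two ((u (k + 1)).im / (u (k + 1)).re)
      have e : θ (k + 1) - θ k = Real.arctan ((u (k + 1)).im / (u (k + 1)).re) -
          Real.arctan ((u k).im / (u k).re) + if (w k).re < 0 then Real.pi else 0 := by
        rw [hθ]; simp only [hΘs]; ring
      -- The arctangents confine the step to (-π, 2π); its sine is positive because `cross` is,
      -- which leaves (0, π).
      have hpos : 0 < θ (k + 1) - θ k := by
        by_contra hle
        have hle' := not_lt.mp hle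
        have := Real.sin_nonpos_of_nonpos_of_neg_pi_le hle' (by
          rw [e]; split_ifs <;> linarith [Real.pi_pos])
        linarith
      refine ⟨hpos, ?_⟩
      by_contra hle
      have hle' := not_lt.mp hle
      have hlt : θ (k + 1) - θ k < 2 * Real.pi := by
        rw [e]; split_ifs <;> linarith [Real.pi_pos]
      have := Real.sin_nonpos_of_nonpos_of_neg_pi_le
        (x := θ (k + 1) - θ k - 2 * Real.pi) (by linarith) (by linarith)
      rw [Real.sin_sub_two_pi] at this
      linarith
    · simp [hθ, hΘ, hsum, hun, h0, QuadraticAlgebra.im_one]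

end Fans

/-! ## Reparametrizations of the simplex -/

section Reparametrization

/-- The exponents of the reparametrization with edge ratios `r`. -/
def edgeExponent (r : Fin 4 → Fin 4 → ℝ) (s : V4) (i : Fin 4) : ℝ := ∑ k, s k * r k i

/-- The homogeneous coordinates of the reparametrization with edge ratios `r`. -/
def reweight (r : Fin 4 → Fin 4 → ℝ) (s : V4) : V4 := fun i => s i * Real.exp (edgeExponent r s i)

/-- Exponentials normalized to sum one. -/
def softmax (x : V4) : V4 := fun i => Real.exp (x i) / ∑ k, Real.exp (x k)

theorem sum_exp_pos (x : V4) : 0 < ∑ k, Real.exp (x k) :=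
  Finset.sum_pos (fun _ _ => Real.exp_pos _) Finset.univ_nonempty

theorem softmax_pos (x : V4) (i : Fin 4) : 0 < softmax x i :=
  div_pos (Real.exp_pos _) (sum_exp_pos x)

theorem sum_softmax (x : V4) : ∑ i, softmax x i = 1 := by
  simp only [softmax, ← Finset.sum_div]
  exact div_self (sum_exp_pos x).ne'

theorem contDiff_softmax : ContDiff ℝ 1 softmax := by
  rw [contDiff_pi]
  intro i
  refine ContDiff.div ?_ ?_ fun x => (sum_exp_pos x).ne'
  · exact Real.contDiff_exp.comp (contDiff_apply ℝ ℝ i)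
  · exact ContDiff.sum fun k _ => Real.contDiff_exp.comp (contDiff_apply ℝ ℝ k)

theorem hasDerivAt_softmax (x v : V4) (i : Fin 4) :
    HasDerivAt (fun t : ℝ => softmax (x + t • v) i)
      (softmax x i * (v i - ∑ k, softmax x k * v k)) 0 := by
  have he : ∀ k, HasDerivAt (fun t : ℝ => Real.exp ((x + t • v) k)) (Real.exp (x k) * v k) 0 := by
    intro k
    have h1 : HasDerivAt (fun t : ℝ => (x + t • v) k) (v k) 0 := by
      simpa using ((hasDerivAt_id (0 : ℝ)).mul_const (v k)).const_add (x k)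
    simpa using h1.exp
  have hs : HasDerivAt (fun t : ℝ => ∑ k, Real.exp ((x + t • v) k))
      (∑ k, Real.exp (x k) * v k) 0 := HasDerivAt.fun_sum fun k _ => he k
  have h := (he i).fun_div hs (sum_exp_pos _).ne'
  refine h.congr_deriv ?_
  have hne := (sum_exp_pos x).ne'
  have e : ∑ k, softmax x k * v k = (∑ k, Real.exp (x k) * v k) / ∑ k, Real.exp (x k) := by
    rw [Finset.sum_div]
    exact Finset.sum_congr rfl fun k _ => by rw [softmax, div_mul_eq_mul_div]
  rw [e, softmax]
  simp only [zero_smul, add_zero]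
  field_simp

/-- Antisymmetric bilinear forms vanish on the diagonal. -/
theorem sum_sum_antisymm {r : Fin 4 → Fin 4 → ℝ} (hr : ∀ k i, r k i = -r i k) (d : V4) :
    ∑ i, d i * ∑ k, d k * r k i = 0 := by
  have h : ∑ i, d i * ∑ k, d k * r k i = -∑ i, d i * ∑ k, d k * r k i := by
    conv_lhs => simp only [Finset.mul_sum]
    rw [Finset.sum_comm, ← Finset.sum_neg_distrib]
    refine Finset.sum_congr rfl fun i _ => ?_
    rw [Finset.mul_sum, ← Finset.sum_neg_distrib]
    refine Finset.sum_congr rfl fun k _ => ?_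
    rw [hr i k]
    ring
  linarith

/-- The map is proper, being at bounded distance from the identity, and it is open, so its range is
open and closed. For openness let p be the softmax of x, v a kernel vector of the derivative, m the
p-mean of v and d_k = p_k (v_k - m). Then v_i = -∑ d_k r_ki; pairing with d kills the antisymmetric
form and leaves the variance of v, so v is constant, d = 0 and v = 0. -/
theorem surjective_add_softmax {r : Fin 4 → Fin 4 → ℝ} (hr : ∀ k i, r k i = -r i k) :
    Function.Surjective fun (x : V4) (i : Fin 4) => x i + ∑ k, softmax x k * r k i := by
  set g : V4 → V4 := fun x i => x i + ∑ k, softmax x k * r k i with hg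
  have hgd : ContDiff ℝ 1 g := by
    rw [contDiff_pi]
    intro i
    refine (contDiff_apply ℝ ℝ i).add (ContDiff.sum fun k _ => ?_)
    exact ((contDiff_apply ℝ ℝ k).comp contDiff_softmax).mul contDiff_const
  have hopen : IsOpenMap g := by
    rw [isOpenMap_iff_nhds_le]
    intro x
    have hstrict : HasStrictFDerivAt g (fderiv ℝ g x) x :=
      hgd.contDiffAt.hasStrictFDerivAt one_ne_zero
    refine (hstrict.map_nhds_eq_of_surj ?_).ge
    rw [LinearMap.range_eq_top]
    have hinj : Function.Injective (fderiv ℝ g x : V4 →ₗ[ℝ] V4) := by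
      rw [← LinearMap.ker_eq_bot, LinearMap.ker_eq_bot']
      intro v hv
      have hline : HasDerivAt (fun t : ℝ => g (x + t • v)) (fderiv ℝ g x v) 0 := by
        have h1 : HasDerivAt (fun t : ℝ => x + t • v) v 0 := by
          simpa using ((hasDerivAt_id (0 : ℝ)).smul_const v).const_add x
        have h2 : HasFDerivAt g (fderiv ℝ g x) (x + (0 : ℝ) • v) := by
          rw [zero_smul, add_zero]
          exact hstrict.hasFDerivAt
        exact h2.comp_hasDerivAt (0 : ℝ) h1
      rw [show fderiv ℝ g x v = 0 from hv, hasDerivAt_pi] at hline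
      set m := ∑ k, softmax x k * v k with hm
      set d : V4 := fun k => softmax x k * (v k - m) with hd
      have hcomp : ∀ i, v i + ∑ k, d k * r k i = 0 := by
        intro i
        have h1 : HasDerivAt (fun t : ℝ => (x + t • v) i) (v i) 0 := by
          simpa using ((hasDerivAt_id (0 : ℝ)).mul_const (v i)).const_add (x i)
        have h2 := h1.add (HasDerivAt.fun_sum (u := Finset.univ)
          fun k _ => (hasDerivAt_softmax x v k).mul_const (r k i))
        exact h2.unique (hline i)
      have hsum : ∑ i, d i = 0 := by
        simp only [hd, mul_sub, Finset.sum_sub_distrib, ← Finset.sum_mul, sum_softmax]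
        rw [hm]; ring
      have h3 : ∑ i, d i * v i = 0 := by
        have h4 : ∑ i, d i * (v i + ∑ k, d k * r k i) = 0 :=
          Finset.sum_eq_zero fun i _ => by rw [hcomp, mul_zero]
        simp only [mul_add, Finset.sum_add_distrib, sum_sum_antisymm hr] at h4
        linarith
      have h5 : ∑ i, softmax x i * (v i - m) ^ 2 = 0 := by
        calc ∑ i, softmax x i * (v i - m) ^ 2 = ∑ i, d i * v i - (∑ i, d i) * m := by
              rw [Finset.sum_mul, ← Finset.sum_sub_distrib]
              refine Finset.sum_congr rfl fun i _ => ?_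
              rw [hd]; ring
          _ = 0 := by rw [h3, hsum]; ring
      have h6 : ∀ i, v i - m = 0 := by
        intro i
        have := (Finset.sum_eq_zero_iff_of_nonneg fun i _ =>
          mul_nonneg (softmax_pos x i).le (sq_nonneg _)).mp h5 i (Finset.mem_univ i)
        exact pow_eq_zero_iff two_ne_zero |>.mp ((mul_eq_zero.mp this).resolve_left
          (softmax_pos x i).ne')
      ext i
      have := hcomp i
      simpa [hd, h6] using this
    exact LinearMap.injective_iff_surjective.mp hinj
  have hcont : Continuous g := hgd.continuous
  have hbound : ∃ C, ∀ x, ‖x - g x‖ ≤ C := by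
    refine ⟨∑ i, ∑ k, |r k i|, fun x => ?_⟩
    rw [pi_norm_le_iff_of_nonneg (by positivity)]
    intro i
    have e : (x - g x) i = -∑ k, softmax x k * r k i := by simp [hg]
    rw [e, norm_neg]
    calc ‖∑ k, softmax x k * r k i‖ ≤ ∑ k, ‖softmax x k * r k i‖ := norm_sum_le _ _
      _ ≤ ∑ k, |r k i| := by
        refine Finset.sum_le_sum fun k _ => ?_
        rw [norm_mul, Real.norm_eq_abs, Real.norm_eq_abs, abs_of_pos (softmax_pos x k)]
        refine mul_le_of_le_one_left (abs_nonneg _) ?_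
        rw [← sum_softmax x]
        exact Finset.single_le_sum (fun i _ => (softmax_pos x i).le) (Finset.mem_univ k)
      _ ≤ _ := Finset.single_le_sum (f := fun i => ∑ k, |r k i|)
        (fun i _ => by positivity) (Finset.mem_univ i)
  obtain ⟨C, hC⟩ := hbound
  have hproper : IsProperMap g := by
    rw [isProperMap_iff_tendsto_cocompact]
    refine ⟨hcont, ?_⟩
    rw [← Metric.cobounded_eq_cocompact,
      ← tendsto_norm_atTop_iff_cobounded]
    refine Filter.tendsto_atTop_mono (f := fun x => ‖x‖ - C) (fun x => ?_) ?_
    · have := norm_sub_norm_le x (g x)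
      linarith [hC x]
    · exact Filter.tendsto_atTop_add_const_right _ _ tendsto_norm_cobounded_atTop
  rw [← Set.range_eq_univ]
  exact IsClopen.eq_univ ⟨hproper.isClosedMap.isClosed_range, hopen.isOpen_range⟩
    (Set.range_nonempty g)

theorem continuous_reweight (r : Fin 4 → Fin 4 → ℝ) : Continuous (reweight r) := by
  unfold reweight edgeExponent
  fun_prop

theorem sum_reweight_pos (r : Fin 4 → Fin 4 → ℝ) {s : V4} (hs : s ∈ stdSimplex ℝ (Fin 4)) :
    0 < ∑ i, reweight r s i := by
  have h0 : ∀ i, 0 ≤ reweight r s i := fun i => mul_nonneg (hs.1 i) (Real.exp_pos _).le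
  obtain ⟨i, -, hi⟩ : ∃ i ∈ Finset.univ, 0 < s i := by
    apply Finset.exists_lt_of_sum_lt (f := fun _ => (0 : ℝ))
    rw [hs.2]
    simp
  exact Finset.sum_pos' (fun i _ => h0 i) ⟨i, Finset.mem_univ i, mul_pos hi (Real.exp_pos _)⟩

/-- The reparametrization of the closed simplex. -/
def simplexMap (r : Fin 4 → Fin 4 → ℝ) (s : stdSimplex ℝ (Fin 4)) : stdSimplex ℝ (Fin 4) :=
  ⟨fun i => reweight r s.1 i / ∑ k, reweight r s.1 k, by
    constructor
    · intro i
      exact div_nonneg (mul_nonneg (s.2.1 i) (Real.exp_pos _).le) (sum_reweight_pos r s.2).le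
    · rw [← Finset.sum_div]
      exact div_self (sum_reweight_pos r s.2).ne'⟩

theorem continuous_simplexMap (r : Fin 4 → Fin 4 → ℝ) : Continuous (simplexMap r) := by
  refine Continuous.subtype_mk (continuous_pi fun i => ?_) _
  have h : Continuous fun s : stdSimplex ℝ (Fin 4) => reweight r s.1 :=
    (continuous_reweight r).comp continuous_subtype_val
  exact ((continuous_apply i).comp h).div
    (continuous_finsetSum _ fun k _ => (continuous_apply k).comp h)
    fun s => (sum_reweight_pos r s.2).ne'

theorem simplexMap_eq_zero (r : Fin 4 → Fin 4 → ℝ) (s : stdSimplex ℝ (Fin 4)) (i : Fin 4) :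
    (simplexMap r s).1 i = 0 ↔ s.1 i = 0 := by
  change reweight r s.1 i / ∑ k, reweight r s.1 k = 0 ↔ _
  rw [div_eq_zero_iff, or_iff_left (sum_reweight_pos r s.2).ne', reweight, mul_eq_zero,
    or_iff_left (Real.exp_ne_zero _)]

/-- Take logarithms of the two equal images and pair their difference with d = s - s'. The
antisymmetric form vanishes and the normalizing constant drops out as d sums to zero. What remains
is ∑ d_i (log s_i - log s'_i) = 0, whose terms are nonnegative by monotonicity of the logarithm. -/
theorem simplexMap_injective {r : Fin 4 → Fin 4 → ℝ} (hr : ∀ k i, r k i = -r i k) :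
    Function.Injective (simplexMap r) := by
  intro s s' h
  set K := Real.log (∑ k, reweight r s.1 k) - Real.log (∑ k, reweight r s'.1 k) with hK
  set d : V4 := s.1 - s'.1 with hd
  -- The points have the same zero coordinates, so indices at which the logarithm takes its default
  -- value contribute nothing.
  have hz : ∀ i, s.1 i = 0 ↔ s'.1 i = 0 := by
    intro i
    rw [← simplexMap_eq_zero r s, h, simplexMap_eq_zero]
  have hterm : ∀ i, d i * (Real.log (s.1 i) - Real.log (s'.1 i)) + d i * ∑ k, d k * r k i =
      d i * K := by
    intro i
    rcases (s.2.1 i).eq_or_lt with h0 | h0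
    · have h0' := (hz i).mp h0.symm
      simp [hd, ← h0, h0']
    · have h0' : 0 < s'.1 i :=
        lt_of_le_of_ne (s'.2.1 i) fun h => h0.ne' ((hz i).mpr h.symm)
      have e : Real.log (reweight r s.1 i / ∑ k, reweight r s.1 k) =
          Real.log (reweight r s'.1 i / ∑ k, reweight r s'.1 k) :=
        congrArg (fun s : stdSimplex ℝ (Fin 4) => Real.log (s.1 i)) h
      have p : reweight r s.1 i ≠ 0 := (mul_pos h0 (Real.exp_pos _)).ne'
      have p' : reweight r s'.1 i ≠ 0 := (mul_pos h0' (Real.exp_pos _)).ne'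
      rw [Real.log_div p (sum_reweight_pos r s.2).ne',
        Real.log_div p' (sum_reweight_pos r s'.2).ne',
        show reweight r s.1 i = s.1 i * Real.exp (edgeExponent r s.1 i) from rfl,
        show reweight r s'.1 i = s'.1 i * Real.exp (edgeExponent r s'.1 i) from rfl, Real.log_mul h0.ne' (Real.exp_ne_zero _), Real.log_mul h0'.ne' (Real.exp_ne_zero _),
        Real.log_exp, Real.log_exp] at e
      have e2 : ∑ k, d k * r k i = edgeExponent r s.1 i - edgeExponent r s'.1 i := by
        simp [edgeExponent, hd, sub_mul]
      rw [e2, ← mul_add]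
      congr 1
      linarith
  have hsum : ∑ i, d i * (Real.log (s.1 i) - Real.log (s'.1 i)) = 0 := by
    have h1 := Finset.sum_congr rfl fun i (_ : i ∈ Finset.univ) => hterm i
    rw [Finset.sum_add_distrib, sum_sum_antisymm hr, ← Finset.sum_mul] at h1
    have h2 : ∑ i, d i = 0 := by
      simp only [hd, Pi.sub_apply, Finset.sum_sub_distrib]
      rw [s.2.2, s'.2.2, sub_self]
    rw [h2] at h1
    linarith
  have hnn : ∀ i, 0 ≤ d i * (Real.log (s.1 i) - Real.log (s'.1 i)) ∧
      (d i * (Real.log (s.1 i) - Real.log (s'.1 i)) = 0 → d i = 0) := by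
    intro i
    rcases (s.2.1 i).eq_or_lt with h0 | h0
    · have h0' := (hz i).mp h0.symm
      simp [hd, ← h0, h0']
    · have h0' : 0 < s'.1 i :=
        lt_of_le_of_ne (s'.2.1 i) fun h => h0.ne' ((hz i).mpr h.symm)
      rcases lt_trichotomy (s.1 i) (s'.1 i) with hlt | heq | hlt
      · have := Real.log_lt_log h0 hlt
        have h3 : 0 < d i * (Real.log (s.1 i) - Real.log (s'.1 i)) :=
          mul_pos_of_neg_of_neg (by simp [hd, hlt]) (by linarith)
        exact ⟨h3.le, fun h => absurd h h3.ne'⟩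
      · simp [hd, heq]
      · have := Real.log_lt_log h0' hlt
        have h3 : 0 < d i * (Real.log (s.1 i) - Real.log (s'.1 i)) :=
          mul_pos (by simp [hd, hlt]) (by linarith)
        exact ⟨h3.le, fun h => absurd h h3.ne'⟩
  refine Subtype.ext (funext fun i => ?_)
  have := (hnn i).2 ((Finset.sum_eq_zero_iff_of_nonneg fun i _ => (hnn i).1).mp hsum i
    (Finset.mem_univ i))
  exact sub_eq_zero.mp this

/-- In logarithmic coordinates on the interior the map is that of `surjective_add_softmax` up to a
common factor, so interior points are attained. The range is closed by compactness and hence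
contains the boundary. -/
theorem simplexMap_surjective {r : Fin 4 → Fin 4 → ℝ} (hr : ∀ k i, r k i = -r i k) :
    Function.Surjective (simplexMap r) := by
  have : CompactSpace (stdSimplex ℝ (Fin 4)) :=
    isCompact_iff_compactSpace.mp (isCompact_stdSimplex ℝ (Fin 4))
  have hclosed : IsClosed (Set.range (simplexMap r)) :=
    (isCompact_range (continuous_simplexMap r)).isClosed
  have hint : ∀ y : stdSimplex ℝ (Fin 4), (∀ i, 0 < y.1 i) → y ∈ Set.range (simplexMap r) := by
    intro y hy
    obtain ⟨x, hx⟩ := surjective_add_softmax hr fun i => Real.log (y.1 i)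
    refine ⟨⟨softmax x, fun i => (softmax_pos x i).le, sum_softmax x⟩, ?_⟩
    have hw : ∀ i, reweight r (softmax x) i = y.1 i / ∑ k, Real.exp (x k) := by
      intro i
      have h1 := congrFun hx i
      rw [reweight, edgeExponent, show ∑ k, softmax x k * r k i = Real.log (y.1 i) - x i by
        linarith, Real.exp_sub, Real.exp_log (hy i), softmax]
      have := (Real.exp_pos (x i)).ne'
      have := (sum_exp_pos x).ne'
      field_simp
    refine Subtype.ext (funext fun i => ?_)
    simp only [simplexMap, hw, ← Finset.sum_div]
    rw [y.2.2]
    have := (sum_exp_pos x).ne'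
    field_simp
  intro y
  change y ∈ Set.range (simplexMap r)
  have hmem : ∀ ε : Set.Icc (0 : ℝ) 1, (fun i => (1 - ε.1) * y.1 i + ε.1 * (1 / 4)) ∈
      stdSimplex ℝ (Fin 4) := by
    rintro ⟨ε, h0, h1⟩
    refine ⟨fun i => add_nonneg (mul_nonneg (by linarith) (y.2.1 i)) (by positivity), ?_⟩
    rw [Finset.sum_add_distrib, ← Finset.mul_sum, y.2.2]
    simp
    ring
  -- The segment from y to the barycentre, interior to the simplex for ε > 0.
  set p : Set.Icc (0 : ℝ) 1 → stdSimplex ℝ (Fin 4) := fun ε => ⟨_, hmem ε⟩ with hp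
  have hpc : Continuous p := by
    refine Continuous.subtype_mk ?_ _
    fun_prop
  have h0 : p 0 = y := Subtype.ext (funext fun i => by simp [hp])
  have hsub : p ⁻¹' (Set.range (simplexMap r)) = Set.univ := by
    refine (IsClosed.closure_eq (hclosed.preimage hpc)).symm.trans (Dense.closure_eq ?_)
    refine Dense.mono (s₁ := {(0 : Set.Icc (0 : ℝ) 1)}ᶜ) ?_ (dense_compl_singleton 0)
    intro ε hε
    have hε0 : 0 < ε.1 := lt_of_le_of_ne ε.2.1 fun h => hε (Subtype.ext h.symm)
    refine hint _ fun i => ?_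
    have := mul_nonneg (sub_nonneg.mpr ε.2.2) (y.2.1 i)
    exact add_pos_of_nonneg_of_pos this (by positivity)
  have : (0 : Set.Icc (0 : ℝ) 1) ∈ p ⁻¹' (Set.range (simplexMap r)) := by
    rw [hsub]; exact Set.mem_univ _
  rwa [Set.mem_preimage, h0] at this

/-- The reparametrization of the closed simplex as a homeomorphism. -/
def simplexHomeo {r : Fin 4 → Fin 4 → ℝ} (hr : ∀ k i, r k i = -r i k) :
    stdSimplex ℝ (Fin 4) ≃ₜ stdSimplex ℝ (Fin 4) :=
  haveI : CompactSpace (stdSimplex ℝ (Fin 4)) :=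
    isCompact_iff_compactSpace.mp (isCompact_stdSimplex ℝ (Fin 4))
  Continuous.homeoOfEquivCompactToT2
    (f := Equiv.ofBijective _ ⟨simplexMap_injective hr, simplexMap_surjective hr⟩)
    (continuous_simplexMap r)

theorem simplexHomeo_apply {r : Fin 4 → Fin 4 → ℝ} (hr : ∀ k i, r k i = -r i k)
    (s : stdSimplex ℝ (Fin 4)) : simplexHomeo hr s = simplexMap r s := rfl

/-- Vertices are thus recognized by their vanishing coordinates, which the reparametrization
preserves; so it restricts to the simplex without vertices. -/
theorem lt_one_iff {s : V4} (hs : s ∈ stdSimplex ℝ (Fin 4)) (i : Fin 4) :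
    s i < 1 ↔ ∃ k, k ≠ i ∧ s k ≠ 0 := by
  have h : s i + ∑ k ∈ Finset.univ.erase i, s k = 1 := by
    rw [Finset.add_sum_erase _ _ (Finset.mem_univ i)]; exact hs.2
  constructor
  · intro hlt
    by_contra hcon
    push Not at hcon
    rw [Finset.sum_eq_zero fun k hk => hcon k (Finset.ne_of_mem_erase hk)] at h
    linarith
  · rintro ⟨k, hk, hk0⟩
    have : 0 < ∑ k ∈ Finset.univ.erase i, s k :=
      Finset.sum_pos' (fun k _ => hs.1 k) ⟨k, Finset.mem_erase.mpr ⟨hk, Finset.mem_univ k⟩,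
        lt_of_le_of_ne (hs.1 k) (Ne.symm hk0)⟩
    linarith

/-- A point of the simplex minus its vertices as a point of the closed simplex. -/
def IdealSimplex.toStd (s : IdealSimplex) : stdSimplex ℝ (Fin 4) :=
  ⟨s.1, fun i => (s.2.1 i).1, s.2.2⟩

theorem continuous_idealSimplex_val : Continuous (fun s : IdealSimplex => s.1) :=
  continuous_subtype_val

theorem continuous_toStd : Continuous IdealSimplex.toStd :=
  Continuous.subtype_mk continuous_idealSimplex_val _

/-- The reparametrization of the simplex minus its vertices. -/
def idealSimplexHomeo {r : Fin 4 → Fin 4 → ℝ} (hr : ∀ k i, r k i = -r i k) :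
    IdealSimplex ≃ₜ IdealSimplex where
  toFun s := ⟨(simplexHomeo hr s.toStd).1, fun i => ⟨(simplexHomeo hr s.toStd).2.1 i, by
    obtain ⟨k, hk, hk0⟩ := (lt_one_iff s.toStd.2 i).mp (s.2.1 i).2
    exact (lt_one_iff (simplexHomeo hr s.toStd).2 i).mpr
      ⟨k, hk, fun h => hk0 ((simplexMap_eq_zero r s.toStd k).mp h)⟩⟩,
    (simplexHomeo hr s.toStd).2.2⟩
  invFun s := ⟨((simplexHomeo hr).symm s.toStd).1,
    fun i => ⟨((simplexHomeo hr).symm s.toStd).2.1 i, by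
      obtain ⟨k, hk, hk0⟩ := (lt_one_iff s.toStd.2 i).mp (s.2.1 i).2
      refine (lt_one_iff ((simplexHomeo hr).symm s.toStd).2 i).mpr ⟨k, hk, fun h => hk0 ?_⟩
      have := (simplexMap_eq_zero r ((simplexHomeo hr).symm s.toStd) k).mpr h
      rwa [← simplexHomeo_apply hr, Homeomorph.apply_symm_apply] at this⟩,
    ((simplexHomeo hr).symm s.toStd).2.2⟩
  left_inv s := Subtype.ext
    (congrArg Subtype.val ((simplexHomeo hr).symm_apply_apply s.toStd) : _)
  right_inv s := Subtype.ext
    (congrArg Subtype.val ((simplexHomeo hr).apply_symm_apply s.toStd) : _)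
  continuous_toFun := Continuous.subtype_mk (continuous_subtype_val.comp
    ((simplexHomeo hr).continuous.comp continuous_toStd)) _
  continuous_invFun := Continuous.subtype_mk (continuous_subtype_val.comp
    ((simplexHomeo hr).symm.continuous.comp continuous_toStd)) _

theorem idealSimplexHomeo_apply {r : Fin 4 → Fin 4 → ℝ} (hr : ∀ k i, r k i = -r i k)
    (s : IdealSimplex) (i : Fin 4) : (idealSimplexHomeo hr s).1 i =
      reweight r s.1 i / ∑ k, reweight r s.1 k := rfl

end Reparametrization

/-! ## Turning around the edges of a solution -/

/-- An even permutation with prescribed values at `0` and `1`. -/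
theorem exists_even_perm : ∀ k i : Fin 4, k ≠ i →
    ∃ σ : Equiv.Perm (Fin 4), Equiv.Perm.sign σ = 1 ∧ σ 0 = k ∧ σ 1 = i := by
  decide

open Classical in
/-- The even permutation with values `k` and `i` at `0` and `1`. -/
def pairPerm (k i : Fin 4) : {σ : Equiv.Perm (Fin 4) // Equiv.Perm.sign σ = 1} :=
  if h : k ≠ i then ⟨(exists_even_perm k i h).choose, (exists_even_perm k i h).choose_spec.1⟩
  else ⟨1, by simp⟩

theorem pairPerm_zero {k i : Fin 4} (h : k ≠ i) : (pairPerm k i).1 0 = k := by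
  rw [pairPerm, dif_pos h]
  exact (exists_even_perm k i h).choose_spec.2.1

theorem pairPerm_one {k i : Fin 4} (h : k ≠ i) : (pairPerm k i).1 1 = i := by
  rw [pairPerm, dif_pos h]
  exact (exists_even_perm k i h).choose_spec.2.2

theorem eq_pairPerm {k i : Fin 4} (h : k ≠ i)
    {σ : {σ : Equiv.Perm (Fin 4) // Equiv.Perm.sign σ = 1}} (h0 : σ.1 0 = k) (h1 : σ.1 1 = i) :
    σ = pairPerm k i :=
  Subtype.ext (IdealTriangulation.even_perm_ext σ.2 (pairPerm k i).2 (h0.trans (pairPerm_zero h).symm)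
    (h1.trans (pairPerm_one h).symm))

namespace IdealTriangulation

variable {N : ℕ} (T : IdealTriangulation N)

/-- A distinguished flag among those at the same edge of the triangulation. -/
def flagBase (f : EdgeFlag N) : EdgeFlag N :=
  (Quotient.mk (Equiv.Perm.SameCycle.setoid T.flagNext) f).out

theorem flagBase_sameCycle (f : EdgeFlag N) : T.flagNext.SameCycle (T.flagBase f) f :=
  Quotient.exact (Quotient.out_eq (Quotient.mk (Equiv.Perm.SameCycle.setoid T.flagNext) f))

theorem flagBase_flagNext (f : EdgeFlag N) : T.flagBase (T.flagNext f) = T.flagBase f :=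
  congrArg Quotient.out (Quotient.sound
    (s := Equiv.Perm.SameCycle.setoid T.flagNext) (Equiv.Perm.sameCycle_apply_left.mpr
      (Equiv.Perm.SameCycle.refl _ f)))

/-- The number of steps from the distinguished flag. -/
def flagIndex (f : EdgeFlag N) : ℕ :=
  (T.exists_iterate_of_sameCycle (T.flagBase_sameCycle f)).choose

theorem flagIndex_lt (f : EdgeFlag N) : T.flagIndex f < T.flagPeriod (T.flagBase f) :=
  (T.exists_iterate_of_sameCycle (T.flagBase_sameCycle f)).choose_spec.1

theorem iterate_flagIndex (f : EdgeFlag N) : T.flagNext^[T.flagIndex f] (T.flagBase f) = f :=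
  (T.exists_iterate_of_sameCycle (T.flagBase_sameCycle f)).choose_spec.2

/-- The product of the first `k` shape parameters around the edge of `f`. -/
def partialTurn {R : Type} [CommRing R] (w : Fin N → R) (f : EdgeFlag N) (k : ℕ) : R :=
  ∏ i ∈ Finset.range k, flagShape (w (T.flagNext^[i] f).1) (T.flagNext^[i] f).2.1

/-- The product of the shape parameters from the distinguished flag to `f`. -/
def turn {R : Type} [CommRing R] (w : Fin N → R) (f : EdgeFlag N) : R :=
  T.partialTurn w (T.flagBase f) (T.flagIndex f)

variable {T} {c : ℝ} {w : Fin N → ShapeAlg c}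

theorem IsPositiveSolution.isPositiveShape (hw : T.IsPositiveSolution w) (j : Fin N) :
    IsPositiveShape (w j) := hw.1 j

theorem partialTurn_flagPeriod (hw : T.IsPositiveSolution w) (f : EdgeFlag N) :
    T.partialTurn w f (T.flagPeriod f) = 1 := by
  have h := (hw.2 (flagEdge f)).1
  rw [prod_edgeClass_flagEdge] at h
  exact h

/-- The only case that is not formal is the return to the distinguished flag, where the index drops
to zero; there the edge equation makes the full product 1. -/
theorem turn_flagNext (hw : T.IsPositiveSolution w) (f : EdgeFlag N) :
    T.turn w (T.flagNext f) = T.turn w f * flagShape (w f.1) f.2.1 := by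
  have h1 : T.turn w f * flagShape (w f.1) f.2.1 =
      T.partialTurn w (T.flagBase f) (T.flagIndex f + 1) := by
    rw [partialTurn, Finset.prod_range_succ, T.iterate_flagIndex]
    rfl
  have h2 : T.flagNext^[T.flagIndex f + 1] (T.flagBase f) = T.flagNext f := by
    rw [Function.iterate_succ_apply', T.iterate_flagIndex]
  have h3 := T.iterate_flagIndex (T.flagNext f)
  have h4 := T.flagIndex_lt (T.flagNext f)
  rw [T.flagBase_flagNext] at h3 h4
  rw [h1, turn, T.flagBase_flagNext]
  rcases lt_or_eq_of_le (Nat.succ_le_of_lt (T.flagIndex_lt f)) with h | h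
  · rw [(Function.iterate_eq_iterate_iff_of_lt_minimalPeriod h4 h).mp (h3.trans h2.symm)]
  · rw [Nat.succ_eq_add_one] at h
    rw [h, iterate_flagPeriod] at h2
    have h5 : T.flagIndex (T.flagNext f) = 0 :=
      (Function.iterate_eq_iterate_iff_of_lt_minimalPeriod h4 (T.flagPeriod_pos _)).mp
        (h3.trans h2.symm)
    rw [h, h5, partialTurn_flagPeriod hw]
    simp [partialTurn]

theorem norm_turn_pos (hw : T.IsPositiveSolution w) (f : EdgeFlag N) :
    0 < QuadraticAlgebra.norm (T.turn w f) := by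
  rw [turn, partialTurn, map_prod]
  exact Finset.prod_pos fun i _ => norm_flagShape_pos (hw.isPositiveShape _)
    (T.flagNext^[i] (T.flagBase f)).2.2

theorem turn_iterate (hw : T.IsPositiveSolution w) (f : EdgeFlag N) (k : ℕ) :
    T.turn w (T.flagNext^[k] f) = T.turn w f * T.partialTurn w f k := by
  induction k with
  | zero => simp [partialTurn]
  | succ k ih =>
    rw [Function.iterate_succ_apply', turn_flagNext hw, ih, mul_assoc, partialTurn, partialTurn,
      Finset.prod_range_succ]

theorem cross_turn_pos (hw : T.IsPositiveSolution w) (f : EdgeFlag N) :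
    0 < cross (T.turn w f) (T.turn w (T.flagNext f)) := by
  rw [turn_flagNext hw]
  have h := cross_mul (T.turn w f) 1 (flagShape (w f.1) f.2.1)
  rw [mul_one] at h
  rw [h]
  refine mul_pos (norm_turn_pos hw f) ?_
  have := im_edgeShape_pos (hw.isPositiveShape f.1) {f.2.1 0, f.2.1 1}
  simpa [cross, flagShape, QuadraticAlgebra.re_one, QuadraticAlgebra.im_one] using this

/-- The sectors around an edge tile the plane. -/
theorem exists_unique_flag_sector (hw : T.IsPositiveSolution w) (f₀ : EdgeFlag N) {x : ShapeAlg c}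
    (hx : x ≠ 0) : ∃! f, T.flagNext.SameCycle f₀ f ∧ 0 ≤ cross (T.turn w f) x ∧
      0 < cross x (T.turn w (T.flagNext f)) := by
  set t := T.turn w f₀ with ht
  have hunit : IsUnit t := isUnit_of_norm_pos (norm_turn_pos hw f₀)
  obtain ⟨y, rfl⟩ : ∃ y, x = t * y := ⟨Ring.inverse t * x, by
    rw [← mul_assoc, Ring.mul_inverse_cancel _ hunit, one_mul]⟩
  have hy : y ≠ 0 := by rintro rfl; exact hx (mul_zero t)
  have hsum := (hw.2 (flagEdge f₀)).2
  rw [sum_edgeClass_flagEdge] at hsum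
  have key := exists_unique_sector_of_sum_dihedralAngle (u := T.partialTurn w f₀)
    (w := fun k => flagShape (w (T.flagNext^[k] f₀).1) (T.flagNext^[k] f₀).2.1)
    (by simp [partialTurn]) (fun k => by rw [partialTurn, Finset.prod_range_succ]; rfl)
    (fun k => norm_flagShape_pos (hw.isPositiveShape _) (T.flagNext^[k] f₀).2.2)
    (fun k => im_edgeShape_pos (hw.isPositiveShape _) _) (partialTurn_flagPeriod hw f₀) hsum hy
  have hiff : ∀ k, (0 ≤ cross (T.turn w (T.flagNext^[k] f₀)) (t * y) ∧
      0 < cross (t * y) (T.turn w (T.flagNext (T.flagNext^[k] f₀)))) ↔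
      (0 ≤ cross (T.partialTurn w f₀ k) y ∧ 0 < cross y (T.partialTurn w f₀ (k + 1))) := by
    intro k
    rw [← Function.iterate_succ_apply' T.flagNext k f₀, turn_iterate hw, turn_iterate hw, ← ht,
      cross_mul, cross_mul, mul_nonneg_iff_of_pos_left (norm_turn_pos hw f₀),
      mul_pos_iff_of_pos_left (norm_turn_pos hw f₀)]
  obtain ⟨k, ⟨hk, hk1⟩, huniq⟩ := key
  refine ⟨T.flagNext^[k] f₀, ⟨T.sameCycle_iterate f₀ k, (hiff k).mpr hk1⟩, ?_⟩
  rintro f ⟨hf, h1⟩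
  obtain ⟨l, hl, rfl⟩ := T.exists_iterate_of_sameCycle hf
  rw [huniq l ⟨hl, (hiff l).mp h1⟩]

/-! ## Edge ratios -/

/-- The ratio of the distances of the ends of an edge from a horosphere determined by the flag. -/
def flagRatio (T : IdealTriangulation N) (w : Fin N → ShapeAlg c) (f : EdgeFlag N) : ℝ :=
  Real.log (-form c (tetVertex (w f.1) (f.2.1 0)) (tetVertex (w f.1) (f.2.1 2))) -
    Real.log (-form c (tetVertex (w f.1) (f.2.1 1)) (tetVertex (w f.1) (f.2.1 2))) +
    Real.log (QuadraticAlgebra.norm (T.turn w f))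

/-- The antisymmetric edge ratios of a tetrahedron. -/
def edgeRatio (T : IdealTriangulation N) (w : Fin N → ShapeAlg c) (j : Fin N) (k i : Fin 4) : ℝ :=
  if k = i then 0 else
    (T.flagRatio w (j, pairPerm k i) - T.flagRatio w (j, pairPerm i k)) / 2

theorem edgeRatio_antisymm (j : Fin N) (k i : Fin 4) :
    T.edgeRatio w j k i = -T.edgeRatio w j i k := by
  unfold edgeRatio
  rcases eq_or_ne k i with rfl | h
  · simp
  · rw [if_neg h, if_neg h.symm]
    ring

theorem form_tetVertex_neg (hw : T.IsPositiveSolution w) (j : Fin N) {i k : Fin 4} (h : i ≠ k) :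
    0 < -form c (tetVertex (w j) i) (tetVertex (w j) k) :=
  neg_pos.mpr ((isIdealTetrahedron_tetVertex (hw.isPositiveShape j)).2 i k h)

/-- The norm of `flagShape_mul`, with norms of determinants read as inner products of the null
vectors. -/
theorem log_norm_flagShape (hw : T.IsPositiveSolution w) (f : EdgeFlag N) :
    Real.log (QuadraticAlgebra.norm (flagShape (w f.1) f.2.1)) =
      Real.log (-form c (tetVertex (w f.1) (f.2.1 0)) (tetVertex (w f.1) (f.2.1 2))) -
      Real.log (-form c (tetVertex (w f.1) (f.2.1 1)) (tetVertex (w f.1) (f.2.1 2))) -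
      Real.log (-form c (tetVertex (w f.1) (f.2.1 0)) (tetVertex (w f.1) (f.2.1 3))) +
      Real.log (-form c (tetVertex (w f.1) (f.2.1 1)) (tetVertex (w f.1) (f.2.1 3))) := by
  have hs := hw.isPositiveShape f.1
  have hne : ∀ i k : Fin 4, i ≠ k → f.2.1 i ≠ f.2.1 k := fun i k h => f.2.1.injective.ne h
  have hform : ∀ i k, -form c (tetVertex (w f.1) i) (tetVertex (w f.1) k) =
      QuadraticAlgebra.norm (pairDet (idealPoint (w f.1) i) (idealPoint (w f.1) k)) / 2 := by
    intro i k
    rw [tetVertex, tetVertex, form_nullVec, pairDet]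
    ring
  have hpos : ∀ i k : Fin 4, i ≠ k →
      -form c (tetVertex (w f.1) (f.2.1 i)) (tetVertex (w f.1) (f.2.1 k)) ≠ 0 :=
    fun i k h => (form_tetVertex_neg hw f.1 (hne i k h)).ne'
  have h := congrArg QuadraticAlgebra.norm (flagShape_mul hs f.2.2)
  have hn : QuadraticAlgebra.norm (flagShape (w f.1) f.2.1) *
      (-form c (tetVertex (w f.1) (f.2.1 0)) (tetVertex (w f.1) (f.2.1 3)) *
        -form c (tetVertex (w f.1) (f.2.1 1)) (tetVertex (w f.1) (f.2.1 2))) =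
      -form c (tetVertex (w f.1) (f.2.1 1)) (tetVertex (w f.1) (f.2.1 3)) *
        -form c (tetVertex (w f.1) (f.2.1 0)) (tetVertex (w f.1) (f.2.1 2)) := by
    rw [form_comm _ (tetVertex (w f.1) (f.2.1 3)), form_comm _ (tetVertex (w f.1) (f.2.1 2)),
      form_comm _ (tetVertex (w f.1) (f.2.1 3)), form_comm _ (tetVertex (w f.1) (f.2.1 2)),
      hform, hform, hform, hform]
    simp only [map_mul] at h
    linear_combination h / 4
  have h03 := hpos 0 3 (by decide)
  have h12 := hpos 1 2 (by decide)
  have h13 := hpos 1 3 (by decide)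
  have h02 := hpos 0 2 (by decide)
  have hl := congrArg Real.log hn
  rw [Real.log_mul (norm_flagShape_pos hs f.2.2).ne' (mul_ne_zero h03 h12),
    Real.log_mul h03 h12, Real.log_mul h13 h02] at hl
  linarith

/-- The change of the flag ratio across a face. -/
theorem flagRatio_flagNext (hw : T.IsPositiveSolution w) (f : EdgeFlag N) {l : Fin 4 → ℝ} {C : ℝ}
    (hC : 0 < C) (hl : ∀ i, i ≠ f.2.1 2 → 0 < l i)
    (h : ∀ p q, p ≠ f.2.1 2 → q ≠ f.2.1 2 → C * form c (tetVertex (w (T.adj f.1 (f.2.1 2)))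
        (T.glue f.1 (f.2.1 2) p)) (tetVertex (w (T.adj f.1 (f.2.1 2))) (T.glue f.1 (f.2.1 2) q)) =
      l p * l q * form c (tetVertex (w f.1) p) (tetVertex (w f.1) q)) :
    T.flagRatio w (T.flagNext f) - T.flagRatio w f =
      Real.log (l (f.2.1 0)) - Real.log (l (f.2.1 1)) := by
  have hne : ∀ i k : Fin 4, i ≠ k → f.2.1 i ≠ f.2.1 k := fun i k h => f.2.1.injective.ne h
  have key : ∀ p q, p ≠ f.2.1 2 → q ≠ f.2.1 2 → p ≠ q →
      Real.log C + Real.log (-form c (tetVertex (w (T.adj f.1 (f.2.1 2)))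
        (T.glue f.1 (f.2.1 2) p)) (tetVertex (w (T.adj f.1 (f.2.1 2))) (T.glue f.1 (f.2.1 2) q)))
      = Real.log (l p) + Real.log (l q) +
        Real.log (-form c (tetVertex (w f.1) p) (tetVertex (w f.1) q)) := by
    intro p q hp hq hpq
    rw [← Real.log_mul hC.ne' (form_tetVertex_neg hw _ ((T.glue _ _).injective.ne hpq)).ne',
      ← Real.log_mul (hl p hp).ne' (hl q hq).ne',
      ← Real.log_mul (mul_pos (hl p hp) (hl q hq)).ne' (form_tetVertex_neg hw _ hpq).ne',
      mul_neg, mul_neg, h p q hp hq]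
  have k0 := key _ _ (hne 0 2 (by decide)) (hne 3 2 (by decide)) (hne 0 3 (by decide))
  have k1 := key _ _ (hne 1 2 (by decide)) (hne 3 2 (by decide)) (hne 1 3 (by decide))
  have hlog := log_norm_flagShape hw f
  have ht : Real.log (QuadraticAlgebra.norm (T.turn w (T.flagNext f))) =
      Real.log (QuadraticAlgebra.norm (T.turn w f)) +
      Real.log (QuadraticAlgebra.norm (flagShape (w f.1) f.2.1)) := by
    rw [turn_flagNext hw, map_mul, Real.log_mul (norm_turn_pos hw f).ne'
      (norm_flagShape_pos (hw.isPositiveShape _) f.2.2).ne']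
  have e0 : (T.flagNext f).2.1 0 = T.glue f.1 (f.2.1 2) (f.2.1 0) := by
    simp [flagNext_apply, crossPerm, Equiv.swap_apply_of_ne_of_ne]
  have e1 : (T.flagNext f).2.1 1 = T.glue f.1 (f.2.1 2) (f.2.1 1) := by
    simp [flagNext_apply, crossPerm, Equiv.swap_apply_of_ne_of_ne]
  have e2 : (T.flagNext f).2.1 2 = T.glue f.1 (f.2.1 2) (f.2.1 3) := by
    simp [flagNext_apply, crossPerm]
  have e3 : (T.flagNext f).1 = T.adj f.1 (f.2.1 2) := rfl
  rw [flagRatio, flagRatio, ht, e0, e1, e2, e3, hlog]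
  linarith

/-- A face containing an edge is opposite to σ 2 or σ 3 of its flag, so crossing it is one turn
forwards or backwards. -/
theorem pairPerm_across (j : Fin N) {a k i : Fin 4} (hk : k ≠ a) (hi : i ≠ a) (hki : k ≠ i) :
    ((pairPerm k i).1 2 = a ∧
      T.flagNext (j, pairPerm k i) = (T.adj j a, pairPerm (T.glue j a k) (T.glue j a i))) ∨
    ((pairPerm k i).1 3 = a ∧
      T.flagNext.symm (j, pairPerm k i) = (T.adj j a, pairPerm (T.glue j a k) (T.glue j a i))) := by
  have hg : T.glue j a k ≠ T.glue j a i := (T.glue j a).injective.ne hki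
  obtain ⟨m, hm⟩ := (pairPerm k i).1.surjective a
  have hm' : m = 2 ∨ m = 3 := by
    have h0 : m ≠ 0 := fun h => hk (by rw [← hm, h, pairPerm_zero hki])
    have h1 : m ≠ 1 := fun h => hi (by rw [← hm, h, pairPerm_one hki])
    omega
  rcases hm' with rfl | rfl
  · refine Or.inl ⟨hm, ?_⟩
    rw [flagNext_apply]
    simp only [hm]
    refine Prod.ext rfl (eq_pairPerm hg ?_ ?_) <;>
      simp [crossPerm, Equiv.swap_apply_of_ne_of_ne, pairPerm_zero hki, pairPerm_one hki]
  · refine Or.inr ⟨hm, ?_⟩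
    rw [flagNext_symm_apply]
    simp only [hm]
    refine Prod.ext rfl (eq_pairPerm hg ?_ ?_) <;>
      simp [crossPerm, Equiv.swap_apply_of_ne_of_ne, pairPerm_zero hki, pairPerm_one hki]

theorem flagRatio_across (hw : T.IsPositiveSolution w) (j : Fin N) (a : Fin 4) {l : Fin 4 → ℝ}
    {C : ℝ} (hC : 0 < C) (hl : ∀ i, i ≠ a → 0 < l i)
    (h : ∀ p q, p ≠ a → q ≠ a → C * form c (tetVertex (w (T.adj j a)) (T.glue j a p))
        (tetVertex (w (T.adj j a)) (T.glue j a q)) =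
      l p * l q * form c (tetVertex (w j) p) (tetVertex (w j) q))
    {k i : Fin 4} (hk : k ≠ a) (hi : i ≠ a) (hki : k ≠ i) :
    T.flagRatio w (T.adj j a, pairPerm (T.glue j a k) (T.glue j a i)) -
      T.flagRatio w (j, pairPerm k i) = Real.log (l k) - Real.log (l i) := by
  rcases pairPerm_across (T := T) j hk hi hki with ⟨ha, hf⟩ | ⟨ha, hf⟩
  · rw [← hf]
    subst ha
    have := flagRatio_flagNext hw (j, pairPerm k i) hC hl h
    simpa only [pairPerm_zero hki, pairPerm_one hki] using this
  · have hg : T.glue j a k ≠ T.glue j a i := (T.glue j a).injective.ne hki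
    set f : EdgeFlag N := (T.adj j a, pairPerm (T.glue j a k) (T.glue j a i)) with hfdef
    have hnext : T.flagNext f = (j, pairPerm k i) := by rw [← hf, Equiv.apply_symm_apply]
    have h2 : f.2.1 2 = T.glue j a a := by
      rw [← hf, flagNext_symm_apply]
      simp [crossPerm, ha]
    have hadj : T.adj f.1 (f.2.1 2) = j := by rw [h2]; exact T.adj_adj j a
    have hglue : T.glue f.1 (f.2.1 2) = (T.glue j a)⁻¹ := by rw [h2]; exact T.glue_glue j a
    have hinv : ∀ x, (T.glue j a)⁻¹ (T.glue j a x) = x := fun x => by simp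
    have happ : ∀ x, T.glue j a ((T.glue j a)⁻¹ x) = x := fun x => by simp
    -- A backward turn is a forward turn from the neighbouring tetrahedron, with all scalings
    -- inverted.
    have := flagRatio_flagNext hw f (C := C⁻¹)
      (l := fun i => (l ((T.glue j a)⁻¹ i))⁻¹) (inv_pos.mpr hC) (fun i hi => ?_)
      (fun p q hp hq => ?_)
    · rw [hnext] at this
      simp only [hfdef, pairPerm_zero hg, pairPerm_one hg, hinv,
        Real.log_inv] at this
      linarith
    · refine inv_pos.mpr (hl _ fun h => hi ?_)
      rw [h2, ← happ i, h]
    · have hp' : (T.glue j a)⁻¹ p ≠ a := fun h => hp (by rw [h2, ← happ p, h])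
      have hq' : (T.glue j a)⁻¹ q ≠ a := fun h => hq (by rw [h2, ← happ q, h])
      have := h _ _ hp' hq'
      rw [happ, happ] at this
      rw [hadj, hglue]
      have h1 := (hl _ hp').ne'
      have h2 := (hl _ hq').ne'
      have h3 := hC.ne'
      field_simp
      linear_combination -this

/-- `flagRatio` is log (m₀ / m₁), where m₀ and m₁ are the factors by which the development of the
flag scales the vectors of the two ends of the edge, relative to ∞ and 0. It therefore changes by
the logarithms of the face scalings. Flags in opposite directions have unrelated base points, so
half their difference is taken to make the ratios antisymmetric; the rule of change survives. -/
theorem edgeRatio_across (hw : T.IsPositiveSolution w) (j : Fin N) (a : Fin 4) {l : Fin 4 → ℝ}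
    {C : ℝ} (hC : 0 < C) (hl : ∀ i, i ≠ a → 0 < l i)
    (h : ∀ p q, p ≠ a → q ≠ a → C * form c (tetVertex (w (T.adj j a)) (T.glue j a p))
        (tetVertex (w (T.adj j a)) (T.glue j a q)) =
      l p * l q * form c (tetVertex (w j) p) (tetVertex (w j) q))
    {k i : Fin 4} (hk : k ≠ a) (hi : i ≠ a) :
    T.edgeRatio w (T.adj j a) (T.glue j a k) (T.glue j a i) =
      T.edgeRatio w j k i + Real.log (l k) - Real.log (l i) := by
  unfold edgeRatio
  rcases eq_or_ne k i with rfl | hki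
  · simp
  · rw [if_neg hki, if_neg ((T.glue j a).injective.ne hki)]
    have h1 := flagRatio_across hw j a hC hl h hk hi hki
    have h2 := flagRatio_across hw j a hC hl h hi hk hki.symm
    linarith

end IdealTriangulation

/-! ## Coordinates with respect to a frame -/

section Frames

variable {c : ℝ}

/-- The component of a vector in the plane of `ℝ + ℝκ`. -/
def planePart (c : ℝ) (v : V4) : ShapeAlg c := ⟨v 2, -v 3⟩

/-- The coordinates of a vector with respect to the vertices `∞, 0, u, u'`. -/
def frameCoord (u u' : ShapeAlg c) (v : V4) : Fin 4 → ℝ :=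
  let x := planePart c v
  let y := cross x u' / cross u u'
  let z := cross u x / cross u u'
  ![v 0 + v 1 - y * QuadraticAlgebra.norm u - z * QuadraticAlgebra.norm u', v 0 - v 1 - y - z, y, z]

theorem frameVec_sum (u u' : ShapeAlg c) (a : Fin 4 → ℝ) : ∑ i, a i • frameVec u u' i =
    ![(a 0 + a 1 + a 2 * (QuadraticAlgebra.norm u + 1) + a 3 * (QuadraticAlgebra.norm u' + 1)) / 2,
      (a 0 - a 1 + a 2 * (QuadraticAlgebra.norm u - 1) + a 3 * (QuadraticAlgebra.norm u' - 1)) / 2,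
      a 2 * u.re + a 3 * u'.re, -(a 2 * u.im + a 3 * u'.im)] := by
  simp only [Fin.sum_univ_four, frameVec, vecInf, vecZero, Matrix.cons_val, nullVec_pair]
  ext i
  fin_cases i <;> simp <;> ring

theorem frameVec_apply (u u' : ShapeAlg c) : frameVec u u' 0 = vecInf ∧ frameVec u u' 1 = vecZero ∧
    frameVec u u' 2 = nullVec ![u, 1] ∧ frameVec u u' 3 = nullVec ![u', 1] :=
  ⟨rfl, rfl, rfl, rfl⟩

/-- The ends ∞ and 0 of the edge have no component in the plane, so wedges around the edge are
preimages of sectors. The sign in `planePart` undoes the conjugation in the last coordinate of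
`nullVec`. -/
theorem planePart_frameVec_sum (u u' : ShapeAlg c) (a : Fin 4 → ℝ) :
    planePart c (∑ i, a i • frameVec u u' i) = a 2 • u + a 3 • u' := by
  rw [frameVec_sum]
  ext <;> simp [planePart]

theorem frameCoord_sum {u u' : ShapeAlg c} (h : cross u u' ≠ 0) (a : Fin 4 → ℝ) :
    frameCoord u u' (∑ i, a i • frameVec u u' i) = a := by
  have h2 : cross (planePart c (∑ i, a i • frameVec u u' i)) u' / cross u u' = a 2 := by
    rw [planePart_frameVec_sum, div_eq_iff h]
    simp [cross]; ring
  have h3 : cross u (planePart c (∑ i, a i • frameVec u u' i)) / cross u u' = a 3 := by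
    rw [planePart_frameVec_sum, div_eq_iff h]
    simp [cross]; ring
  unfold frameCoord
  simp only [h2, h3]
  rw [frameVec_sum]
  ext i
  fin_cases i <;> simp <;> ring

theorem sum_frameCoord {u u' : ShapeAlg c} (h : cross u u' ≠ 0) (v : V4) :
    ∑ i, frameCoord u u' v i • frameVec u u' i = v := by
  rw [frameVec_sum]
  ext i
  fin_cases i
  · simp [frameCoord]; ring
  · simp [frameCoord]; ring
  · simp only [frameCoord, planePart, Fin.reduceFinMk, Matrix.cons_val]
    field_simp
    simp [cross]
    ring
  · simp only [frameCoord, planePart, Fin.reduceFinMk, Matrix.cons_val]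
    field_simp
    simp [cross]
    ring

theorem continuous_frameCoord (u u' : ShapeAlg c) : Continuous (frameCoord u u') := by
  refine continuous_pi fun i => ?_
  fin_cases i <;> simp [frameCoord, planePart, cross] <;> fun_prop

theorem frameCoord_smul (u u' : ShapeAlg c) (a : ℝ) (v : V4) :
    frameCoord u u' (a • v) = a • frameCoord u u' v := by
  ext i
  fin_cases i <;> simp [frameCoord, planePart, cross] <;> ring

theorem cross_self_eq_zero (x : ShapeAlg c) : cross x x = 0 := by
  simp only [cross]; ring

theorem cross_add_smul_right (u u' : ShapeAlg c) (a b : ℝ) :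
    cross u (a • u + b • u') = b * cross u u' := by
  simp [cross]; ring

theorem cross_add_smul_left (u u' : ShapeAlg c) (a b : ℝ) :
    cross (a • u + b • u') u' = a * cross u u' := by
  simp [cross]; ring

end Frames

/-! ### Developed tetrahedra and wedges around an edge -/

namespace IdealTriangulation

variable {N : ℕ} (T : IdealTriangulation N) {c : ℝ} (w : Fin N → ShapeAlg c)

/-- The vertices `∞, 0` and `u_f, u_{f + 1}`. -/
def flagFrame (f : EdgeFlag N) : Fin 4 → V4 := frameVec (T.turn w f) (T.turn w (T.flagNext f))

/-- The straight simplex with vertices `∞, 0, 1, w j`, suitably parametrized. -/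
def tetLift (j : Fin N) (s : V4) : V4 := ∑ i, reweight (T.edgeRatio w j) s i • tetVertex (w j) i

/-- The map that takes the tetrahedron of a flag to its position at the edge `∞, 0`. -/
def flagDev (f : EdgeFlag N) : V4 →ₗ[ℝ] V4 := hermAct (devMatrix (T.turn w f) (w f.1) f.2.1)

/-- The developed tetrahedron of a flag. -/
def flagLift (f : EdgeFlag N) (s : V4) : V4 := T.flagDev w f (T.tetLift w f.1 s)

variable {T w}

theorem exists_flagDev_tetVertex (hw : T.IsPositiveSolution w) (f : EdgeFlag N) :
    ∃ m : Fin 4 → ℝ, (∀ i, 0 < m i) ∧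
      ∀ i, T.flagDev w f (tetVertex (w f.1) (f.2.1 i)) = m i • T.flagFrame w f i := by
  rw [flagFrame, turn_flagNext hw]
  exact exists_hermAct_devMatrix (norm_turn_pos hw f) (hw.isPositiveShape f.1) f.2.2

theorem flagDev_sum (f : EdgeFlag N) (a : Fin 4 → ℝ) {m : Fin 4 → ℝ}
    (hm : ∀ i, T.flagDev w f (tetVertex (w f.1) (f.2.1 i)) = m i • T.flagFrame w f i) :
    T.flagDev w f (∑ i, a i • tetVertex (w f.1) i) =
      ∑ i, (a (f.2.1 i) * m i) • T.flagFrame w f i := by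
  rw [map_sum, ← Equiv.sum_comp f.2.1]
  refine Finset.sum_congr rfl fun i _ => ?_
  rw [map_smul, hm, smul_smul]

/-- The frames of consecutive flags share ∞, 0 and u_{f+1}, with positions 2 and 3 exchanged; each
scaling is a quotient of two positive ones. -/
theorem exists_face_scaling (hw : T.IsPositiveSolution w) (f : EdgeFlag N) :
    ∃ l : Fin 4 → ℝ, (∀ i, 0 < l i) ∧ ∀ p, p ≠ f.2.1 2 →
      T.flagDev w (T.flagNext f)
          (tetVertex (w (T.adj f.1 (f.2.1 2))) (T.glue f.1 (f.2.1 2) p)) =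
        l p • T.flagDev w f (tetVertex (w f.1) p) := by
  obtain ⟨m, hm, hm'⟩ := exists_flagDev_tetVertex hw f
  obtain ⟨n, hn, hn'⟩ := exists_flagDev_tetVertex hw (T.flagNext f)
  refine ⟨fun p => n (Equiv.swap 2 3 (f.2.1.symm p)) / m (f.2.1.symm p),
    fun p => div_pos (hn _) (hm _), fun p hp => ?_⟩
  obtain ⟨i, rfl⟩ := f.2.1.surjective p
  have hi : i ≠ 2 := fun h => hp (h ▸ rfl)
  have e : T.glue f.1 (f.2.1 2) (f.2.1 i) = (T.flagNext f).2.1 (Equiv.swap 2 3 i) := by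
    simp [flagNext_apply, crossPerm]
  have hF : T.flagFrame w (T.flagNext f) (Equiv.swap 2 3 i) = T.flagFrame w f i := by
    have hi' : i = 0 ∨ i = 1 ∨ i = 3 := by omega
    rcases hi' with rfl | rfl | rfl
    · rw [Equiv.swap_apply_of_ne_of_ne (by decide) (by decide), flagFrame, flagFrame,
        (frameVec_apply _ _).1, (frameVec_apply _ _).1]
    · rw [Equiv.swap_apply_of_ne_of_ne (by decide) (by decide), flagFrame, flagFrame,
        (frameVec_apply _ _).2.1, (frameVec_apply _ _).2.1]
    · rw [Equiv.swap_apply_right, flagFrame, flagFrame, (frameVec_apply _ _).2.2.1,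
        (frameVec_apply _ _).2.2.2]
  simp only [Equiv.symm_apply_apply]
  rw [e, hm', smul_smul, div_mul_cancel₀ _ (hm i).ne', ← hF]
  rw [← hn']
  rfl

theorem form_flagDev (f : EdgeFlag N) (x y : V4) :
    form c (T.flagDev w f x) (T.flagDev w f y) =
      QuadraticAlgebra.norm (devMatrix (T.turn w f) (w f.1) f.2.1).det * form c x y :=
  form_hermAct _ _ _

theorem norm_det_flagDev_pos (hw : T.IsPositiveSolution w) (f : EdgeFlag N) :
    0 < QuadraticAlgebra.norm (devMatrix (T.turn w f) (w f.1) f.2.1).det :=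
  norm_det_devMatrix_pos (norm_turn_pos hw f) (hw.isPositiveShape f.1) f.2.1

/-- The developed tetrahedra of consecutive flags fit together along their common face. -/
theorem flagLift_flagNext (hw : T.IsPositiveSolution w) (f : EdgeFlag N) {s s' : V4}
    (hsum : ∑ i, s i = 1) (h2 : s (f.2.1 2) = 0)
    (hs : ∀ i, s' (T.glue f.1 (f.2.1 2) i) = s i) :
    ∃ C : ℝ, 0 < C ∧ T.flagLift w (T.flagNext f) s' = C • T.flagLift w f s := by
  obtain ⟨l, hl, hl'⟩ := exists_face_scaling hw f
  set a := f.2.1 2 with ha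
  have hn := norm_det_flagDev_pos hw f
  have hn' := norm_det_flagDev_pos hw (T.flagNext f)
  have hr : ∀ k p, k ≠ a → p ≠ a → T.edgeRatio w (T.adj f.1 a) (T.glue f.1 a k) (T.glue f.1 a p) =
      T.edgeRatio w f.1 k p + Real.log (l k) - Real.log (l p) := by
    intro k p hk hp
    refine edgeRatio_across hw f.1 a (div_pos hn' hn) (fun i _ => hl i) (fun p q hp hq => ?_) hk hp
    have h1 := form_flagDev (T := T) (w := w) (T.flagNext f)
      (tetVertex (w (T.adj f.1 a)) (T.glue f.1 a p)) (tetVertex (w (T.adj f.1 a)) (T.glue f.1 a q))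
    rw [hl' p hp, hl' q hq] at h1
    have h2 : ∀ (x y : V4) (a b : ℝ), form c (a • x) (b • y) = a * b * form c x y := by
      intro x y a b
      simp only [form, Pi.smul_apply, smul_eq_mul]; ring
    rw [h2, form_flagDev] at h1
    rw [div_mul_eq_mul_div, ← h1, div_eq_iff hn.ne']
    ring
  -- As barycentric coordinates sum to one, the exponent at p grows by ∑ s_k log l_k - log l_p. The
  -- second term cancels the scaling l_p of the vertex and the first is a factor common to the whole
  -- face, which projective space does not see.
  refine ⟨Real.exp (∑ k, s k * Real.log (l k)), Real.exp_pos _, ?_⟩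
  have hexp : ∀ p, p ≠ a → edgeExponent (T.edgeRatio w (T.adj f.1 a)) s' (T.glue f.1 a p) =
      edgeExponent (T.edgeRatio w f.1) s p + ∑ k, s k * Real.log (l k) - Real.log (l p) := by
    intro p hp
    rw [edgeExponent, ← Equiv.sum_comp (T.glue f.1 a)]
    have h1 : ∀ k, s' (T.glue f.1 a k) * T.edgeRatio w (T.adj f.1 a) (T.glue f.1 a k)
        (T.glue f.1 a p) = s k * T.edgeRatio w f.1 k p + s k * Real.log (l k) -
          s k * Real.log (l p) := by
      intro k
      rw [hs]
      rcases eq_or_ne k a with rfl | hk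
      · rw [h2]; ring
      · rw [hr k p hk hp]; ring
    rw [Finset.sum_congr rfl fun k _ => h1 k, Finset.sum_sub_distrib, Finset.sum_add_distrib,
      ← Finset.sum_mul, hsum, one_mul, edgeExponent]
  rw [flagLift, flagLift, tetLift, tetLift, map_sum, map_sum, Finset.smul_sum]
  change ∑ x, T.flagDev w (T.flagNext f) (reweight (T.edgeRatio w (T.adj f.1 a)) s' x •
    tetVertex (w (T.adj f.1 a)) x) = _
  rw [← Equiv.sum_comp (T.glue f.1 a)]
  refine Finset.sum_congr rfl fun p _ => ?_
  rw [map_smul, map_smul]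
  rcases eq_or_ne p a with rfl | hp
  · simp only [reweight, hs, h2, zero_mul, zero_smul, smul_zero]
  · rw [hl' p hp, smul_smul, smul_smul, reweight, reweight, hs, hexp p hp, Real.exp_sub,
      Real.exp_add, Real.exp_log (hl p)]
    congr 1
    have := (hl p).ne'
    field_simp

/-- Every vector of a developed tetrahedron has nonnegative coordinates. -/
theorem exists_flagLift_eq (hw : T.IsPositiveSolution w) (f : EdgeFlag N) (s : V4) :
    ∃ m : Fin 4 → ℝ, (∀ i, 0 < m i) ∧
      T.flagLift w f s = ∑ i, (m i * s (f.2.1 i)) • T.flagFrame w f i := by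
  obtain ⟨m, hm, hm'⟩ := exists_flagDev_tetVertex hw f
  refine ⟨fun i => Real.exp (edgeExponent (T.edgeRatio w f.1) s (f.2.1 i)) * m i,
    fun i => mul_pos (Real.exp_pos _) (hm i), ?_⟩
  rw [flagLift, tetLift, flagDev_sum f _ hm']
  refine Finset.sum_congr rfl fun i _ => ?_
  rw [reweight]
  congr 1
  ring

/-- The vectors in the wedge of a flag. -/
def InWedge (T : IdealTriangulation N) (w : Fin N → ShapeAlg c) (f : EdgeFlag N) (v : V4) : Prop :=
  0 ≤ cross (T.turn w f) (planePart c v) ∧ 0 ≤ cross (planePart c v) (T.turn w (T.flagNext f))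

theorem InWedge.smul {f : EdgeFlag N} {v : V4} (h : T.InWedge w f v) {C : ℝ} (hC : 0 ≤ C) :
    T.InWedge w f (C • v) := by
  have e : planePart c (C • v) = C • planePart c v := by ext <;> simp [planePart]
  have e1 : ∀ x y : ShapeAlg c, cross x (C • y) = C * cross x y := by
    intro x y; simp [cross]; ring
  have e2 : ∀ x y : ShapeAlg c, cross (C • x) y = C * cross x y := by
    intro x y; simp [cross]; ring
  rw [InWedge, e, e1, e2]
  exact ⟨mul_nonneg hC h.1, mul_nonneg hC h.2⟩

theorem inWedge_flagLift (hw : T.IsPositiveSolution w) (f : EdgeFlag N) {s : V4}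
    (hs : ∀ i, 0 ≤ s i) : T.InWedge w f (T.flagLift w f s) := by
  obtain ⟨m, hm, h⟩ := exists_flagLift_eq hw f s
  rw [h, InWedge, flagFrame, planePart_frameVec_sum, cross_add_smul_right, cross_add_smul_left]
  have := cross_turn_pos hw f
  exact ⟨mul_nonneg (mul_nonneg (hm _).le (hs _)) this.le,
    mul_nonneg (mul_nonneg (hm _).le (hs _)) this.le⟩

/-- The wedges cover the space. -/
theorem exists_inWedge (hw : T.IsPositiveSolution w) (f₀ : EdgeFlag N) (v : V4) :
    ∃ f, T.flagNext.SameCycle f₀ f ∧ T.InWedge w f v := by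
  rcases eq_or_ne (planePart c v) 0 with h | h
  · exact ⟨f₀, Equiv.Perm.SameCycle.refl _ _, by simp [InWedge, h, cross]⟩
  · obtain ⟨f, ⟨h1, h2, h3⟩, -⟩ := exists_unique_flag_sector hw f₀ h
    exact ⟨f, h1, h2, h3.le⟩

/-- The wedges meet only along their faces. -/
theorem eq_of_inWedge (hw : T.IsPositiveSolution w) {f f' : EdgeFlag N}
    (hf : T.flagNext.SameCycle f f') {a : Fin 4 → ℝ} (h2 : 0 ≤ a 2) (h3 : 0 ≤ a 3)
    (h : T.InWedge w f' (∑ i, a i • T.flagFrame w f i)) :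
    f' = f ∨ (f' = T.flagNext f ∧ a 2 = 0) ∨ (f' = T.flagNext.symm f ∧ a 3 = 0) ∨
      (a 2 = 0 ∧ a 3 = 0) := by
  rw [InWedge, flagFrame, planePart_frameVec_sum] at h
  set u := T.turn w with hu
  set x := a 2 • u f + a 3 • u (T.flagNext f) with hx
  have hpos := fun f => cross_turn_pos hw f
  have hx1 : cross (u f) x = a 3 * cross (u f) (u (T.flagNext f)) := cross_add_smul_right _ _ _ _
  have hx2 : cross x (u (T.flagNext f)) = a 2 * cross (u f) (u (T.flagNext f)) :=
    cross_add_smul_left _ _ _ _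
  by_cases hall : a 2 = 0 ∧ a 3 = 0
  · exact Or.inr (Or.inr (Or.inr hall))
  have hx0 : x ≠ 0 := by
    rintro h0
    rw [h0] at hx1 hx2
    simp only [cross, QuadraticAlgebra.re_zero, QuadraticAlgebra.im_zero, mul_zero, zero_mul,
      sub_zero] at hx1 hx2
    have := (hpos f).ne'
    refine hall ⟨?_, ?_⟩
    · simpa [this] using (mul_eq_zero.mp hx2.symm).resolve_right this
    · simpa [this] using (mul_eq_zero.mp hx1.symm).resolve_right this
  -- The half-open sectors are disjoint, so both closed wedges are compared with the one sector g
  -- that contains x; a difference can occur only on a bounding ray.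
  obtain ⟨g, -, huniq⟩ := exists_unique_flag_sector hw f hx0
  have sf : T.flagNext.SameCycle f f := Equiv.Perm.SameCycle.refl _ _
  -- the sector containing `x`
  have hg : (g = f ∧ a 2 ≠ 0) ∨ (g = T.flagNext f ∧ a 2 = 0) := by
    rcases h2.eq_or_lt with h0 | h0
    · right
      refine ⟨(huniq _ ⟨Equiv.Perm.sameCycle_apply_right.mpr sf, ?_, ?_⟩).symm, h0.symm⟩
      · have : x = a 3 • u (T.flagNext f) := by rw [hx, ← h0, zero_smul, zero_add]
        rw [this, ← zero_add (a 3 • _), ← zero_smul ℝ (u (T.flagNext f)), ← hu]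
        have := cross_add_smul_right (u (T.flagNext f)) (u (T.flagNext f)) 0 (a 3)
        rw [this, cross_self_eq_zero, mul_zero]
      · have : x = a 3 • u (T.flagNext f) + (0 : ℝ) • u (T.flagNext (T.flagNext f)) := by
          rw [hx, ← h0, zero_smul, zero_add, zero_smul, add_zero]
        rw [this, cross_add_smul_left]
        have h3' : 0 < a 3 := lt_of_le_of_ne h3 fun h => hall ⟨h0.symm, h.symm⟩
        exact mul_pos h3' (hpos _)
    · left
      refine ⟨(huniq _ ⟨sf, ?_, ?_⟩).symm, h0.ne'⟩
      · rw [hx1]; exact mul_nonneg h3 (hpos f).le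
      · rw [hx2]; exact mul_pos h0 (hpos f)
  rcases h.2.eq_or_lt with h0 | h0
  · -- `x` lies on the ray of the flag after `f'`
    have hdec : x = frameCoord (u f') (u (T.flagNext f')) ![0, 0, x.re, -x.im] 2 • u f' +
        frameCoord (u f') (u (T.flagNext f')) ![0, 0, x.re, -x.im] 3 • u (T.flagNext f') := by
      have h4 := congrArg (planePart c)
        (sum_frameCoord (hpos f').ne' ![0, 0, x.re, -x.im])
      rw [planePart_frameVec_sum] at h4
      rw [h4]
      ext <;> simp [planePart]
    set b := frameCoord (u f') (u (T.flagNext f')) ![0, 0, x.re, -x.im] 2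
    set d := frameCoord (u f') (u (T.flagNext f')) ![0, 0, x.re, -x.im] 3
    have hb : b = 0 := by
      have := cross_add_smul_left (u f') (u (T.flagNext f')) b d
      rw [← hdec, ← h0] at this
      exact (mul_eq_zero.mp this.symm).resolve_right (hpos f').ne'
    have hd : 0 ≤ d := by
      have := cross_add_smul_right (u f') (u (T.flagNext f')) b d
      rw [← hdec] at this
      exact nonneg_of_mul_nonneg_left (this ▸ h.1) (hpos f')
    have hd' : 0 < d := lt_of_le_of_ne hd fun h => hx0 (by rw [hdec, hb, ← h]; simp)
    have hxd : x = d • u (T.flagNext f') + (0 : ℝ) • u (T.flagNext (T.flagNext f')) := by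
      conv_lhs => rw [hdec, hb]
      simp
    have hxd' : x = (0 : ℝ) • u (T.flagNext f') + d • u (T.flagNext f') := by
      conv_lhs => rw [hdec, hb]
      simp
    have hg' : T.flagNext f' = g := by
      refine huniq _ ⟨Equiv.Perm.sameCycle_apply_right.mpr hf, ?_, ?_⟩
      · rw [hxd']
        have := cross_add_smul_right (u (T.flagNext f')) (u (T.flagNext f')) 0 d
        rw [this, cross_self_eq_zero, mul_zero]
      · rw [hxd, cross_add_smul_left]
        exact mul_pos hd' (hpos _)
    rcases hg with ⟨hg, ha⟩ | ⟨hg, ha⟩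
    · refine Or.inr (Or.inr (Or.inl ⟨?_, ?_⟩))
      · rw [← hg, ← hg', Equiv.symm_apply_apply]
      · rw [← hg'.trans hg, hxd'] at hx1
        have e := cross_add_smul_right (u (T.flagNext f')) (u (T.flagNext f')) 0 d
        rw [e, cross_self_eq_zero, mul_zero] at hx1
        exact (mul_eq_zero.mp hx1.symm).resolve_right (hpos _).ne'
    · exact Or.inl (T.flagNext.injective (hg'.trans hg))
  · have := huniq f' ⟨hf, h.1, h0⟩
    rcases hg with ⟨hg, ha⟩ | ⟨hg, ha⟩
    · exact Or.inl (this.trans hg)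
    · exact Or.inr (Or.inl ⟨this.trans hg, ha⟩)

end IdealTriangulation

/-- The permutation of the coordinates of the simplex. -/
def IdealSimplex.perm (g : Equiv.Perm (Fin 4)) (s : IdealSimplex) : IdealSimplex :=
  ⟨fun i => s.1 (g.symm i), fun i => s.2.1 _, by
    rw [Equiv.sum_comp g.symm fun i => s.1 i]; exact s.2.2⟩

theorem IdealSimplex.perm_apply (g : Equiv.Perm (Fin 4)) (s : IdealSimplex) (i : Fin 4) :
    (s.perm g).1 (g i) = s.1 i := by
  simp [IdealSimplex.perm]

theorem IdealSimplex.eq_perm {g : Equiv.Perm (Fin 4)} {s s' : IdealSimplex}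
    (h : ∀ i, s'.1 (g i) = s.1 i) : s' = s.perm g := by
  refine Subtype.ext (funext fun i => ?_)
  obtain ⟨k, rfl⟩ := g.surjective i
  rw [h, s.perm_apply]

/-! ### Carrying a point to another tetrahedron at the same edge -/

namespace IdealTriangulation

variable {N : ℕ} {T : IdealTriangulation N} {c : ℝ} {w : Fin N → ShapeAlg c}

theorem flagLift_flagNext_symm (hw : T.IsPositiveSolution w) (f : EdgeFlag N) {s s' : V4}
    (hsum : ∑ i, s i = 1) (h3 : s (f.2.1 3) = 0)
    (hs : ∀ i, s' (T.glue f.1 (f.2.1 3) i) = s i) :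
    ∃ C : ℝ, 0 < C ∧ T.flagLift w (T.flagNext.symm f) s' = C • T.flagLift w f s := by
  have hinv : ∀ x, T.glue f.1 (f.2.1 3) ((T.glue f.1 (f.2.1 3))⁻¹ x) = x := fun x => by simp
  have h2 : (T.flagNext.symm f).2.1 2 = T.glue f.1 (f.2.1 3) (f.2.1 3) := by
    simp [flagNext_symm_apply, crossPerm]
  obtain ⟨C, hC, h⟩ := flagLift_flagNext hw (T.flagNext.symm f) (s := s') (s' := s)
    (by rw [← hsum, ← Equiv.sum_comp (T.glue f.1 (f.2.1 3))]; simp only [hs])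
    (by rw [h2, hs, h3]) (fun i => by
      have : T.glue (T.flagNext.symm f).1 ((T.flagNext.symm f).2.1 2) =
          (T.glue f.1 (f.2.1 3))⁻¹ := by rw [h2]; exact T.glue_glue _ _
      rw [this, ← hs, hinv])
  rw [Equiv.apply_symm_apply] at h
  exact ⟨C⁻¹, inv_pos.mpr hC, by rw [h, smul_smul, inv_mul_cancel₀ hC.ne', one_smul]⟩

/-- A point of a developed tetrahedron that lies in the wedge of another flag at the same edge
is a point of the developed tetrahedron of that flag. -/
theorem exists_flagLift_of_inWedge (hw : T.IsPositiveSolution w)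
    {Q : EdgeFlag N → IdealSimplex → Prop}
    (hnext : ∀ f s, Q f s → s.1 (f.2.1 2) = 0 →
      Q (T.flagNext f) (s.perm (T.glue f.1 (f.2.1 2))))
    (hprev : ∀ f s, Q f s → s.1 (f.2.1 3) = 0 →
      Q (T.flagNext.symm f) (s.perm (T.glue f.1 (f.2.1 3))))
    {f f' : EdgeFlag N} (hf : T.flagNext.SameCycle f f') {s : IdealSimplex} (hQ : Q f s)
    (h : T.InWedge w f' (T.flagLift w f s.1)) :
    ∃ s', Q f' s' ∧ ∃ C : ℝ, 0 < C ∧ T.flagLift w f' s'.1 = C • T.flagLift w f s.1 := by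
  obtain ⟨m, hm, hexp⟩ := exists_flagLift_eq hw f s.1
  rw [hexp] at h
  have hm0 : ∀ i, m i * s.1 (f.2.1 i) = 0 → s.1 (f.2.1 i) = 0 := fun i h =>
    (mul_eq_zero.mp h).resolve_left (hm i).ne'
  rcases eq_of_inWedge hw hf (mul_nonneg (hm 2).le (s.2.1 _).1) (mul_nonneg (hm 3).le (s.2.1 _).1) h
    with rfl | ⟨rfl, h2⟩ | ⟨rfl, h3⟩ | ⟨h2, h3⟩
  · exact ⟨s, hQ, 1, one_pos, (one_smul _ _).symm⟩
  · exact ⟨_, hnext f s hQ (hm0 _ h2), flagLift_flagNext hw f s.2.2 (hm0 _ h2)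
      fun i => s.perm_apply _ _⟩
  · exact ⟨_, hprev f s hQ (hm0 _ h3), flagLift_flagNext_symm hw f s.2.2 (hm0 _ h3)
      fun i => s.perm_apply _ _⟩
  -- A point on the edge itself lies in every wedge; it is carried forwards one face at a time until
  -- the flag is reached.
  · obtain ⟨k, -, rfl⟩ := T.exists_iterate_of_sameCycle hf
    suffices H : ∀ k : ℕ, ∃ s' : IdealSimplex, Q (T.flagNext^[k] f) s' ∧
        s'.1 ((T.flagNext^[k] f).2.1 2) = 0 ∧ s'.1 ((T.flagNext^[k] f).2.1 3) = 0 ∧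
        ∃ C : ℝ, 0 < C ∧ T.flagLift w (T.flagNext^[k] f) s'.1 = C • T.flagLift w f s.1 by
      obtain ⟨s', h1, -, -, h4⟩ := H k
      exact ⟨s', h1, h4⟩
    intro k
    induction k with
    | zero => exact ⟨s, hQ, hm0 _ h2, hm0 _ h3, 1, one_pos, (one_smul _ _).symm⟩
    | succ k ih =>
      obtain ⟨s', h1, h2, h3, C, hC, h4⟩ := ih
      rw [Function.iterate_succ_apply']
      set f' := T.flagNext^[k] f
      obtain ⟨C', hC', h5⟩ := flagLift_flagNext hw f' s'.2.2 h2
        fun i => s'.perm_apply (T.glue f'.1 (f'.2.1 2)) i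
      refine ⟨_, hnext f' s' h1 h2, ?_, ?_, C' * C, mul_pos hC' hC, ?_⟩
      · have : (T.flagNext f').2.1 2 = T.glue f'.1 (f'.2.1 2) (f'.2.1 3) := by
          simp [flagNext_apply, crossPerm]
        rw [this, s'.perm_apply, h3]
      · have : (T.flagNext f').2.1 3 = T.glue f'.1 (f'.2.1 2) (f'.2.1 2) := by
          simp [flagNext_apply, crossPerm]
        rw [this, s'.perm_apply, h2]
      · rw [h5, h4, smul_smul]

end IdealTriangulation

/-! ## Regions of flags -/

namespace IdealTriangulation

variable {N : ℕ} (T : IdealTriangulation N)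

theorem flagNext_two_three (f : EdgeFlag N) (i : Fin 4) :
    (T.flagNext f).2.1 i = T.glue f.1 (f.2.1 2) (f.2.1 (Equiv.swap 2 3 i)) := by
  simp [flagNext_apply, crossPerm]

theorem flagNext_symm_two_three (f : EdgeFlag N) (i : Fin 4) :
    (T.flagNext.symm f).2.1 i = T.glue f.1 (f.2.1 3) (f.2.1 (Equiv.swap 2 3 i)) := by
  simp [flagNext_symm_apply, crossPerm]

theorem perm_flagNext (f : EdgeFlag N) (s : IdealSimplex) (i : Fin 4) :
    (s.perm (T.glue f.1 (f.2.1 2))).1 ((T.flagNext f).2.1 i) = s.1 (f.2.1 (Equiv.swap 2 3 i)) := by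
  rw [flagNext_two_three, s.perm_apply]

theorem perm_flagNext_symm (f : EdgeFlag N) (s : IdealSimplex) (i : Fin 4) :
    (s.perm (T.glue f.1 (f.2.1 3))).1 ((T.flagNext.symm f).2.1 i) =
      s.1 (f.2.1 (Equiv.swap 2 3 i)) := by
  rw [flagNext_symm_two_three, s.perm_apply]

/-- When both sides of a face lie in one tetrahedron they are still different faces of it. -/
theorem flagNext_ne_self (f : EdgeFlag N) (h : T.adj f.1 (f.2.1 2) = f.1) :
    (T.flagNext f).2.1 3 ≠ f.2.1 2 := by
  rw [flagNext_two_three, Equiv.swap_apply_right]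
  exact fun h' => T.not_self f.1 (f.2.1 2) ⟨h, h'⟩

/-- An open set of the triangulated manifold that is embedded by developing it around the edge of
a flag, given by its parts in the tetrahedra at that edge. -/
structure FlagRegion where
  /-- a flag at the edge -/
  base : EdgeFlag N
  /-- the part of the region that belongs to a flag -/
  carrier : EdgeFlag N → Set IdealSimplex
  isOpen : ∀ f, IsOpen (carrier f)
  sameCycle : ∀ f s, s ∈ carrier f → T.flagNext.SameCycle base f
  pos : ∀ f s, s ∈ carrier f → 0 < s.1 (f.2.1 0) ∧ 0 < s.1 (f.2.1 1)
  unique : ∀ f f' s, s ∈ carrier f → s ∈ carrier f' → f.1 = f'.1 → f = f'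
  next : ∀ f s, s ∈ carrier f → s.1 (f.2.1 2) = 0 →
    s.perm (T.glue f.1 (f.2.1 2)) ∈ carrier (T.flagNext f)
  prev : ∀ f s, s ∈ carrier f → s.1 (f.2.1 3) = 0 →
    s.perm (T.glue f.1 (f.2.1 3)) ∈ carrier (T.flagNext.symm f)

theorem continuous_coord (i : Fin 4) : Continuous fun s : IdealSimplex => s.1 i :=
  (continuous_apply i).comp continuous_idealSimplex_val

theorem isOpen_coord_lt (i k : Fin 4) : IsOpen {s : IdealSimplex | s.1 i < s.1 k} :=
  isOpen_lt (continuous_coord i) (continuous_coord k)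

/-- The edge is recovered from the point as the pair of vertices with the two largest coordinates.
-/
theorem edge_eq_of_lt {σ τ : Equiv.Perm (Fin 4)} (hσ : Equiv.Perm.sign σ = 1)
    (hτ : Equiv.Perm.sign τ = 1) {t : Fin 4 → ℝ}
    (h : t (σ 2) < t (σ 0) ∧ t (σ 2) < t (σ 1) ∧ t (σ 3) < t (σ 0) ∧ t (σ 3) < t (σ 1))
    (h' : t (τ 2) < t (τ 0) ∧ t (τ 2) < t (τ 1) ∧ t (τ 3) < t (τ 0) ∧ t (τ 3) < t (τ 1)) :
    ({σ 0, σ 1} : Finset (Fin 4)) = {τ 0, τ 1} := by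
  obtain ⟨ρ, rfl⟩ : ∃ ρ, τ = σ * ρ := ⟨σ⁻¹ * τ, by simp⟩
  have hρ : Equiv.Perm.sign ρ = 1 := by simpa [hσ] using hτ
  have hc := even_perm_cases ρ hρ
  simp only [List.mem_cons, Prod.mk.injEq, List.not_mem_nil, or_false] at hc
  simp only [Equiv.Perm.mul_apply] at h' ⊢
  obtain ⟨h1, h2, h3, h4⟩ := h
  rcases hc with hc | hc | hc | hc | hc | hc | hc | hc | hc | hc | hc | hc <;>
    obtain ⟨a, b, d, e⟩ := hc <;> rw [a, b, d, e] at h' <;> obtain ⟨k1, k2, k3, k4⟩ := h' <;>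
    rw [a, b] <;> first | rfl | exact Finset.pair_comm _ _ | (exfalso; linarith)

/-- The neighbourhood of an edge. -/
def edgeRegion (f₀ : EdgeFlag N) : T.FlagRegion where
  base := f₀
  carrier f := {s | T.flagNext.SameCycle f₀ f ∧ s.1 (f.2.1 2) < s.1 (f.2.1 0) ∧
    s.1 (f.2.1 2) < s.1 (f.2.1 1) ∧ s.1 (f.2.1 3) < s.1 (f.2.1 0) ∧ s.1 (f.2.1 3) < s.1 (f.2.1 1)}
  isOpen f := isOpen_const.and ((isOpen_coord_lt _ _).and ((isOpen_coord_lt _ _).and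
    ((isOpen_coord_lt _ _).and (isOpen_coord_lt _ _))))
  sameCycle f s h := h.1
  pos f s h := ⟨(s.2.1 _).1.trans_lt h.2.1, (s.2.1 _).1.trans_lt h.2.2.1⟩
  -- One tetrahedron may meet the edge several times; the strict inequalities assign each of its
  -- points to at most one of these occurrences.
  unique f f' s h h' e := by
    refine T.flagEdge_injOn h.1 h'.1 (Prod.ext e (Subtype.ext ?_))
    exact edge_eq_of_lt f.2.2 f'.2.2 h.2 h'.2
  next f s h _ := by
    refine ⟨Equiv.Perm.sameCycle_apply_right.mpr h.1, ?_⟩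
    simp only [perm_flagNext, Equiv.swap_apply_left, Equiv.swap_apply_right,
      Equiv.swap_apply_of_ne_of_ne (show (0 : Fin 4) ≠ 2 by decide) (show (0 : Fin 4) ≠ 3 by decide),
      Equiv.swap_apply_of_ne_of_ne (show (1 : Fin 4) ≠ 2 by decide) (show (1 : Fin 4) ≠ 3 by decide)]
    exact ⟨h.2.2.2.1, h.2.2.2.2, h.2.1, h.2.2.1⟩
  prev f s h _ := by
    refine ⟨Equiv.Perm.sameCycle_symm_apply_right.mpr h.1, ?_⟩
    simp only [perm_flagNext_symm, Equiv.swap_apply_left, Equiv.swap_apply_right,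
      Equiv.swap_apply_of_ne_of_ne (show (0 : Fin 4) ≠ 2 by decide) (show (0 : Fin 4) ≠ 3 by decide),
      Equiv.swap_apply_of_ne_of_ne (show (1 : Fin 4) ≠ 2 by decide) (show (1 : Fin 4) ≠ 3 by decide)]
    exact ⟨h.2.2.2.1, h.2.2.2.2, h.2.1, h.2.2.1⟩

/-- The neighbourhood of a face. -/
def faceRegion (f₀ : EdgeFlag N) : T.FlagRegion where
  base := f₀
  carrier f := {s | (f = f₀ ∧ ∀ i, i ≠ 2 → s.1 (f.2.1 2) < s.1 (f.2.1 i)) ∨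
    (f = T.flagNext f₀ ∧ ∀ i, i ≠ 3 → s.1 (f.2.1 3) < s.1 (f.2.1 i))}
  isOpen f := by
    have h : ∀ a, IsOpen {s : IdealSimplex | ∀ i, i ≠ a → s.1 (f.2.1 a) < s.1 (f.2.1 i)} := by
      intro a
      simp only [Set.ofPred_forall]
      exact isOpen_iInter_of_finite fun i => isOpen_iInter_of_finite fun _ => isOpen_coord_lt _ _
    exact IsOpen.union (isOpen_const.and (h 2)) (isOpen_const.and (h 3))
  sameCycle f s h := by
    rcases h with ⟨rfl, -⟩ | ⟨rfl, -⟩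
    · exact Equiv.Perm.SameCycle.refl _ _
    · exact Equiv.Perm.sameCycle_apply_right.mpr (Equiv.Perm.SameCycle.refl _ _)
  pos f s h := by
    rcases h with ⟨-, h⟩ | ⟨-, h⟩
    · exact ⟨(s.2.1 _).1.trans_lt (h 0 (by decide)), (s.2.1 _).1.trans_lt (h 1 (by decide))⟩
    · exact ⟨(s.2.1 _).1.trans_lt (h 0 (by decide)), (s.2.1 _).1.trans_lt (h 1 (by decide))⟩
  -- If both sides of the face lie in one tetrahedron, the point would have its strictly smallest
  -- coordinate at two different vertices.
  unique f f' s h h' e := by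
    have key : ∀ f : EdgeFlag N, (∀ i, i ≠ 2 → s.1 (f.2.1 2) < s.1 (f.2.1 i)) →
        (∀ i, i ≠ 3 → s.1 ((T.flagNext f).2.1 3) < s.1 ((T.flagNext f).2.1 i)) →
        (T.flagNext f).1 ≠ f.1 := by
      intro f h1 h2 h3
      have hne := T.flagNext_ne_self f h3
      obtain ⟨i, hi⟩ := f.2.1.surjective ((T.flagNext f).2.1 3)
      obtain ⟨k, hk⟩ := (T.flagNext f).2.1.surjective (f.2.1 2)
      have h4 := h1 i fun h => hne (by rw [← hi, h])
      have h5 := h2 k fun h => hne (by rw [← hk, h])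
      rw [hi] at h4
      rw [hk] at h5
      exact lt_asymm h4 h5
    rcases h with ⟨rfl, h⟩ | ⟨rfl, h⟩ <;> rcases h' with ⟨rfl, h'⟩ | ⟨rfl, h'⟩
    · rfl
    · exact absurd e.symm (key _ h h')
    · exact absurd e (key _ h' h)
    · rfl
  next f s h h0 := by
    rcases h with ⟨rfl, h⟩ | ⟨rfl, h⟩
    · refine Or.inr ⟨rfl, fun i hi => ?_⟩
      rw [perm_flagNext, perm_flagNext, Equiv.swap_apply_right]
      exact h _ fun h => hi ((Equiv.swap_apply_eq_iff.mp h).trans (Equiv.swap_apply_left _ _))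
    · have := h 2 (by decide)
      rw [h0] at this
      exact absurd this (not_lt.mpr (s.2.1 _).1)
  prev f s h h0 := by
    rcases h with ⟨rfl, h⟩ | ⟨rfl, h⟩
    · have := h 3 (by decide)
      rw [h0] at this
      exact absurd this (not_lt.mpr (s.2.1 _).1)
    · refine Or.inl ⟨Equiv.symm_apply_apply _ _, fun i hi => ?_⟩
      rw [perm_flagNext_symm, perm_flagNext_symm, Equiv.swap_apply_left]
      exact h _ fun h => hi ((Equiv.swap_apply_eq_iff.mp h).trans (Equiv.swap_apply_right _ _))

/-- The interior of a tetrahedron. -/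
def cellRegion (f₀ : EdgeFlag N) : T.FlagRegion where
  base := f₀
  carrier f := {s | f = f₀ ∧ ∀ i, 0 < s.1 i}
  isOpen f := by
    refine isOpen_const.and ?_
    simp only [Set.ofPred_forall]
    exact isOpen_iInter_of_finite fun i => isOpen_lt continuous_const (continuous_coord i)
  sameCycle f s h := by
    rw [h.1]
  pos f s h := ⟨h.2 _, h.2 _⟩
  unique f f' s h h' _ := h.1.trans h'.1.symm
  next f s h h0 := absurd h0 (h.2 _).ne'
  prev f s h h0 := absurd h0 (h.2 _).ne'

theorem exists_even_perm_two_three : ∀ p q : Fin 4, p ≠ q →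
    ∃ σ : Equiv.Perm (Fin 4), Equiv.Perm.sign σ = 1 ∧ σ 2 = p ∧ σ 3 = q := by
  decide

/-- The regions cover the manifold. -/
theorem exists_flagRegion (j : Fin N) (s : IdealSimplex) :
    ∃ (R : T.FlagRegion) (σ : {σ : Equiv.Perm (Fin 4) // Equiv.Perm.sign σ = 1}),
      s ∈ R.carrier (j, σ) := by
  by_cases h2 : ∃ p q, p ≠ q ∧ s.1 p = 0 ∧ s.1 q = 0
  · obtain ⟨p, q, hpq, hp, hq⟩ := h2
    obtain ⟨σ, hσ, h2, h3⟩ := exists_even_perm_two_three p q hpq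
    refine ⟨T.edgeRegion (j, ⟨σ, hσ⟩), ⟨σ, hσ⟩, Equiv.Perm.SameCycle.refl _ _, ?_⟩
    have hsum := s.2.2
    rw [← Equiv.sum_comp σ, Fin.sum_univ_four, h2, h3, hp, hq] at hsum
    have h0 := (s.2.1 (σ 0)).2
    have h1 := (s.2.1 (σ 1)).2
    simp only [h2, h3, hp, hq]
    refine ⟨?_, ?_, ?_, ?_⟩ <;> linarith
  · by_cases h1 : ∃ p, s.1 p = 0
    · obtain ⟨p, hp⟩ := h1
      obtain ⟨q, hq⟩ := exists_ne p
      obtain ⟨σ, hσ, h2', -⟩ := exists_even_perm_two_three p q hq.symm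
      refine ⟨T.faceRegion (j, ⟨σ, hσ⟩), ⟨σ, hσ⟩, Or.inl ⟨rfl, fun i hi => ?_⟩⟩
      change s.1 (σ 2) < s.1 (σ i)
      rw [h2', hp]
      refine lt_of_le_of_ne (s.2.1 _).1 fun h => h2 ⟨p, σ i, ?_, hp, h.symm⟩
      rw [← h2']
      exact σ.injective.ne hi.symm
    · push Not at h1
      exact ⟨T.cellRegion (j, ⟨1, by simp⟩), ⟨1, by simp⟩, rfl,
        fun i => lt_of_le_of_ne (s.2.1 i).1 (h1 i).symm⟩

end IdealTriangulation

/-! ## The topology of projective space -/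

/-- The line of a vector (and an arbitrary line for the zero vector). -/
def projMk (v : V4) : RP3 :=
  if h : v ≠ 0 then Projectivization.mk ℝ v h
  else Projectivization.mk ℝ (Pi.single 0 1) (by simp)

theorem projMk_of_ne {v : V4} (h : v ≠ 0) : projMk v = Projectivization.mk ℝ v h := dif_pos h

theorem projMk_smul {a : ℝ} (ha : a ≠ 0) (v : V4) : projMk (a • v) = projMk v := by
  rcases eq_or_ne v 0 with rfl | h
  · rw [smul_zero]
  · rw [projMk_of_ne h, projMk_of_ne (smul_ne_zero ha h), Projectivization.mk_eq_mk_iff']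
    exact ⟨a, rfl⟩

theorem exists_smul_of_projMk_eq {v v' : V4} (h : v ≠ 0) (h' : v' ≠ 0) (e : projMk v = projMk v') :
    ∃ a : ℝ, a ≠ 0 ∧ v = a • v' := by
  rw [projMk_of_ne h, projMk_of_ne h', Projectivization.mk_eq_mk_iff] at e
  obtain ⟨a, ha⟩ := e
  exact ⟨a, a.ne_zero, ha.symm⟩

theorem exists_projMk_eq (p : RP3) : ∃ v : V4, v ≠ 0 ∧ p = projMk v := by
  induction p using Projectivization.ind with
  | h v hv => exact ⟨v, hv, (projMk_of_ne hv).symm⟩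

theorem smul_projMk (g : GL4) {v : V4} (h : v ≠ 0) : g • projMk v = projMk (g • v) := by
  have h' : g • v ≠ 0 := (smul_ne_zero_iff_ne g).mpr h
  rw [projMk_of_ne h, projMk_of_ne h']
  rfl

theorem continuousOn_projMk : ContinuousOn projMk {0}ᶜ := by
  rw [continuousOn_iff_continuous_domRestrict]
  have h : Continuous (Projectivization.mk' ℝ : {v : V4 // v ≠ 0} → RP3) := continuous_coinduced_rng
  refine h.congr fun v => ?_
  exact (projMk_of_ne v.2).symm

/-- The projection to projective space is open. -/
theorem mem_nhds_projMk {v : V4} (hv : v ≠ 0) {B : Set RP3} (h : ∀ᶠ x in 𝓝 v, projMk x ∈ B) :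
    B ∈ 𝓝 (projMk v) := by
  obtain ⟨S, hS, hSo, hvS⟩ := eventually_nhds_iff.mp (h.and (isOpen_ne.mem_nhds hv))
  refine mem_nhds_iff.mpr ⟨projMk '' S, ?_, ?_, ⟨v, hvS, rfl⟩⟩
  · rintro _ ⟨x, hx, rfl⟩
    exact (hS x hx).1
  · rw [isOpen_coinduced]
    have e : Projectivization.mk' ℝ ⁻¹' (projMk '' S) =
        {x : {v : V4 // v ≠ 0} | ∃ a : ℝ, a ≠ 0 ∧ a • x.1 ∈ S} := by
      ext x
      constructor
      · rintro ⟨y, hy, hxy⟩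
        have hx : projMk y = projMk x.1 := by
          rw [hxy, projMk_of_ne x.2, Projectivization.mk'_eq_mk]
        obtain ⟨a, ha, h⟩ := exists_smul_of_projMk_eq (hS y hy).2 x.2 hx
        exact ⟨a, ha, h ▸ hy⟩
      · rintro ⟨a, ha, h⟩
        exact ⟨_, h, by rw [projMk_smul ha, projMk_of_ne x.2, Projectivization.mk'_eq_mk]⟩
    rw [e]
    simp only [Set.ofPred_exists]
    refine isOpen_iUnion fun a => isOpen_const.and ?_
    exact hSo.preimage (continuous_subtype_val.const_smul a)

theorem continuous_smul_RP3 (g : GL4) : Continuous fun p : RP3 => g • p := by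
  rw [continuous_coinduced_dom]
  have h : Continuous (Projectivization.mk' ℝ : {v : V4 // v ≠ 0} → RP3) := continuous_coinduced_rng
  have hc : Continuous fun v : V4 => g • v :=
    LinearMap.continuous_of_finiteDimensional (g : V4 →ₗ[ℝ] V4)
  have h2 : Continuous fun v : {v : V4 // v ≠ 0} =>
      (⟨g • v.1, (smul_ne_zero_iff_ne g).mpr v.2⟩ : {v : V4 // v ≠ 0}) :=
    Continuous.subtype_mk (hc.comp continuous_subtype_val) _
  exact h.comp h2

/-- Projective transformations as homeomorphisms. -/
def projHomeo (g : GL4) : RP3 ≃ₜ RP3 where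
  toEquiv := MulAction.toPerm g
  continuous_toFun := continuous_smul_RP3 g
  continuous_invFun := continuous_smul_RP3 g⁻¹

/-! ## The topology of the manifold -/

namespace IdealTriangulation

variable {N : ℕ} (T : IdealTriangulation N)

theorem continuous_toSpace (j : Fin N) : Continuous (T.toSpace j) :=
  continuous_quot_mk.comp (Continuous.prodMk_right j)

theorem isOpen_space_iff {U : Set T.Space} : IsOpen U ↔ ∀ j, IsOpen (T.toSpace j ⁻¹' U) := by
  constructor
  · exact fun h j => h.preimage (T.continuous_toSpace j)
  · intro h
    have : IsOpen (Quot.mk T.FaceRel ⁻¹' U) := by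
      have e : Quot.mk T.FaceRel ⁻¹' U =
          ⋃ j, (Prod.fst ⁻¹' {j}) ∩ (Prod.snd ⁻¹' (T.toSpace j ⁻¹' U)) := by
        ext ⟨j, s⟩
        simp only [Set.mem_iUnion, Set.mem_inter_iff, Set.mem_preimage, Set.mem_singleton_iff]
        exact ⟨fun h => ⟨j, rfl, h⟩, fun ⟨_, hj, h⟩ => hj ▸ h⟩
      rw [e]
      exact isOpen_iUnion fun j => ((isOpen_discrete _).preimage continuous_fst).inter
        ((h j).preimage continuous_snd)
    exact this

theorem exists_toSpace_eq (x : T.Space) : ∃ j s, T.toSpace j s = x := by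
  induction x using Quot.ind with
  | mk p => exact ⟨p.1, p.2, rfl⟩

theorem faceRel_iff {p q : Fin N × IdealSimplex} : T.FaceRel p q ↔
    ∃ a, p.2.1 a = 0 ∧ q = (T.adj p.1 a, p.2.perm (T.glue p.1 a)) := by
  constructor
  · rintro ⟨a, h0, h1, h2⟩
    exact ⟨a, h0, Prod.ext h1 (IdealSimplex.eq_perm h2)⟩
  · rintro ⟨a, h0, rfl⟩
    exact ⟨a, h0, rfl, fun i => p.2.perm_apply _ i⟩

theorem faceRel_symm {p q : Fin N × IdealSimplex} (h : T.FaceRel p q) : T.FaceRel q p := by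
  obtain ⟨a, h0, h1, h2⟩ := h
  refine ⟨T.glue p.1 a a, by rw [h2, h0], by rw [h1, T.adj_adj], fun i => ?_⟩
  rw [h1, T.glue_glue, ← h2]
  simp

/-- A property of the points of the tetrahedra that is compatible with the gluing. -/
def quotProp (P : Fin N × IdealSimplex → Prop) (h : ∀ p q, T.FaceRel p q → P p → P q) :
    Set T.Space :=
  {x | Quot.lift P (fun p q hpq => propext ⟨h p q hpq, h q p (T.faceRel_symm hpq)⟩) x}

end IdealTriangulation

/-! ## Developed tetrahedra -/

theorem form_sum_left (c : ℝ) (a : Fin 4 → ℝ) (Z : Fin 4 → V4) (y : V4) :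
    form c (∑ i, a i • Z i) y = ∑ i, a i * form c (Z i) y := by
  simp only [form, Fin.sum_univ_four, Pi.add_apply, Pi.smul_apply, smul_eq_mul]
  ring

/-- The points of an ideal tetrahedron other than its vertices are negative. -/
theorem form_sum_neg {c : ℝ} {Z : Fin 4 → V4} (hZ : IsIdealTetrahedron c Z) {a : Fin 4 → ℝ}
    (ha : ∀ i, 0 ≤ a i) {p q : Fin 4} (hpq : p ≠ q) (hp : 0 < a p) (hq : 0 < a q) :
    form c (∑ i, a i • Z i) (∑ i, a i • Z i) < 0 := by
  have hnonpos : ∀ i k, a i * (a k * form c (Z k) (Z i)) ≤ 0 := by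
    intro i k
    have : form c (Z k) (Z i) ≤ 0 := by
      rcases eq_or_ne k i with rfl | h
      · exact (hZ.1 k).le
      · exact (hZ.2 k i h).le
    exact mul_nonpos_of_nonneg_of_nonpos (ha i) (mul_nonpos_of_nonneg_of_nonpos (ha k) this)
  have e : form c (∑ i, a i • Z i) (∑ i, a i • Z i) = ∑ i, ∑ k, a i * (a k * form c (Z k) (Z i)) := by
    rw [form_sum_left]
    refine Finset.sum_congr rfl fun i _ => ?_
    rw [form_comm, form_sum_left, Finset.mul_sum]
  rw [e]
  refine Finset.sum_neg' (fun i _ => Finset.sum_nonpos fun k _ => hnonpos i k)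
    ⟨p, Finset.mem_univ p, Finset.sum_neg' (fun k _ => hnonpos p k) ⟨q, Finset.mem_univ q, ?_⟩⟩
  exact mul_neg_of_pos_of_neg hp (mul_neg_of_pos_of_neg hq (hZ.2 q p hpq.symm))

theorem mk_mem_modelSpace_iff {c : ℝ} {v : V4} (hv : v ≠ 0) :
    projMk v ∈ modelSpace c ↔ form c v v < 0 := by
  constructor
  · rintro ⟨x, hx, e, h⟩
    rw [← projMk_of_ne hx] at e
    obtain ⟨a, ha, rfl⟩ := exists_smul_of_projMk_eq hv hx e
    have : form c (a • x) (a • x) = a ^ 2 * form c x x := by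
      simp only [form, Pi.smul_apply, smul_eq_mul]; ring
    rw [this]
    exact mul_neg_of_pos_of_neg (by positivity) h
  · intro h
    exact ⟨v, hv, projMk_of_ne hv, h⟩

namespace IdealTriangulation

variable {N : ℕ} {T : IdealTriangulation N} {c : ℝ} {w : Fin N → ShapeAlg c}

theorem reweight_nonneg (r : Fin 4 → Fin 4 → ℝ) {s : V4} (hs : ∀ i, 0 ≤ s i) (i : Fin 4) :
    0 ≤ reweight r s i := mul_nonneg (hs i) (Real.exp_pos _).le

theorem reweight_pos (r : Fin 4 → Fin 4 → ℝ) {s : V4} {i : Fin 4} (hs : 0 < s i) :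
    0 < reweight r s i := mul_pos hs (Real.exp_pos _)

theorem form_flagLift_neg (hw : T.IsPositiveSolution w) (f : EdgeFlag N) {s : IdealSimplex}
    (h0 : 0 < s.1 (f.2.1 0)) (h1 : 0 < s.1 (f.2.1 1)) :
    form c (T.flagLift w f s.1) (T.flagLift w f s.1) < 0 := by
  rw [flagLift, form_flagDev]
  refine mul_neg_of_pos_of_neg (norm_det_flagDev_pos hw f) ?_
  exact form_sum_neg (isIdealTetrahedron_tetVertex (hw.isPositiveShape f.1))
    (reweight_nonneg _ fun i => (s.2.1 i).1) (f.2.1.injective.ne (by decide))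
    (reweight_pos _ h0) (reweight_pos _ h1)

/-- All frame vectors have positive first coordinate. Developed vectors thus lie in one half-space,
so that proportional ones are positively proportional. -/
theorem flagLift_zero_pos (hw : T.IsPositiveSolution w) (f : EdgeFlag N) {s : IdealSimplex}
    (h0 : 0 < s.1 (f.2.1 0)) : 0 < T.flagLift w f s.1 0 := by
  obtain ⟨m, hm, h⟩ := exists_flagLift_eq hw f s.1
  rw [h, flagFrame, frameVec_sum]
  simp only [Matrix.cons_val_zero]
  have hn := norm_turn_pos hw f
  have hn' := norm_turn_pos hw (T.flagNext f)
  have hs : ∀ i, 0 ≤ m i * s.1 (f.2.1 i) := fun i => mul_nonneg (hm i).le (s.2.1 _).1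
  have := mul_pos (hm 0) h0
  have := hs 1
  have := mul_nonneg (hs 2) (by linarith : 0 ≤ QuadraticAlgebra.norm (T.turn w f) + 1)
  have := mul_nonneg (hs 3) (by linarith :
    0 ≤ QuadraticAlgebra.norm (T.turn w (T.flagNext f)) + 1)
  linarith

theorem flagLift_ne_zero (hw : T.IsPositiveSolution w) (f : EdgeFlag N) {s : IdealSimplex}
    (h0 : 0 < s.1 (f.2.1 0)) : T.flagLift w f s.1 ≠ 0 := by
  intro h
  have := flagLift_zero_pos hw f h0
  rw [h] at this
  exact lt_irrefl _ this

theorem continuous_flagLift (f : EdgeFlag N) : Continuous (T.flagLift w f) := by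
  have h1 : Continuous (T.flagDev w f) := LinearMap.continuous_of_finiteDimensional _
  refine h1.comp ?_
  unfold tetLift
  exact continuous_finsetSum _ fun i _ =>
    ((continuous_apply i).comp (continuous_reweight _)).smul continuous_const

/-- The reparametrization of a tetrahedron. -/
def tetHomeo (T : IdealTriangulation N) (w : Fin N → ShapeAlg c) (j : Fin N) :
    IdealSimplex ≃ₜ IdealSimplex :=
  idealSimplexHomeo (r := T.edgeRatio w j) (edgeRatio_antisymm j)

theorem reweight_eq_tetHomeo (j : Fin N) (s : IdealSimplex) (i : Fin 4) :
    reweight (T.edgeRatio w j) s.1 i =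
      (∑ k, reweight (T.edgeRatio w j) s.1 k) * (T.tetHomeo w j s).1 i := by
  have : ∑ k, reweight (T.edgeRatio w j) s.1 k ≠ 0 :=
    (sum_reweight_pos (T.edgeRatio w j) s.toStd.2).ne'
  rw [tetHomeo, idealSimplexHomeo_apply, mul_div_cancel₀ _ this]

theorem sum_reweight_idealSimplex_pos (r : Fin 4 → Fin 4 → ℝ) (s : IdealSimplex) :
    0 < ∑ k, reweight r s.1 k := sum_reweight_pos r s.toStd.2

theorem tetLift_eq (j : Fin N) (s : IdealSimplex) : T.tetLift w j s.1 =
    (∑ k, reweight (T.edgeRatio w j) s.1 k) •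
      ∑ i, (T.tetHomeo w j s).1 i • tetVertex (w j) i := by
  rw [tetLift, Finset.smul_sum]
  refine Finset.sum_congr rfl fun i _ => ?_
  rw [smul_smul, ← reweight_eq_tetHomeo]

theorem frameCoord_flagLift (hw : T.IsPositiveSolution w) (f : EdgeFlag N) {m : Fin 4 → ℝ}
    (hm : ∀ i, T.flagDev w f (tetVertex (w f.1) (f.2.1 i)) = m i • T.flagFrame w f i) (s : V4)
    (i : Fin 4) : frameCoord (T.turn w f) (T.turn w (T.flagNext f)) (T.flagLift w f s) i =
      reweight (T.edgeRatio w f.1) s (f.2.1 i) * m i := by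
  rw [flagLift, tetLift, flagDev_sum f _ hm, flagFrame, frameCoord_sum (cross_turn_pos hw f).ne']

/-- Frame coordinates recover the reweighted coordinates up to a common factor, and normalization
removes it; the reparametrization is injective. -/
theorem eq_of_flagLift_eq_smul (hw : T.IsPositiveSolution w) (f : EdgeFlag N) {s s' : IdealSimplex}
    {a : ℝ} (h : T.flagLift w f s'.1 = a • T.flagLift w f s.1) : s' = s := by
  obtain ⟨m, hm, hm'⟩ := exists_flagDev_tetVertex hw f
  have h1 : ∀ i, reweight (T.edgeRatio w f.1) s'.1 i = a * reweight (T.edgeRatio w f.1) s.1 i := by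
    intro i
    obtain ⟨k, rfl⟩ := f.2.1.surjective i
    have := congrFun (congrArg (frameCoord (T.turn w f) (T.turn w (T.flagNext f))) h) k
    rw [frameCoord_smul, Pi.smul_apply, frameCoord_flagLift hw f hm', frameCoord_flagLift hw f hm',
      smul_eq_mul, ← mul_assoc] at this
    exact mul_right_cancel₀ (hm k).ne' this
  apply (T.tetHomeo w f.1).injective
  refine Subtype.ext (funext fun i => ?_)
  have hp := sum_reweight_idealSimplex_pos (T.edgeRatio w f.1) s
  have hp' := sum_reweight_idealSimplex_pos (T.edgeRatio w f.1) s'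
  have h2 := reweight_eq_tetHomeo (T := T) (w := w) f.1 s i
  have h3 := reweight_eq_tetHomeo (T := T) (w := w) f.1 s' i
  have h4 : ∑ k, reweight (T.edgeRatio w f.1) s'.1 k =
      a * ∑ k, reweight (T.edgeRatio w f.1) s.1 k := by
    rw [Finset.mul_sum]
    exact Finset.sum_congr rfl fun k _ => h1 k
  rw [h1, h2, h4, ← mul_assoc] at h3
  rw [h4] at hp'
  exact (mul_left_cancel₀ hp'.ne' h3).symm

/-- Near a point of a developed tetrahedron, the vectors in its wedge are again points of the
developed tetrahedron, up to scale. -/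
theorem eventually_exists_flagLift (hw : T.IsPositiveSolution w) (f : EdgeFlag N)
    {s : IdealSimplex} (h0 : 0 < s.1 (f.2.1 0)) (h1 : 0 < s.1 (f.2.1 1)) {V : Set IdealSimplex}
    (hV : V ∈ 𝓝 s) : ∀ᶠ v in 𝓝 (T.flagLift w f s.1), T.InWedge w f v →
      ∃ s' ∈ V, ∃ C : ℝ, 0 < C ∧ T.flagLift w f s'.1 = C • v := by
  obtain ⟨m, hm, hm'⟩ := exists_flagDev_tetVertex hw f
  have hcr := cross_turn_pos hw f
  set h := T.tetHomeo w f.1 with hh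
  -- barycentric coordinates
  set y : V4 → Fin 4 → ℝ := fun v i =>
    frameCoord (T.turn w f) (T.turn w (T.flagNext f)) v (f.2.1.symm i) / m (f.2.1.symm i) with hy
  have hyc : Continuous y := continuous_pi fun i =>
    ((continuous_apply _).comp (continuous_frameCoord _ _)).div_const _
  have hys : y (T.flagLift w f s.1) = fun i => reweight (T.edgeRatio w f.1) s.1 i := by
    funext i
    simp only [hy, frameCoord_flagLift hw f hm', Equiv.apply_symm_apply]
    exact mul_div_cancel_right₀ _ (hm _).ne'
  have hyv : ∀ v, T.flagDev w f (∑ i, y v i • tetVertex (w f.1) i) = v := by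
    intro v
    rw [flagDev_sum f _ hm']
    conv_rhs => rw [← sum_frameCoord hcr.ne' v]
    refine Finset.sum_congr rfl fun i _ => ?_
    simp only [hy, Equiv.symm_apply_apply]
    rw [div_mul_cancel₀ _ (hm i).ne', flagFrame]
  have hsum : 0 < ∑ i, y (T.flagLift w f s.1) i := by
    rw [hys]
    exact sum_reweight_idealSimplex_pos _ s
  -- The frame gives barycentric coordinates of the straight simplex, so neighbourhoods have to be
  -- transported through the reparametrization.
  have hV' : h.symm ⁻¹' V ∈ 𝓝 (h s) :=
    h.symm.continuous.continuousAt.preimage_mem_nhds (by rwa [h.symm_apply_apply])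
  obtain ⟨W, hW, hWV⟩ := mem_nhds_subtype _ _ _ |>.mp hV'
  have hlim : ContinuousAt (fun v i => y v i / ∑ k, y v k) (T.flagLift w f s.1) := by
    refine continuousAt_pi.mpr fun i => ContinuousAt.div ?_ ?_ hsum.ne'
    · exact ((continuous_apply i).comp hyc).continuousAt
    · exact (continuous_finsetSum _ fun k _ => (continuous_apply k).comp hyc).continuousAt
  have hval : (fun i => y (T.flagLift w f s.1) i / ∑ k, y (T.flagLift w f s.1) k) = (h s).1 := by
    funext i
    rw [hys]
    rfl
  have e1 := hlim.preimage_mem_nhds (t := W) (by rw [hval]; exact hW)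
  have e2 : ∀ p, 0 < s.1 p → ∀ᶠ v in 𝓝 (T.flagLift w f s.1), 0 < y v p := by
    intro p hp
    refine ((continuous_apply p).comp hyc).continuousAt.eventually (lt_mem_nhds ?_)
    simp only [Function.comp_apply, hys]
    exact reweight_pos _ hp
  filter_upwards [e1, e2 _ h0, e2 _ h1] with v hvW hv0 hv1 hwedge
  -- Coordinates at the ends of the edge are positive by continuity, the other two are nonnegative
  -- exactly by the wedge condition.
  have hnn : ∀ i, 0 ≤ y v i := by
    intro i
    obtain ⟨k, rfl⟩ := f.2.1.surjective i
    have hk : k = 0 ∨ k = 1 ∨ k = 2 ∨ k = 3 := by omega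
    rcases hk with rfl | rfl | rfl | rfl
    · exact hv0.le
    · exact hv1.le
    · simp only [hy, Equiv.symm_apply_apply]
      exact div_nonneg (div_nonneg hwedge.2 hcr.le) (hm _).le
    · simp only [hy, Equiv.symm_apply_apply]
      exact div_nonneg (div_nonneg hwedge.1 hcr.le) (hm _).le
  have hpos : 0 < ∑ k, y v k :=
    Finset.sum_pos' (fun i _ => hnn i) ⟨_, Finset.mem_univ _, hv0⟩
  have hstd : (fun i => y v i / ∑ k, y v k) ∈ stdSimplex ℝ (Fin 4) :=
    ⟨fun i => div_nonneg (hnn i) hpos.le, by rw [← Finset.sum_div]; exact div_self hpos.ne'⟩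
  have hlt : ∀ i, y v i / ∑ k, y v k < 1 := by
    intro i
    refine (lt_one_iff hstd i).mpr ?_
    rcases eq_or_ne i (f.2.1 0) with rfl | hi
    · exact ⟨f.2.1 1, f.2.1.injective.ne (by decide), (div_pos hv1 hpos).ne'⟩
    · exact ⟨f.2.1 0, hi.symm, (div_pos hv0 hpos).ne'⟩
  set q : IdealSimplex := ⟨fun i => y v i / ∑ k, y v k, fun i => ⟨hstd.1 i, hlt i⟩, hstd.2⟩ with hq
  have hqV : h.symm q ∈ V := hWV (show q.1 ∈ W from hvW)
  have hr := sum_reweight_idealSimplex_pos (T.edgeRatio w f.1) (h.symm q)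
  refine ⟨h.symm q, hqV, (∑ k, reweight (T.edgeRatio w f.1) (h.symm q).1 k) / ∑ k, y v k,
    div_pos hr hpos, ?_⟩
  rw [flagLift, tetLift_eq, ← hh, h.apply_symm_apply, map_smul]
  have e3 : ∑ i, q.1 i • tetVertex (w f.1) i = (∑ k, y v k)⁻¹ • ∑ i, y v i • tetVertex (w f.1) i := by
    rw [Finset.smul_sum]
    refine Finset.sum_congr rfl fun i _ => ?_
    rw [smul_smul, hq, inv_mul_eq_div]
  rw [e3, map_smul, hyv, smul_smul, div_eq_mul_inv]

/-! ## The charts -/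

/-- The points of the tetrahedra over a region. -/
def FlagRegion.Over (R : T.FlagRegion) (p : Fin N × IdealSimplex) : Prop :=
  ∃ σ, p.2 ∈ R.carrier (p.1, σ)

theorem FlagRegion.cross (R : T.FlagRegion) {f : EdgeFlag N} {s : IdealSimplex}
    (hs : s ∈ R.carrier f) {q : Fin N × IdealSimplex} (h : T.FaceRel (f.1, s) q) :
    (s.1 (f.2.1 2) = 0 ∧ q.1 = (T.flagNext f).1 ∧ q.2 = s.perm (T.glue f.1 (f.2.1 2)) ∧
      q.2 ∈ R.carrier (T.flagNext f)) ∨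
    (s.1 (f.2.1 3) = 0 ∧ q.1 = (T.flagNext.symm f).1 ∧ q.2 = s.perm (T.glue f.1 (f.2.1 3)) ∧
      q.2 ∈ R.carrier (T.flagNext.symm f)) := by
  obtain ⟨a, h0, rfl⟩ := T.faceRel_iff.mp h
  obtain ⟨k, rfl⟩ := f.2.1.surjective a
  have hpos := R.pos f s hs
  have hk : k = 2 ∨ k = 3 := by
    have : k ≠ 0 := by rintro rfl; exact hpos.1.ne' h0
    have : k ≠ 1 := by rintro rfl; exact hpos.2.ne' h0
    omega
  rcases hk with rfl | rfl
  · exact Or.inl ⟨h0, rfl, rfl, R.next f s hs h0⟩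
  · exact Or.inr ⟨h0, rfl, rfl, R.prev f s hs h0⟩

theorem FlagRegion.over_of_faceRel (R : T.FlagRegion) (p q : Fin N × IdealSimplex)
    (h : T.FaceRel p q) (hp : R.Over p) : R.Over q := by
  obtain ⟨σ, hσ⟩ := hp
  rcases R.cross hσ h with ⟨-, h1, -, h2⟩ | ⟨-, h1, -, h2⟩
  · exact ⟨(T.flagNext (p.1, σ)).2, by rw [h1]; exact h2⟩
  · exact ⟨(T.flagNext.symm (p.1, σ)).2, by rw [h1]; exact h2⟩

/-- The region as a subset of the manifold. -/
def FlagRegion.domain (R : T.FlagRegion) : Set T.Space := T.quotProp R.Over R.over_of_faceRel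

theorem FlagRegion.toSpace_mem {R : T.FlagRegion} {f : EdgeFlag N} {s : IdealSimplex}
    (hs : s ∈ R.carrier f) : T.toSpace f.1 s ∈ R.domain := ⟨f.2, hs⟩

theorem FlagRegion.exists_of_mem {R : T.FlagRegion} {x : T.Space} (hx : x ∈ R.domain) :
    ∃ f s, s ∈ R.carrier f ∧ T.toSpace f.1 s = x := by
  obtain ⟨j, s, rfl⟩ := T.exists_toSpace_eq x
  obtain ⟨σ, hσ⟩ := hx
  exact ⟨(j, σ), s, hσ, rfl⟩

theorem FlagRegion.preimage_domain_inter (R : T.FlagRegion) {A : Set T.Space} {j : Fin N} :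
    T.toSpace j ⁻¹' (R.domain ∩ A) =
      ⋃ σ, (R.carrier (j, σ) ∩ T.toSpace j ⁻¹' A) := by
  ext s
  simp only [Set.mem_iUnion, Set.preimage_inter, Set.mem_inter_iff, exists_and_right]
  rfl

theorem FlagRegion.isOpen_domain (R : T.FlagRegion) : IsOpen R.domain := by
  rw [isOpen_space_iff]
  intro j
  have := R.preimage_domain_inter (A := Set.univ) (j := j)
  rw [Set.inter_univ] at this
  rw [this]
  simp only [Set.preimage_univ, Set.inter_univ]
  exact isOpen_iUnion fun σ => R.isOpen _

open Classical in
/-- The developing map of a region on the points of the tetrahedra. -/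
def FlagRegion.pointMap (R : T.FlagRegion) (w : Fin N → ShapeAlg c) (p : Fin N × IdealSimplex) :
    RP3 :=
  if h : R.Over p then projMk (T.flagLift w (p.1, h.choose) p.2.1) else projMk 0

theorem FlagRegion.pointMap_eq {R : T.FlagRegion} {f : EdgeFlag N} {s : IdealSimplex}
    (hs : s ∈ R.carrier f) : R.pointMap w (f.1, s) = projMk (T.flagLift w f s.1) := by
  have h : R.Over (f.1, s) := ⟨f.2, hs⟩
  rw [pointMap, dif_pos h]
  have : ((f.1, h.choose) : EdgeFlag N) = f := R.unique _ _ s h.choose_spec hs rfl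
  rw [this]

theorem FlagRegion.pointMap_eq_of_faceRel (R : T.FlagRegion) (hw : T.IsPositiveSolution w)
    (p q : Fin N × IdealSimplex) (h : T.FaceRel p q) : R.pointMap w p = R.pointMap w q := by
  by_cases hp : R.Over p
  · obtain ⟨σ, hσ⟩ := hp
    have e1 : R.pointMap w p = _ := R.pointMap_eq (f := (p.1, σ)) hσ
    rw [e1]
    obtain ⟨q1, q2⟩ := q
    rcases R.cross hσ h with ⟨h0, h1, h2, h3⟩ | ⟨h0, h1, h2, h3⟩
    · simp only at h1 h2 h3
      rw [h1, R.pointMap_eq h3]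
      obtain ⟨C, hC, h4⟩ := flagLift_flagNext hw (p.1, σ) p.2.2.2 h0 (s' := q2.1)
        (by rw [h2]; exact fun i => p.2.perm_apply _ i)
      rw [h4, projMk_smul hC.ne']
    · simp only at h1 h2 h3
      rw [h1, R.pointMap_eq h3]
      obtain ⟨C, hC, h4⟩ := flagLift_flagNext_symm hw (p.1, σ) p.2.2.2 h0 (s' := q2.1)
        (by rw [h2]; exact fun i => p.2.perm_apply _ i)
      rw [h4, projMk_smul hC.ne']
  · have hq : ¬ R.Over q := fun hq => hp (R.over_of_faceRel q p (T.faceRel_symm h) hq)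
    rw [pointMap, pointMap, dif_neg hp, dif_neg hq]

/-- The developing map of a region. -/
def FlagRegion.dev (R : T.FlagRegion) (hw : T.IsPositiveSolution w) : T.Space → RP3 :=
  Quot.lift (R.pointMap w) (R.pointMap_eq_of_faceRel hw)

theorem FlagRegion.dev_toSpace {R : T.FlagRegion} (hw : T.IsPositiveSolution w) {f : EdgeFlag N}
    {s : IdealSimplex} (hs : s ∈ R.carrier f) :
    R.dev hw (T.toSpace f.1 s) = projMk (T.flagLift w f s.1) := R.pointMap_eq hs

theorem toSpace_perm (T : IdealTriangulation N) (j : Fin N) {a : Fin 4} {s : IdealSimplex}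
    (h : s.1 a = 0) : T.toSpace (T.adj j a) (s.perm (T.glue j a)) = T.toSpace j s :=
  (Quot.sound (T.faceRel_iff (p := (j, s)).mpr ⟨a, h, rfl⟩)).symm

theorem FlagRegion.exists_flagLift (R : T.FlagRegion) (hw : T.IsPositiveSolution w)
    {f f' : EdgeFlag N} {s : IdealSimplex} (hs : s ∈ R.carrier f)
    (hf : T.flagNext.SameCycle f f') (h : T.InWedge w f' (T.flagLift w f s.1)) :
    ∃ s' ∈ R.carrier f', T.toSpace f'.1 s' = T.toSpace f.1 s ∧
      ∃ C : ℝ, 0 < C ∧ T.flagLift w f' s'.1 = C • T.flagLift w f s.1 := by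
  obtain ⟨s', ⟨h1, h2⟩, h3⟩ := exists_flagLift_of_inWedge hw
    (Q := fun g r => r ∈ R.carrier g ∧ T.toSpace g.1 r = T.toSpace f.1 s)
    (fun g r hg h0 => ⟨R.next g r hg.1 h0, (T.toSpace_perm g.1 h0).trans hg.2⟩)
    (fun g r hg h0 => ⟨R.prev g r hg.1 h0, (T.toSpace_perm g.1 h0).trans hg.2⟩)
    hf ⟨hs, rfl⟩ h
  exact ⟨s', h1, h2, h3⟩

/-- If two points have the same image, their vectors are positively proportional, so the first lies
in the wedge of the second. It can then be represented in the same tetrahedron, where development is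
injective. -/
theorem FlagRegion.injOn_dev (R : T.FlagRegion) (hw : T.IsPositiveSolution w) :
    Set.InjOn (R.dev hw) R.domain := by
  intro x hx y hy hxy
  obtain ⟨f, s, hs, rfl⟩ := R.exists_of_mem hx
  obtain ⟨f', s', hs', rfl⟩ := R.exists_of_mem hy
  rw [R.dev_toSpace hw hs, R.dev_toSpace hw hs'] at hxy
  have hp := R.pos f s hs
  have hp' := R.pos f' s' hs'
  obtain ⟨a, ha, h⟩ := exists_smul_of_projMk_eq (flagLift_ne_zero hw f hp.1)
    (flagLift_ne_zero hw f' hp'.1) hxy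
  have ha' : 0 < a := by
    have h1 := flagLift_zero_pos hw f hp.1
    have h2 := flagLift_zero_pos hw f' hp'.1
    rw [h, Pi.smul_apply, smul_eq_mul] at h1
    exact pos_of_mul_pos_left h1 h2.le
  have hwedge : T.InWedge w f' (T.flagLift w f s.1) := by
    rw [h]
    exact (inWedge_flagLift hw f' fun i => (s'.2.1 i).1).smul ha'.le
  obtain ⟨s₁, -, h1, C, hC, h2⟩ := R.exists_flagLift hw hs
    ((R.sameCycle f s hs).symm.trans (R.sameCycle f' s' hs')) hwedge
  rw [h, smul_smul] at h2
  rw [← h1, eq_of_flagLift_eq_smul hw f' h2]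

theorem FlagRegion.continuousOn_dev (R : T.FlagRegion) (hw : T.IsPositiveSolution w) :
    ContinuousOn (R.dev hw) R.domain := by
  rw [continuousOn_open_iff R.isOpen_domain]
  intro O hO
  rw [isOpen_space_iff]
  intro j
  rw [R.preimage_domain_inter]
  refine isOpen_iUnion fun σ => ?_
  have e : R.carrier (j, σ) ∩ T.toSpace j ⁻¹' (R.dev hw ⁻¹' O) =
      R.carrier (j, σ) ∩ (fun s : IdealSimplex => projMk (T.flagLift w (j, σ) s.1)) ⁻¹' O := by
    ext s
    refine and_congr_right fun hs => ?_
    change R.dev hw (T.toSpace ((j, σ) : EdgeFlag N).1 s) ∈ O ↔ _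
    rw [R.dev_toSpace hw hs]
    rfl
  rw [e]
  refine ContinuousOn.isOpen_inter_preimage ?_ (R.isOpen _) hO
  refine continuousOn_projMk.comp
    ((continuous_flagLift _).comp continuous_idealSimplex_val).continuousOn ?_
  intro s hs
  exact flagLift_ne_zero hw _ (R.pos _ s hs).1

theorem isClosed_inWedge (f : EdgeFlag N) : IsClosed {v | T.InWedge w f v} := by
  have h : ∀ x : ShapeAlg c, Continuous fun v => cross x (planePart c v) := by
    intro x
    simp only [cross, planePart]
    fun_prop
  have h' : ∀ x : ShapeAlg c, Continuous fun v => cross (planePart c v) x := by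
    intro x
    simp only [cross, planePart]
    fun_prop
  exact (isClosed_le continuous_const (h _)).inter (isClosed_le continuous_const (h' _))

/-- A vector near the image lies in one of the finitely many wedges. Wedges are closed, so only
those containing the image itself matter; in each of them the point has a representative, near which
the developed tetrahedron fills the wedge. -/
theorem FlagRegion.image_dev_mem_nhds (R : T.FlagRegion) (hw : T.IsPositiveSolution w)
    {x : T.Space} (hx : x ∈ R.domain) {U : Set T.Space} (hU : U ∈ 𝓝 x) :
    R.dev hw '' U ∈ 𝓝 (R.dev hw x) := by
  obtain ⟨f, s, hs, rfl⟩ := R.exists_of_mem hx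
  have hpos := R.pos f s hs
  rw [R.dev_toSpace hw hs]
  refine mem_nhds_projMk (flagLift_ne_zero hw f hpos.1) ?_
  have key : ∀ f', ∀ᶠ v in 𝓝 (T.flagLift w f s.1), T.flagNext.SameCycle f f' →
      T.InWedge w f' v → projMk v ∈ R.dev hw '' U := by
    intro f'
    by_cases hf : T.flagNext.SameCycle f f'
    swap
    · exact Filter.Eventually.of_forall fun v h => absurd h hf
    by_cases hin : T.InWedge w f' (T.flagLift w f s.1)
    swap
    · filter_upwards [(isClosed_inWedge f').isOpen_compl.mem_nhds hin] with v hv _ h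
      exact absurd h hv
    obtain ⟨s', hs', h1, C, hC, h2⟩ := R.exists_flagLift hw hs hf hin
    have hpos' := R.pos f' s' hs'
    have hV : T.toSpace f'.1 ⁻¹' U ∩ R.carrier f' ∈ 𝓝 s' :=
      Filter.inter_mem ((T.continuous_toSpace f'.1).continuousAt.preimage_mem_nhds (by rwa [h1]))
        ((R.isOpen f').mem_nhds hs')
    have hev := eventually_exists_flagLift hw f' hpos'.1 hpos'.2 hV
    rw [h2] at hev
    have hcont : Continuous fun v : V4 => C • v := continuous_const_smul C
    filter_upwards [hcont.continuousAt.eventually hev] with v hv _ hwedge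
    obtain ⟨s₁, ⟨hs1, hs2⟩, D, hD, h3⟩ := hv (hwedge.smul hC.le)
    refine ⟨_, hs1, ?_⟩
    rw [R.dev_toSpace hw hs2, h3, projMk_smul hD.ne', projMk_smul hC.ne']
  filter_upwards [Filter.eventually_all.mpr key] with v hv
  obtain ⟨f', hf', hw'⟩ := exists_inWedge hw f v
  exact hv f' hf' hw'

theorem FlagRegion.nonempty_space (R : T.FlagRegion) : Nonempty T.Space :=
  ⟨T.toSpace R.base.1 ⟨![1 / 2, 1 / 2, 0, 0], by
    intro i
    fin_cases i <;> norm_num, by simp [Fin.sum_univ_four]; norm_num⟩⟩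

/-- The chart of a region. -/
def FlagRegion.chart (R : T.FlagRegion) (hw : T.IsPositiveSolution w) :
    OpenPartialHomeomorph T.Space RP3 :=
  haveI := R.nonempty_space
  OpenPartialHomeomorph.ofContinuousOpenRestrict
    ((R.injOn_dev hw).toPartialEquiv _ _) (R.continuousOn_dev hw) (by
      rw [isOpenMap_iff_nhds_le]
      intro x
      refine (Filter.le_map fun U hU => ?_)
      obtain ⟨V, hV, hVU⟩ := mem_nhds_subtype _ _ _ |>.mp hU
      refine Filter.mem_of_superset (R.image_dev_mem_nhds hw x.2
        (Filter.inter_mem hV (R.isOpen_domain.mem_nhds x.2))) ?_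
      rintro _ ⟨y, ⟨hy, hyd⟩, rfl⟩
      exact ⟨⟨y, hyd⟩, hVU hy, rfl⟩) R.isOpen_domain

theorem FlagRegion.chart_apply (R : T.FlagRegion) (hw : T.IsPositiveSolution w) (x : T.Space) :
    R.chart hw x = R.dev hw x := rfl

theorem FlagRegion.chart_source (R : T.FlagRegion) (hw : T.IsPositiveSolution w) :
    (R.chart hw).source = R.domain := rfl

theorem FlagRegion.chart_target_subset (R : T.FlagRegion) (hw : T.IsPositiveSolution w) :
    (R.chart hw).target ⊆ modelSpace c := by
  rw [← (R.chart hw).image_source_eq_target, R.chart_source hw]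
  rintro _ ⟨x, hx, rfl⟩
  obtain ⟨f, s, hs, rfl⟩ := R.exists_of_mem hx
  have hpos := R.pos f s hs
  rw [R.chart_apply, R.dev_toSpace hw hs, mk_mem_modelSpace_iff (flagLift_ne_zero hw f hpos.1)]
  exact form_flagLift_neg hw f hpos.1 hpos.2

end IdealTriangulation

/-! ## The geometric structure of a solution -/

/-- The maximal atlas generated by compatible charts. -/
def GXStructure.ofAtlas {G : Subgroup GL4} {X : Set RP3} {M : Type} [TopologicalSpace M]
    (B : Set (OpenPartialHomeomorph M RP3)) (htarget : ∀ φ ∈ B, φ.target ⊆ X)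
    (hcover : ∀ x : M, ∃ φ ∈ B, x ∈ φ.source)
    (hcompat : ∀ φ ∈ B, ∀ ψ ∈ B, ∀ x ∈ φ.source ∩ ψ.source,
      ∃ g ∈ G, ∀ᶠ y in 𝓝 x, ψ y = g • φ y) : GXStructure G X M where
  charts := {φ | φ.target ⊆ X ∧ ∀ ψ ∈ B, ∀ x ∈ φ.source ∩ ψ.source,
    ∃ g ∈ G, ∀ᶠ y in 𝓝 x, ψ y = g • φ y}
  target_subset φ hφ := hφ.1
  covers x := by
    obtain ⟨φ, hφ, hx⟩ := hcover x
    exact ⟨φ, ⟨htarget φ hφ, hcompat φ hφ⟩, hx⟩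
  compatible φ hφ φ' hφ' x hx := by
    obtain ⟨ψ, hψ, hxψ⟩ := hcover x
    obtain ⟨g, hg, h⟩ := hφ.2 ψ hψ x ⟨hx.1, hxψ⟩
    obtain ⟨g', hg', h'⟩ := hφ'.2 ψ hψ x ⟨hx.2, hxψ⟩
    refine ⟨g'⁻¹ * g, G.mul_mem (G.inv_mem hg') hg, ?_⟩
    filter_upwards [h, h'] with y hy hy'
    rw [mul_smul, ← hy, hy', inv_smul_smul]
  maximal φ hφ h := ⟨hφ, fun ψ hψ => h ψ ⟨htarget ψ hψ, hcompat ψ hψ⟩⟩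

theorem projMk_injective_of_smul {g g' : GL4} (h : ∀ p : RP3, g • p = g' • p) {x : V4} (hx : x ≠ 0) :
    ∃ r : ℝ, r ≠ 0 ∧ g • x = r • g' • x := by
  have h1 := h (projMk x)
  rw [smul_projMk g hx, smul_projMk g' hx] at h1
  exact exists_smul_of_projMk_eq ((smul_ne_zero_iff_ne g).mpr hx) ((smul_ne_zero_iff_ne g').mpr hx) h1

theorem smul_eq_self_of_scalar {g : GL4} {r : ℝ} (hr : r ≠ 0) (h : ∀ x : V4, g • x = r • x)
    (p : RP3) : g • p = p := by
  obtain ⟨v, hv, rfl⟩ := exists_projMk_eq p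
  rw [smul_projMk g hv, h, projMk_smul hr]

namespace IdealTriangulation

variable {N : ℕ} {T : IdealTriangulation N} {c : ℝ} {w : Fin N → ShapeAlg c}

theorem isUnit_det_devMatrix (hw : T.IsPositiveSolution w) (f : EdgeFlag N) :
    IsUnit (devMatrix (T.turn w f) (w f.1) f.2.1).det :=
  isUnit_of_norm_pos (norm_det_flagDev_pos hw f)

/-- The developing transformation of a flag as an element of the general linear group. -/
def flagGL (hw : T.IsPositiveSolution w) (f : EdgeFlag N) : GL4 :=
  hermActUnits (Matrix.nonsingInvUnit _ (isUnit_det_devMatrix hw f))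

theorem flagGL_smul (hw : T.IsPositiveSolution w) (f : EdgeFlag N) (x : V4) :
    flagGL hw f • x = T.flagDev w f x := rfl

theorem flagGL_mem (hw : T.IsPositiveSolution w) (f : EdgeFlag N) :
    flagGL hw f ∈ modelGroup c :=
  hermActUnits_mem (norm_det_flagDev_pos hw f)

theorem tetVertex_ne_zero (hw : T.IsPositiveSolution w) (j : Fin N) (i : Fin 4) :
    tetVertex (w j) i ≠ 0 := by
  intro h
  obtain ⟨k, hk⟩ := exists_ne i
  have := form_tetVertex_neg hw j hk
  rw [h] at this
  simp [form] at this

/-- The vertices of the common face of consecutive developed tetrahedra agree. -/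
theorem FlagRegion.exists_cross (R : T.FlagRegion) (hw : T.IsPositiveSolution w) {f : EdgeFlag N}
    {s : IdealSimplex} (hs : s ∈ R.carrier f) {a : Fin 4} (ha : s.1 a = 0) :
    ∃ σ, s.perm (T.glue f.1 a) ∈ R.carrier (T.adj f.1 a, σ) ∧ ∀ i, i ≠ a → ∃ r : ℝ, r ≠ 0 ∧
      flagGL hw (T.adj f.1 a, σ) • tetVertex (w (T.adj f.1 a)) (T.glue f.1 a i) =
        r • flagGL hw f • tetVertex (w f.1) i := by
  simp only [flagGL_smul]
  obtain ⟨k, rfl⟩ := f.2.1.surjective a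
  have hpos := R.pos f s hs
  have hk : k = 2 ∨ k = 3 := by
    have : k ≠ 0 := by rintro rfl; exact hpos.1.ne' ha
    have : k ≠ 1 := by rintro rfl; exact hpos.2.ne' ha
    omega
  rcases hk with rfl | rfl
  · obtain ⟨l, hl, h⟩ := exists_face_scaling hw f
    exact ⟨(T.flagNext f).2, R.next f s hs ha, fun i hi => ⟨l i, (hl i).ne', h i hi⟩⟩
  · refine ⟨(T.flagNext.symm f).2, R.prev f s hs ha, fun i hi => ?_⟩
    obtain ⟨l, hl, h⟩ := exists_face_scaling hw (T.flagNext.symm f)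
    have h2 : (T.flagNext.symm f).2.1 2 = T.glue f.1 (f.2.1 3) (f.2.1 3) := by
      rw [flagNext_symm_two_three, Equiv.swap_apply_left]
    have h3 := h (T.glue f.1 (f.2.1 3) i) (by rw [h2]; exact (T.glue _ _).injective.ne hi)
    have e1 : T.adj (T.flagNext.symm f).1 ((T.flagNext.symm f).2.1 2) = f.1 := by
      rw [h2]; exact T.adj_adj _ _
    have e2 : T.glue (T.flagNext.symm f).1 ((T.flagNext.symm f).2.1 2) =
        (T.glue f.1 (f.2.1 3))⁻¹ := by
      rw [h2]; exact T.glue_glue _ _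
    have e3 : (T.glue f.1 (f.2.1 3))⁻¹ (T.glue f.1 (f.2.1 3) i) = i := by simp
    rw [e1, e2, e3, Equiv.apply_symm_apply] at h3
    refine ⟨(l (T.glue f.1 (f.2.1 3) i))⁻¹, inv_ne_zero (hl _).ne', ?_⟩
    rw [h3, smul_smul, inv_mul_cancel₀ (hl _).ne', one_smul]
    rfl

/-- The points where two regions are related by a given transformation. -/
def FlagRegion.Related (R R' : T.FlagRegion) (hw : T.IsPositiveSolution w) (g : GL4)
    (p : Fin N × IdealSimplex) : Prop :=
  ∃ σ σ', p.2 ∈ R.carrier (p.1, σ) ∧ p.2 ∈ R'.carrier (p.1, σ') ∧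
    ∀ y : RP3, flagGL hw (p.1, σ') • y = g • flagGL hw (p.1, σ) • y

/-- On the far side of a face, g composed with one flag transformation and the inverse of the other
fixes the three vertices of the face, hence acts trivially by rigidity. So the same g relates the
two charts there. -/
theorem FlagRegion.related_of_faceRel (R R' : T.FlagRegion) (hw : T.IsPositiveSolution w) {g : GL4}
    (hg : g ∈ modelGroup c) (p q : Fin N × IdealSimplex) (hpq : T.FaceRel p q)
    (h : R.Related R' hw g p) : R.Related R' hw g q := by
  obtain ⟨a, h0, rfl⟩ := T.faceRel_iff.mp hpq
  obtain ⟨σ, σ', h1, h2, h3⟩ := h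
  obtain ⟨τ, k1, k2⟩ := R.exists_cross hw h1 h0
  obtain ⟨τ', k1', k2'⟩ := R'.exists_cross hw h2 h0
  refine ⟨τ, τ', k1, k1', fun y => ?_⟩
  set j' := T.adj p.1 a with hj'
  set A := flagGL hw (j', τ) with hA
  set A' := flagGL hw (j', τ') with hA'
  set k := A'⁻¹ * g * A with hk
  have hkm : k ∈ modelGroup c := (modelGroup c).mul_mem ((modelGroup c).mul_mem
    ((modelGroup c).inv_mem (flagGL_mem hw _)) hg) (flagGL_mem hw _)
  obtain ⟨r, hr, hkr⟩ := exists_smul_of_fixes_face (hw.isPositiveShape j') hkm (T.glue p.1 a a)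
    (fun i hi => by
      obtain ⟨i, rfl⟩ := (T.glue p.1 a).surjective i
      have hia : i ≠ a := fun h => hi (by rw [h])
      obtain ⟨r1, hr1, e1⟩ := k2 i hia
      obtain ⟨r2, hr2, e2⟩ := k2' i hia
      obtain ⟨r3, hr3, e3⟩ := projMk_injective_of_smul (g := flagGL hw (p.1, σ'))
        (g' := g * flagGL hw (p.1, σ)) (fun y => by rw [h3, mul_smul])
        (tetVertex_ne_zero hw p.1 i)
      have hsm : ∀ (g : GL4) (r : ℝ) (x : V4), g • r • x = r • g • x :=
        fun g r x => map_smul (g : V4 →ₗ[ℝ] V4) r x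
      have e4 : g • flagGL hw (p.1, σ) • tetVertex (w p.1) i =
          r3⁻¹ • flagGL hw (p.1, σ') • tetVertex (w p.1) i := by
        rw [e3, inv_smul_smul₀ hr3, mul_smul]
      have e5 : flagGL hw (p.1, σ') • tetVertex (w p.1) i =
          r2⁻¹ • A' • tetVertex (w j') (T.glue p.1 a i) := by
        rw [hA', e2, smul_smul, inv_mul_cancel₀ hr2, one_smul]
      refine ⟨r1 * (r3⁻¹ * r2⁻¹), mul_ne_zero hr1 (mul_ne_zero (inv_ne_zero hr3)
        (inv_ne_zero hr2)), ?_⟩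
      rw [hk, mul_smul, mul_smul, hA, e1, hsm, e4, e5, smul_smul, smul_smul, hsm, inv_smul_smul,
        mul_assoc])
  have h4 := smul_eq_self_of_scalar hr hkr y
  rw [hk, mul_smul, mul_smul, inv_smul_eq_iff] at h4
  exact h4.symm

theorem flagLift_eq_smul (hw : T.IsPositiveSolution w) (f : EdgeFlag N) (s : V4) :
    T.flagLift w f s = flagGL hw f • T.tetLift w f.1 s := rfl

theorem tetLift_ne_zero (hw : T.IsPositiveSolution w) (f : EdgeFlag N) {s : IdealSimplex}
    (h0 : 0 < s.1 (f.2.1 0)) : T.tetLift w f.1 s.1 ≠ 0 := by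
  intro h
  exact flagLift_ne_zero hw f h0 (by rw [flagLift, h, map_zero])

theorem FlagRegion.dev_eq (R : T.FlagRegion) (hw : T.IsPositiveSolution w) {f : EdgeFlag N}
    {s : IdealSimplex} (hs : s ∈ R.carrier f) :
    R.dev hw (T.toSpace f.1 s) = flagGL hw f • projMk (T.tetLift w f.1 s.1) := by
  rw [R.dev_toSpace hw hs, flagLift_eq_smul hw,
    smul_projMk _ (tetLift_ne_zero hw f (R.pos f s hs).1)]

/-- The transition is read off in one tetrahedron at x. The points at which it relates the two
regions form a set compatible with the gluing and open in every tetrahedron, so it is the transition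
on a full neighbourhood. -/
theorem FlagRegion.chart_compatible (R R' : T.FlagRegion) (hw : T.IsPositiveSolution w) {x : T.Space}
    (hx : x ∈ R.domain) (hx' : x ∈ R'.domain) :
    ∃ g ∈ modelGroup c, ∀ᶠ y in 𝓝 x, R'.chart hw y = g • R.chart hw y := by
  obtain ⟨j, s, rfl⟩ := T.exists_toSpace_eq x
  obtain ⟨σ, hσ⟩ := hx
  obtain ⟨σ', hσ'⟩ := hx'
  set g := flagGL hw (j, σ') * (flagGL hw (j, σ))⁻¹ with hg
  have hgm : g ∈ modelGroup c := (modelGroup c).mul_mem (flagGL_mem hw _)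
    ((modelGroup c).inv_mem (flagGL_mem hw _))
  set V : Set T.Space := T.quotProp (R.Related R' hw g) (R.related_of_faceRel R' hw hgm) with hV
  have hVo : IsOpen V := by
    rw [isOpen_space_iff]
    intro i
    have e : T.toSpace i ⁻¹' V = ⋃ τ, ⋃ τ', {s | s ∈ R.carrier (i, τ) ∧ s ∈ R'.carrier (i, τ') ∧
        ∀ y : RP3, flagGL hw (i, τ') • y = g • flagGL hw (i, τ) • y} := by
      ext s
      simp only [Set.mem_iUnion]
      rfl
    rw [e]
    exact isOpen_iUnion fun τ => isOpen_iUnion fun τ' =>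
      (R.isOpen _).and ((R'.isOpen _).and isOpen_const)
  refine ⟨g, hgm, Filter.mem_of_superset (hVo.mem_nhds ?_) ?_⟩
  · exact ⟨σ, σ', hσ, hσ', fun y => by rw [hg, mul_smul, inv_smul_smul]⟩
  · intro y hy
    obtain ⟨i, t, rfl⟩ := T.exists_toSpace_eq y
    obtain ⟨τ, τ', h1, h2, h3⟩ := hy
    change R'.chart hw (T.toSpace i t) = g • R.chart hw (T.toSpace i t)
    rw [chart_apply, chart_apply, R'.dev_eq hw (f := (i, τ')) h2, R.dev_eq hw (f := (i, τ)) h1, h3]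

/-- The geometric structure of a solution. -/
def devStructure (hw : T.IsPositiveSolution w) {G : Subgroup GL4} {X : Set RP3}
    (hG : modelGroup c ≤ G) (hX : modelSpace c ⊆ X) : GXStructure G X T.Space :=
  GXStructure.ofAtlas (Set.range fun R : T.FlagRegion => R.chart hw)
    (by rintro _ ⟨R, rfl⟩; exact (R.chart_target_subset hw).trans hX)
    (by
      intro x
      obtain ⟨j, s, rfl⟩ := T.exists_toSpace_eq x
      obtain ⟨R, σ, h⟩ := T.exists_flagRegion j s
      exact ⟨_, ⟨R, rfl⟩, R.toSpace_mem h⟩)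
    (by
      rintro _ ⟨R, rfl⟩ _ ⟨R', rfl⟩ x ⟨hx, hx'⟩
      obtain ⟨g, hg, h⟩ := R.chart_compatible R' hw hx hx'
      exact ⟨g, hG hg, h⟩)

theorem mem_devStructure_charts (hw : T.IsPositiveSolution w) {G : Subgroup GL4} {X : Set RP3}
    (hG : modelGroup c ≤ G) (hX : modelSpace c ⊆ X) {φ : OpenPartialHomeomorph T.Space RP3} :
    φ ∈ (devStructure hw hG hX).charts ↔ φ.target ⊆ X ∧ ∀ R : T.FlagRegion,
      ∀ x ∈ φ.source ∩ R.domain, ∃ g ∈ G, ∀ᶠ y in 𝓝 x, R.chart hw y = g • φ y := by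
  constructor
  · rintro ⟨h1, h2⟩
    exact ⟨h1, fun R x hx => h2 _ ⟨R, rfl⟩ x hx⟩
  · rintro ⟨h1, h2⟩
    refine ⟨h1, ?_⟩
    rintro _ ⟨R, rfl⟩ x hx
    exact h2 R x hx

theorem chart_mem_devStructure (hw : T.IsPositiveSolution w) {G : Subgroup GL4} {X : Set RP3}
    (hG : modelGroup c ≤ G) (hX : modelSpace c ⊆ X) (R : T.FlagRegion) :
    R.chart hw ∈ (devStructure hw hG hX).charts := by
  rw [mem_devStructure_charts]
  refine ⟨(R.chart_target_subset hw).trans hX, fun R' x hx => ?_⟩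
  obtain ⟨g, hg, h⟩ := R.chart_compatible R' hw hx.1 hx.2
  exact ⟨g, hG hg, h⟩

theorem isRealizedAs_devStructure (hw : T.IsPositiveSolution w) {G : Subgroup GL4} {X : Set RP3}
    (hG : modelGroup c ≤ G) (hX : modelSpace c ⊆ X) (j : Fin N) :
    T.IsRealizedAs (devStructure hw hG hX) j (tetVertex (w j)) := by
  have hne : ∀ s, ∑ i, (T.tetHomeo w j s).1 i • tetVertex (w j) i ≠ 0 := by
    intro s h
    obtain ⟨R, σ, hs⟩ := T.exists_flagRegion j s
    refine tetLift_ne_zero hw (j, σ) (R.pos _ s hs).1 ?_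
    rw [tetLift_eq, h, smul_zero]
  -- The developing map with vertices in the position ∞, 0, 1, w; the charts differ from it by the
  -- transformation of a flag.
  refine ⟨T.tetHomeo w j, fun s => projMk (T.tetLift w j s.1), ?_, fun s => ⟨hne s, ?_⟩, ?_⟩
  · intro s a
    exact simplexMap_eq_zero _ s.toStd a
  · simp only
    rw [tetLift_eq, projMk_smul (sum_reweight_idealSimplex_pos _ s).ne', projMk_of_ne (hne s)]
  · intro s φ hφ hs
    obtain ⟨R, σ, hR⟩ := T.exists_flagRegion j s
    obtain ⟨g, hg, h⟩ := ((mem_devStructure_charts hw hG hX).mp hφ).2 R _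
      ⟨hs, R.toSpace_mem (f := (j, σ)) hR⟩
    refine ⟨g⁻¹ * flagGL hw (j, σ), G.mul_mem (G.inv_mem hg) (hG (flagGL_mem hw _)), ?_⟩
    filter_upwards [(T.continuous_toSpace j).continuousAt.eventually h,
      (R.isOpen (j, σ)).mem_nhds hR] with s' h1 h2
    rw [mul_smul, eq_inv_smul_iff, ← h1, R.chart_apply, R.dev_eq hw (f := (j, σ)) h2]

/-- The model structure of a solution. -/
def modelStructure (hw : T.IsPositiveSolution w) : ModelStructure c T.Space :=
  devStructure hw le_rfl subset_rfl

/-- The projective structure of a solution. -/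
def projStructure (hw : T.IsPositiveSolution w) : ProjStructure T.Space :=
  devStructure hw (modelGroup_le_GL4pos c) (Set.subset_univ _)

theorem isTriangulatedWithShapes_modelStructure (hw : T.IsPositiveSolution w) :
    T.IsTriangulatedWithShapes (modelStructure hw) w := fun j =>
  ⟨tetVertex (w j), isIdealTetrahedron_tetVertex (hw.isPositiveShape j),
    isPositivelyOriented_tetVertex (hw.isPositiveShape j).2.2, hasShape_tetVertex (w j),
    isRealizedAs_devStructure hw _ _ j⟩

theorem isPositivelyRealized_projStructure (hw : T.IsPositiveSolution w) :
    T.IsPositivelyRealized (projStructure hw) := fun j =>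
  ⟨tetVertex (w j), isPositivelyOriented_tetVertex (hw.isPositiveShape j).2.2,
    isRealizedAs_devStructure hw _ _ j⟩

/-- The charts of regions generate both maximal atlases, so it is enough to compare D on them;
transition maps are conjugated by D and remain orientation preserving. -/
theorem isConjugate_of_chart_eq {c' : ℝ} {w' : Fin N → ShapeAlg c'} (hw : T.IsPositiveSolution w)
    (hw' : T.IsPositiveSolution w') {D : GL4} (hD : D ∈ GL4pos)
    (h : ∀ (R : T.FlagRegion), ∀ x ∈ R.domain, R.chart hw' x = D • R.chart hw x) :
    IsConjugate (projStructure hw') (modelStructure hw) := by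
  refine ⟨D, hD, fun φ hφ => ⟨φ.transHomeomorph (projHomeo D), ?_, rfl, fun y _ => rfl⟩⟩
  rw [projStructure, mem_devStructure_charts]
  refine ⟨Set.subset_univ _, fun R x hx => ?_⟩
  obtain ⟨g, hg, hgφ⟩ := ((mem_devStructure_charts hw _ _).mp hφ).2 R x hx
  refine ⟨D * g * D⁻¹, GL4pos.mul_mem (GL4pos.mul_mem hD (modelGroup_le_GL4pos c hg))
    (GL4pos.inv_mem hD), ?_⟩
  filter_upwards [hgφ, R.isOpen_domain.mem_nhds hx.2] with y hy hyR
  change R.chart hw' y = (D * g * D⁻¹) • D • φ y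
  rw [h R y hyR, hy, mul_smul, mul_smul, inv_smul_smul]

end IdealTriangulation

/-! ## Rescaling the algebra -/

theorem map_ringInverse {R S : Type} [CommRing R] [CommRing S] (φ : R →+* S) {a : R}
    (ha : IsUnit a) : φ (Ring.inverse a) = Ring.inverse (φ a) := by
  obtain ⟨u, rfl⟩ := ha
  rw [Ring.inverse_unit]
  exact (Ring.inverse_unit (Units.map (φ : R →* S) u)).symm

theorem map_edgeShape {R S : Type} [CommRing R] [CommRing S] (φ : R →+* S) {w : R} (hw : IsUnit w)
    (hw' : IsUnit (1 - w)) (s : Finset (Fin 4)) : φ (edgeShape w s) = edgeShape (φ w) s := by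
  unfold edgeShape
  split_ifs
  · rfl
  · rw [map_ringInverse φ hw', map_sub, map_one]
  · rw [map_mul, map_ringInverse φ hw, map_sub, map_one]

theorem map_flagShape {R S : Type} [CommRing R] [CommRing S] (φ : R →+* S) {w : R} (hw : IsUnit w)
    (hw' : IsUnit (1 - w)) (σ : Equiv.Perm (Fin 4)) : φ (flagShape w σ) = flagShape (φ w) σ :=
  map_edgeShape φ hw hw' _

section Rescaling

variable {c c' t : ℝ}

/-- The isomorphism of algebras that takes `κ` to `t κ'`. -/
def scaleHom (h : c = t ^ 2 * c') : ShapeAlg c →+* ShapeAlg c' where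
  toFun a := ⟨a.re, t * a.im⟩
  map_one' := by ext <;> simp [QuadraticAlgebra.re_one, QuadraticAlgebra.im_one]
  map_mul' a b := by
    ext
    · simp only [QuadraticAlgebra.re_mul, h]; ring
    · simp only [QuadraticAlgebra.im_mul]; ring
  map_zero' := by ext <;> simp
  map_add' a b := by ext <;> simp [mul_add]

theorem scaleHom_apply (h : c = t ^ 2 * c') (a : ShapeAlg c) : scaleHom h a = ⟨a.re, t * a.im⟩ := rfl

theorem scaleHom_star (h : c = t ^ 2 * c') (a : ShapeAlg c) :
    scaleHom h (star a) = star (scaleHom h a) := by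
  ext <;> simp [scaleHom_apply]

theorem norm_scaleHom (h : c = t ^ 2 * c') (a : ShapeAlg c) :
    QuadraticAlgebra.norm (scaleHom h a) = QuadraticAlgebra.norm a := by
  simp only [QuadraticAlgebra.norm_def, scaleHom_apply, h]
  ring

/-- The linear map that multiplies the last coordinate by `t`. -/
def scaleVec (t : ℝ) : V4 →ₗ[ℝ] V4 := Matrix.toLin' (Matrix.diagonal ![1, 1, 1, t])

theorem scaleVec_apply (t : ℝ) (x : V4) : scaleVec t x = ![x 0, x 1, x 2, t * x 3] := by
  ext i
  rw [scaleVec, Matrix.toLin'_apply, Matrix.mulVec_diagonal]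
  fin_cases i <;> simp

/-- `scaleVec` as an element of the general linear group. -/
def scaleGL (t : ℝ) (ht : 0 < t) : GL4 where
  val := scaleVec t
  inv := scaleVec t⁻¹
  val_inv := by
    refine LinearMap.ext fun x => ?_
    rw [Module.End.mul_apply, scaleVec_apply, scaleVec_apply]
    ext i
    fin_cases i <;> simp [ht.ne']
  inv_val := by
    refine LinearMap.ext fun x => ?_
    rw [Module.End.mul_apply, scaleVec_apply, scaleVec_apply]
    ext i
    fin_cases i <;> simp [ht.ne']

theorem scaleGL_smul (ht : 0 < t) (x : V4) : scaleGL t ht • x = scaleVec t x := rfl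

theorem scaleGL_mem (ht : 0 < t) : scaleGL t ht ∈ GL4pos := by
  change 0 < LinearMap.det (scaleVec t)
  rw [scaleVec, LinearMap.det_toLin', Matrix.det_diagonal]
  simpa [Fin.prod_univ_four] using ht

theorem herm_scaleVec (h : c = t ^ 2 * c') (x : V4) :
    herm c' (scaleVec t x) = (herm c x).map (scaleHom h) := by
  rw [scaleVec_apply]
  ext i k <;> fin_cases i <;> fin_cases k <;> simp [herm, scaleHom_apply]

theorem hermAct_scaleVec (h : c = t ^ 2 * c') (A : Matrix (Fin 2) (Fin 2) (ShapeAlg c)) (x : V4) :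
    hermAct (A.map (scaleHom h)) (scaleVec t x) = scaleVec t (hermAct A x) := by
  apply herm_injective c'
  rw [herm_hermAct, herm_scaleVec h, herm_scaleVec h, herm_hermAct, Matrix.map_mul, Matrix.map_mul,
    Matrix.conjTranspose_map _ (fun a => scaleHom_star h a)]

theorem form_scaleVec (h : c = t ^ 2 * c') (x y : V4) :
    form c' (scaleVec t x) (scaleVec t y) = form c x y := by
  rw [scaleVec_apply, scaleVec_apply]
  simp only [form, Matrix.cons_val, h]
  ring

theorem nullVec_scaleHom (h : c = t ^ 2 * c') (p : Fin 2 → ShapeAlg c) :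
    nullVec (fun i => scaleHom h (p i)) = scaleVec t (nullVec p) := by
  apply herm_injective c'
  rw [herm_scaleVec h, herm_nullVec, herm_nullVec]
  ext i k <;> simp [Matrix.vecMulVec_apply, ← scaleHom_star, ← map_mul]

theorem idealPoint_scaleHom (h : c = t ^ 2 * c') (w : ShapeAlg c) (i : Fin 4) :
    idealPoint (scaleHom h w) i = fun k => scaleHom h (idealPoint w i k) := by
  funext k
  fin_cases i <;> fin_cases k <;> simp [idealPoint]

theorem tetVertex_scaleHom (h : c = t ^ 2 * c') (w : ShapeAlg c) (i : Fin 4) :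
    tetVertex (scaleHom h w) i = scaleVec t (tetVertex w i) := by
  rw [tetVertex, idealPoint_scaleHom, nullVec_scaleHom, tetVertex]

theorem devMatrix_scaleHom (h : c = t ^ 2 * c') (u w : ShapeAlg c) (σ : Equiv.Perm (Fin 4)) :
    devMatrix (scaleHom h u) (scaleHom h w) σ = (devMatrix u w σ).map (scaleHom h) := by
  rw [devMatrix, devMatrix, Matrix.map_mul]
  congr 1
  · ext i k <;> fin_cases i <;> fin_cases k <;> simp [Matrix.diagonal]
  · simp only [flagMatrix, idealPoint_scaleHom, pairDet]
    refine Matrix.ext fun i k => ?_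
    fin_cases i <;> fin_cases k <;> simp

/-- The factor √(-c) in the angle absorbs the rescaling, since √(-c) = t √(-c'); the real part does
not change. -/
theorem dihedralAngle_scaleHom (h : c = t ^ 2 * c') (ht : 0 < t) (a : ShapeAlg c) :
    dihedralAngle (scaleHom h a) = dihedralAngle a := by
  have hc : c' < 0 ↔ c < 0 := by
    rw [h]
    exact ⟨fun h => mul_neg_of_pos_of_neg (by positivity) h,
      fun h => neg_of_mul_neg_right h (by positivity)⟩
  have hre : (scaleHom h a).re = a.re := rfl
  have him : (scaleHom h a).im = t * a.im := rfl
  unfold dihedralAngle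
  refine if_congr hc ?_ (if_congr (by rw [hre]) rfl rfl)
  have e : √(-c) = t * √(-c') := by
    rw [h, ← mul_neg, Real.sqrt_mul (by positivity), Real.sqrt_sq ht.le]
  rw [e, hre, him]
  congr 2
  ring

end Rescaling

/-! ### Solutions and their structures under rescaling -/

namespace IdealTriangulation

variable {N : ℕ} {T : IdealTriangulation N} {c c' t : ℝ} {w : Fin N → ShapeAlg c}

theorem IsPositiveSolution.scale (hw : T.IsPositiveSolution w) (h : c = t ^ 2 * c') (ht : 0 < t) :
    T.IsPositiveSolution fun j => scaleHom h (w j) := by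
  have hu : ∀ j, IsUnit (w j) := fun j => isUnit_of_norm_pos (hw.isPositiveShape j).1
  have hu' : ∀ j, IsUnit (1 - w j) := fun j => isUnit_of_norm_pos (hw.isPositiveShape j).2.1
  refine ⟨fun j => ⟨?_, ?_, ?_⟩, fun e => ⟨?_, ?_⟩⟩
  · rw [norm_scaleHom]
    exact (hw.isPositiveShape j).1
  · rw [← map_one (scaleHom h), ← map_sub, norm_scaleHom]
    exact (hw.isPositiveShape j).2.1
  · exact mul_pos ht (hw.isPositiveShape j).2.2
  · rw [← map_one (scaleHom h), ← (hw.2 e).1, map_prod]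
    exact Finset.prod_congr rfl fun x _ => (map_edgeShape _ (hu _) (hu' _) _).symm
  · rw [← (hw.2 e).2]
    refine Finset.sum_congr rfl fun x _ => ?_
    rw [← map_edgeShape _ (hu _) (hu' _), dihedralAngle_scaleHom h ht]

theorem turn_scaleHom (hw : T.IsPositiveSolution w) (h : c = t ^ 2 * c') (f : EdgeFlag N) :
    T.turn (fun j => scaleHom h (w j)) f = scaleHom h (T.turn w f) := by
  rw [turn, turn, partialTurn, partialTurn, map_prod]
  exact Finset.prod_congr rfl fun i _ => (map_flagShape _
    (isUnit_of_norm_pos (hw.isPositiveShape _).1) (isUnit_of_norm_pos (hw.isPositiveShape _).2.1)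
    _).symm

/-- Edge ratios involve only norms and inner products. The reparametrizations are therefore the
same, and corresponding charts differ by one linear map on the nose. -/
theorem edgeRatio_scaleHom (hw : T.IsPositiveSolution w) (h : c = t ^ 2 * c') (j : Fin N) :
    T.edgeRatio (fun j => scaleHom h (w j)) j = T.edgeRatio w j := by
  have e : ∀ f, T.flagRatio (fun j => scaleHom h (w j)) f = T.flagRatio w f := by
    intro f
    simp only [flagRatio, tetVertex_scaleHom, form_scaleVec h, turn_scaleHom hw h, norm_scaleHom]
  funext k i
  simp only [edgeRatio, e]

theorem flagLift_scaleHom (hw : T.IsPositiveSolution w) (h : c = t ^ 2 * c') (f : EdgeFlag N)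
    (s : V4) : T.flagLift (fun j => scaleHom h (w j)) f s = scaleVec t (T.flagLift w f s) := by
  have e : T.tetLift (fun j => scaleHom h (w j)) f.1 s = scaleVec t (T.tetLift w f.1 s) := by
    rw [tetLift, tetLift, map_sum, edgeRatio_scaleHom hw]
    exact Finset.sum_congr rfl fun i _ => by rw [map_smul, tetVertex_scaleHom]
  rw [flagLift, flagLift, e, flagDev, flagDev, turn_scaleHom hw, devMatrix_scaleHom,
    hermAct_scaleVec]

theorem chart_scaleHom (hw : T.IsPositiveSolution w) (h : c = t ^ 2 * c') (ht : 0 < t)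
    (hw' : T.IsPositiveSolution fun j => scaleHom h (w j)) (R : T.FlagRegion) {x : T.Space}
    (hx : x ∈ R.domain) : R.chart hw' x = scaleGL t ht • R.chart hw x := by
  obtain ⟨f, s, hs, rfl⟩ := R.exists_of_mem hx
  rw [R.chart_apply, R.chart_apply, R.dev_toSpace hw' hs, R.dev_toSpace hw hs, flagLift_scaleHom hw,
    smul_projMk _ (flagLift_ne_zero hw f (R.pos f s hs).1), scaleGL_smul]

theorem isConjugate_scale (hw : T.IsPositiveSolution w) (h : c = t ^ 2 * c') (ht : 0 < t)
    (hw' : T.IsPositiveSolution fun j => scaleHom h (w j)) :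
    IsConjugate (projStructure hw') (modelStructure hw) :=
  isConjugate_of_chart_eq hw hw' (scaleGL_mem ht) fun R _ hx => chart_scaleHom hw h ht hw' R hx

theorem isConjugate_modelStructure (hw : T.IsPositiveSolution w) :
    IsConjugate (projStructure hw) (modelStructure hw) :=
  isConjugate_of_chart_eq hw hw (D := 1) GL4pos.one_mem fun _ _ _ => (one_smul _ _).symm

end IdealTriangulation

/-! ## Continuous families of solutions -/

section Families

variable {Y : Type} [TopologicalSpace Y] {C : Y → ℝ}

/-- A family of elements of the algebras `ℝ + ℝκ`, `κ² = C y`, with continuous coordinates. -/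
structure ContinuousFamily (x : ∀ y, ShapeAlg (C y)) : Prop where
  re : Continuous fun y => (x y).re
  im : Continuous fun y => (x y).im

namespace ContinuousFamily

variable {x x' : ∀ y, ShapeAlg (C y)}

theorem mul (hC : Continuous C) (h : ContinuousFamily x) (h' : ContinuousFamily x') :
    ContinuousFamily fun y => x y * x' y := by
  obtain ⟨h1, h2⟩ := h
  obtain ⟨h3, h4⟩ := h'
  constructor
  · simp only [QuadraticAlgebra.re_mul]; fun_prop
  · simp only [QuadraticAlgebra.im_mul]; fun_prop

theorem add (h : ContinuousFamily x) (h' : ContinuousFamily x') :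
    ContinuousFamily fun y => x y + x' y :=
  ⟨h.re.add h'.re, h.im.add h'.im⟩

theorem neg (h : ContinuousFamily x) : ContinuousFamily fun y => -x y :=
  ⟨h.re.neg, h.im.neg⟩

theorem sub (h : ContinuousFamily x) (h' : ContinuousFamily x') :
    ContinuousFamily fun y => x y - x' y :=
  ⟨h.re.sub h'.re, h.im.sub h'.im⟩

theorem zero : ContinuousFamily fun y => (0 : ShapeAlg (C y)) :=
  ⟨continuous_const (y := (0 : ℝ)), continuous_const (y := (0 : ℝ))⟩

theorem one : ContinuousFamily fun y => (1 : ShapeAlg (C y)) := by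
  constructor
  · simp only [QuadraticAlgebra.re_one]; exact continuous_const
  · simp only [QuadraticAlgebra.im_one]; exact continuous_const

theorem star (h : ContinuousFamily x) : ContinuousFamily fun y => Star.star (x y) := by
  obtain ⟨h1, h2⟩ := h
  constructor
  · simp only [QuadraticAlgebra.re_star]; fun_prop
  · simp only [QuadraticAlgebra.im_star]; fun_prop

theorem norm (hC : Continuous C) (h : ContinuousFamily x) :
    Continuous fun y => QuadraticAlgebra.norm (x y) := by
  obtain ⟨h1, h2⟩ := h
  simp only [QuadraticAlgebra.norm_def]
  fun_prop

theorem inverse (hC : Continuous C) (h : ContinuousFamily x)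
    (hx : ∀ y, 0 < QuadraticAlgebra.norm (x y)) : ContinuousFamily fun y => Ring.inverse (x y) := by
  have hn := h.norm hC
  have hs := h.star
  have hi : Continuous fun y => (QuadraticAlgebra.norm (x y))⁻¹ := hn.inv₀ fun y => (hx y).ne'
  simp only [norm_mul_inverse (hx _)]
  exact ⟨hi.mul hs.re, hi.mul hs.im⟩

theorem prod (hC : Continuous C) {ι : Type} (S : Finset ι) {x : ι → ∀ y, ShapeAlg (C y)}
    (h : ∀ i, ContinuousFamily (x i)) : ContinuousFamily fun y => ∏ i ∈ S, x i y := by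
  classical
  induction S using Finset.induction_on with
  | empty => simpa using one
  | insert a S ha ih =>
    simp only [Finset.prod_insert ha]
    exact (h a).mul hC ih

theorem edgeShape (hC : Continuous C) (h : ContinuousFamily x) (hx : ∀ y, IsPositiveShape (x y))
    (s : Finset (Fin 4)) : ContinuousFamily fun y => _root_.edgeShape (x y) s := by
  unfold _root_.edgeShape
  split_ifs
  · exact h
  · exact (one.sub h).inverse hC fun y => (hx y).2.1
  · exact (h.sub one).mul hC (h.inverse hC fun y => (hx y).1)

end ContinuousFamily

theorem continuous_hermAct (hC : Continuous C) {A : ∀ y, Matrix (Fin 2) (Fin 2) (ShapeAlg (C y))}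
    (hA : ∀ i k, ContinuousFamily fun y => A y i k) {v : Y → V4} (hv : Continuous v) :
    Continuous fun y => hermAct (A y) (v y) := by
  have hv' : ∀ i, Continuous fun y => v y i := fun i => (continuous_apply i).comp hv
  have hH : ∀ i k, ContinuousFamily fun y => herm (C y) (v y) i k := by
    intro i k
    have := hv' 0
    have := hv' 1
    have := hv' 2
    have := hv' 3
    fin_cases i <;> fin_cases k <;> constructor <;> simp [herm] <;> fun_prop
  have hM : ∀ i k, ContinuousFamily fun y => (A y * herm (C y) (v y) * (A y)ᴴ) i k := by
    intro i k
    simp only [Matrix.mul_apply, Fin.sum_univ_two, Matrix.conjTranspose_apply]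
    exact (((hA i 0).mul hC (hH 0 0)).add ((hA i 1).mul hC (hH 1 0))).mul hC (hA k 0).star |>.add
      ((((hA i 0).mul hC (hH 0 1)).add ((hA i 1).mul hC (hH 1 1))).mul hC (hA k 1).star)
  refine continuous_pi fun i => ?_
  change Continuous fun y => hermCoord (C y) (A y * herm (C y) (v y) * (A y)ᴴ) i
  fin_cases i
  · exact ((hM 0 0).re.add (hM 1 1).re).div_const 2
  · exact ((hM 0 0).re.sub (hM 1 1).re).div_const 2
  · exact (hM 1 0).re
  · exact (hM 1 0).im

theorem continuous_nullVec (hC : Continuous C) {p : ∀ y, Fin 2 → ShapeAlg (C y)}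
    (hp : ∀ i, ContinuousFamily fun y => p y i) : Continuous fun y => nullVec (p y) := by
  have hM : ∀ i k, ContinuousFamily fun y => Matrix.vecMulVec (p y) (Star.star (p y)) i k := by
    intro i k
    simp only [Matrix.vecMulVec_apply, Pi.star_apply]
    exact (hp i).mul hC (hp k).star
  refine continuous_pi fun i => ?_
  change Continuous fun y => hermCoord (C y) (Matrix.vecMulVec (p y) (Star.star (p y))) i
  fin_cases i
  · exact ((hM 0 0).re.add (hM 1 1).re).div_const 2
  · exact ((hM 0 0).re.sub (hM 1 1).re).div_const 2
  · exact (hM 1 0).re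
  · exact (hM 1 0).im

theorem ContinuousFamily.idealPoint {x : ∀ y, ShapeAlg (C y)} (h : ContinuousFamily x) (i : Fin 4)
    (k : Fin 2) : ContinuousFamily fun y => _root_.idealPoint (x y) i k := by
  fin_cases i <;> fin_cases k
  · exact ContinuousFamily.one
  · exact ContinuousFamily.zero
  · exact ContinuousFamily.zero
  · exact ContinuousFamily.one
  · exact ContinuousFamily.one
  · exact ContinuousFamily.one
  · exact h
  · exact ContinuousFamily.one

theorem continuous_form (hC : Continuous C) {v v' : Y → V4} (hv : Continuous v)
    (hv' : Continuous v') : Continuous fun y => form (C y) (v y) (v' y) := by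
  unfold form
  fun_prop

theorem ContinuousFamily.devMatrix (hC : Continuous C) {u x : ∀ y, ShapeAlg (C y)}
    (hu : ContinuousFamily u) (hx : ContinuousFamily x) (σ : Equiv.Perm (Fin 4)) (i k : Fin 2) :
    ContinuousFamily fun y => _root_.devMatrix (u y) (x y) σ i k := by
  have hd : ∀ a b, ContinuousFamily fun y =>
      pairDet (_root_.idealPoint (x y) (σ a)) (_root_.idealPoint (x y) (σ b)) := fun a b =>
    ((hx.idealPoint _ 0).mul hC (hx.idealPoint _ 1)).sub
      ((hx.idealPoint _ 1).mul hC (hx.idealPoint _ 0))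
  have hf : ∀ i k, ContinuousFamily fun y => flagMatrix (x y) σ i k := by
    intro i k
    fin_cases i <;> fin_cases k
    · exact (hx.idealPoint _ 1).mul hC (hd 2 0)
    · exact ((hx.idealPoint _ 0).mul hC (hd 2 0)).neg
    · exact (hx.idealPoint _ 1).mul hC (hd 2 1)
    · exact ((hx.idealPoint _ 0).mul hC (hd 2 1)).neg
  simp only [_root_.devMatrix, Matrix.diagonal_mul]
  refine ContinuousFamily.mul hC ?_ (hf i k)
  fin_cases i
  · exact hu
  · exact ContinuousFamily.one

end Families

/-! ### Joint continuity of the developing maps -/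

namespace IdealTriangulation

variable {N : ℕ} {T : IdealTriangulation N} {Y : Type} [TopologicalSpace Y] {C : Y → ℝ}
  {w : ∀ y, Fin N → ShapeAlg (C y)}

theorem continuousFamily_turn (hC : Continuous C) (hw : ∀ y, T.IsPositiveSolution (w y))
    (hcont : ∀ j, ContinuousFamily fun y => w y j) (f : EdgeFlag N) :
    ContinuousFamily fun y => T.turn (w y) f := by
  unfold turn partialTurn
  exact ContinuousFamily.prod hC _ fun i =>
    (hcont _).edgeShape hC (fun y => (hw y).isPositiveShape _) _

theorem continuous_tetVertex (hC : Continuous C)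
    (hcont : ∀ j, ContinuousFamily fun y => w y j) (j : Fin N) (i : Fin 4) :
    Continuous fun y => tetVertex (w y j) i :=
  continuous_nullVec hC fun k => (hcont j).idealPoint i k

theorem continuous_edgeRatio (hC : Continuous C) (hw : ∀ y, T.IsPositiveSolution (w y))
    (hcont : ∀ j, ContinuousFamily fun y => w y j) (j : Fin N) (k i : Fin 4) :
    Continuous fun y => T.edgeRatio (w y) j k i := by
  have hf : ∀ f, Continuous fun y => T.flagRatio (w y) f := by
    intro f
    have hZ : ∀ a b : Fin 4, a ≠ b → Continuous fun y => Real.log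
        (-form (C y) (tetVertex (w y f.1) (f.2.1 a)) (tetVertex (w y f.1) (f.2.1 b))) := by
      intro a b hab
      refine Continuous.log (continuous_form hC (continuous_tetVertex hC hcont _ _)
        (continuous_tetVertex hC hcont _ _)).neg fun y => ?_
      exact (form_tetVertex_neg (hw y) f.1 (f.2.1.injective.ne hab)).ne'
    unfold flagRatio
    refine ((hZ 0 2 (by decide)).sub (hZ 1 2 (by decide))).add (Continuous.log ?_ fun y => ?_)
    · exact (continuousFamily_turn hC hw hcont f).norm hC
    · exact (norm_turn_pos (hw y) f).ne'
  unfold edgeRatio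
  split_ifs
  · exact continuous_const
  · exact ((hf _).sub (hf _)).div_const 2

theorem continuous_flagLift_family (hC : Continuous C) (hw : ∀ y, T.IsPositiveSolution (w y))
    (hcont : ∀ j, ContinuousFamily fun y => w y j) (f : EdgeFlag N) :
    Continuous fun q : Y × IdealSimplex => T.flagLift (w q.1) f q.2.1 := by
  have hC' : Continuous fun q : Y × IdealSimplex => C q.1 := hC.comp continuous_fst
  have hs : ∀ i, Continuous fun q : Y × IdealSimplex => q.2.1 i := fun i =>
    (continuous_coord i).comp continuous_snd
  unfold flagLift flagDev
  refine continuous_hermAct (C := fun q : Y × IdealSimplex => C q.1) hC' (fun i k => ?_) ?_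
  · have hd := ContinuousFamily.devMatrix hC (continuousFamily_turn hC hw hcont f) (hcont f.1)
      f.2.1 i k
    exact ⟨hd.re.comp continuous_fst, hd.im.comp continuous_fst⟩
  · unfold tetLift reweight edgeExponent
    refine continuous_finsetSum _ fun i _ => ?_
    have hZ : Continuous fun q : Y × IdealSimplex => tetVertex (w q.1 f.1) i :=
      (continuous_tetVertex hC hcont f.1 i).comp continuous_fst
    have hcoef : Continuous fun q : Y × IdealSimplex =>
        q.2.1 i * Real.exp (∑ k, q.2.1 k * T.edgeRatio (w q.1) f.1 k i) :=
      (hs i).mul (Real.continuous_exp.comp (continuous_finsetSum _ fun k _ => (hs k).mul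
        ((continuous_edgeRatio hC hw hcont f.1 k i).comp continuous_fst)))
    exact hcoef.smul hZ

theorem isQuotientMap_toSpace (T : IdealTriangulation N) :
    Topology.IsQuotientMap fun p : Fin N × IdealSimplex => T.toSpace p.1 p.2 :=
  isQuotientMap_quot_mk (r := T.FaceRel)

theorem FlagRegion.continuousOn_projMk_flagLift (hC : Continuous C)
    (hw : ∀ y, T.IsPositiveSolution (w y)) (hcont : ∀ j, ContinuousFamily fun y => w y j)
    (R : T.FlagRegion) (f : EdgeFlag N) :
    ContinuousOn (fun q : Y × IdealSimplex => projMk (T.flagLift (w q.1) f q.2.1))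
      (Prod.snd ⁻¹' R.carrier f) := by
  refine continuousOn_projMk.comp (continuous_flagLift_family hC hw hcont f).continuousOn ?_
  intro q hq
  exact flagLift_ne_zero (hw q.1) f (R.pos _ _ hq).1

theorem FlagRegion.continuous_dev_toSpace (hC : Continuous C)
    (hw : ∀ y, T.IsPositiveSolution (w y)) (hcont : ∀ j, ContinuousFamily fun y => w y j)
    (R : T.FlagRegion) : ContinuousOn (fun q : Y × (Fin N × IdealSimplex) =>
      R.dev (hw q.1) (T.toSpace q.2.1 q.2.2)) {q | R.Over q.2} := by
  intro q hq
  refine ContinuousAt.continuousWithinAt ?_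
  obtain ⟨y, j, s⟩ := q
  obtain ⟨σ, hσ⟩ := hq
  have hsrc : IsOpen (Prod.snd ⁻¹' R.carrier (j, σ) : Set (Y × IdealSimplex)) :=
    (R.isOpen _).preimage continuous_snd
  have h1 := (R.continuousOn_projMk_flagLift hC hw hcont (j, σ)).continuousAt
    (hsrc.mem_nhds (show (y, s) ∈ _ from hσ))
  have hproj : Continuous fun p : Y × (Fin N × IdealSimplex) => (p.1, p.2.2) := by fun_prop
  refine (ContinuousAt.comp (f := fun p : Y × (Fin N × IdealSimplex) => (p.1, p.2.2))
    (x := (y, j, s)) h1 hproj.continuousAt).congr ?_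
  have hopen : IsOpen {p : Y × (Fin N × IdealSimplex) |
      p.2.1 = j ∧ p.2.2 ∈ R.carrier (j, σ)} := by
    refine IsOpen.and ?_ ?_
    · exact (isOpen_discrete {j}).preimage (continuous_fst.comp continuous_snd)
    · exact (R.isOpen (j, σ)).preimage (continuous_snd.comp continuous_snd)
  filter_upwards [hopen.mem_nhds ⟨rfl, hσ⟩] with p hp
  obtain ⟨y', j', s'⟩ := p
  obtain ⟨hj, hs'⟩ := hp
  simp only at hj hs'
  subst hj
  exact (R.dev_toSpace (hw y') (f := (j', σ)) hs').symm

/-- Joint continuity is checked on the tetrahedra. It descends because the product of a quotient map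
with a locally compact space is a quotient map. -/
theorem FlagRegion.continuous_dev_family [LocallyCompactSpace Y] (hC : Continuous C)
    (hw : ∀ y, T.IsPositiveSolution (w y)) (hcont : ∀ j, ContinuousFamily fun y => w y j)
    (R : T.FlagRegion) :
    Continuous fun q : Y × R.domain => R.dev (hw q.1) q.2.1 := by
  have hrest := T.isQuotientMap_toSpace.restrictPreimage_isOpen (s := R.domain) R.isOpen_domain
  refine hrest.continuous_lift_prod_right (g := fun q : Y × R.domain => R.dev (hw q.1) q.2.1) ?_
  refine (R.continuous_dev_toSpace hC hw hcont).comp_continuous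
    (f := fun p : Y × ((fun p : Fin N × IdealSimplex => T.toSpace p.1 p.2) ⁻¹' R.domain) =>
      (p.1, p.2.1)) (by fun_prop) fun p => ?_
  exact p.2.2

/-- The projective structures of a continuous family of solutions form a continuous path. -/
theorem isContinuousPath_projStructure {I : Set ℝ} (hI : IsOpen I) {C : I → ℝ} (hC : Continuous C)
    {w : ∀ y, Fin N → ShapeAlg (C y)} (hw : ∀ y, T.IsPositiveSolution (w y))
    (hcont : ∀ j, ContinuousFamily fun y => w y j) {P : ℝ → ProjStructure T.Space}
    (hP : ∀ y : I, P y = projStructure (hw y)) : IsContinuousPath I P := by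
  classical
  intro t₀ ht₀ x₀
  obtain ⟨j, s, rfl⟩ := T.exists_toSpace_eq x₀
  obtain ⟨R, σ, hR⟩ := T.exists_flagRegion j s
  have : LocallyCompactSpace I := hI.locallyCompactSpace
  refine ⟨Set.univ, Filter.univ_mem, R.domain, R.isOpen_domain.mem_nhds ⟨σ, hR⟩,
    fun t => if h : t ∈ I then R.chart (hw ⟨t, h⟩) else R.chart (hw ⟨t₀, ht₀⟩), ?_, ?_⟩
  · rintro t ⟨-, ht⟩
    simp only [dif_pos ht]
    rw [hP ⟨t, ht⟩]
    exact ⟨chart_mem_devStructure _ _ _ R, subset_rfl⟩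
  · rw [Set.univ_inter, continuousOn_iff_continuous_domRestrict]
    have h1 := R.continuous_dev_family hC hw hcont
    have h2 : Continuous fun q : (I ×ˢ R.domain : Set (ℝ × T.Space)) =>
        ((⟨q.1.1, q.2.1⟩, ⟨q.1.2, q.2.2⟩) : I × R.domain) := by
      fun_prop
    refine (h1.comp h2).congr ?_
    rintro ⟨⟨t, x⟩, ht, hx⟩
    change _ = (if h : t ∈ I then R.chart (hw ⟨t, h⟩) else R.chart (hw ⟨t₀, ht₀⟩)) x
    rw [dif_pos ht]
    rfl

end IdealTriangulation

/-! ## The transition from hyperbolic to anti de Sitter structures -/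

section Gluing

/-- Two functions on `[0, δ)` with the same value at `0` glued to a function on `(-δ, δ)`. -/
def glueAtZero (f g : ℝ → ℝ) (y : ℝ) : ℝ := f (max y 0) + g (max (-y) 0) - f 0

theorem glueAtZero_of_nonneg {f g : ℝ → ℝ} (h : f 0 = g 0) {y : ℝ} (hy : 0 ≤ y) :
    glueAtZero f g y = f y := by
  rw [glueAtZero, max_eq_left hy, max_eq_right (neg_nonpos.mpr hy), h]
  ring

theorem glueAtZero_of_nonpos {f g : ℝ → ℝ} {y : ℝ} (hy : y ≤ 0) :
    glueAtZero f g y = g (-y) := by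
  rw [glueAtZero, max_eq_right hy, max_eq_left (neg_nonneg.mpr hy)]
  ring

theorem continuous_glueAtZero {f g : ℝ → ℝ} {δ : ℝ} (hδ : 0 < δ)
    (hf : ContinuousOn f (Set.Ico 0 δ)) (hg : ContinuousOn g (Set.Ico 0 δ)) :
    Continuous fun y : Set.Ioo (-δ) δ => glueAtZero f g y := by
  unfold glueAtZero
  refine ((hf.comp_continuous (f := fun y : Set.Ioo (-δ) δ => max (y : ℝ) 0) (by fun_prop)
    fun y => ?_).add (hg.comp_continuous (f := fun y : Set.Ioo (-δ) δ => max (-(y : ℝ)) 0)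
    (by fun_prop) fun y => ?_)).sub continuous_const
  · exact ⟨le_max_right _ _, max_lt y.2.2 hδ⟩
  · exact ⟨le_max_right _ _, max_lt (by linarith [y.2.1]) hδ⟩

/-- The difference quotient of a function that vanishes at `0`. -/
def quotientAtZero (f : ℝ → ℝ) (v : ℝ) : ℝ → ℝ := Function.update (fun t => t⁻¹ * f t) 0 v

theorem quotientAtZero_of_ne {f : ℝ → ℝ} {v t : ℝ} (ht : t ≠ 0) :
    quotientAtZero f v t = t⁻¹ * f t := Function.update_of_ne ht _ _

theorem quotientAtZero_zero {f : ℝ → ℝ} {v : ℝ} : quotientAtZero f v 0 = v :=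
  Function.update_self _ _ _

/-- The limit at 0 is the one-sided derivative. This is the point at which the initial velocity of a
regeneration is used. -/
theorem continuousOn_quotientAtZero {f : ℝ → ℝ} {v δ : ℝ} (hf : ContinuousOn f (Set.Ico 0 δ))
    (h0 : f 0 = 0) (hd : HasDerivWithinAt f v (Set.Ici 0) 0) :
    ContinuousOn (quotientAtZero f v) (Set.Ico 0 δ) := by
  rw [quotientAtZero, continuousOn_update_iff]
  refine ⟨?_, fun _ => ?_⟩
  · exact ((continuousOn_inv₀).mono fun t ht => ht.2).mul (hf.mono Set.sdiff_subset)
  · rw [hasDerivWithinAt_iff_tendsto_slope] at hd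
    have e : slope f 0 = fun t => t⁻¹ * f t := by
      funext t
      simp [slope, h0]
    rw [e] at hd
    exact hd.mono_left (nhdsWithin_mono _ (Set.sdiff_subset_sdiff_left Set.Ico_subset_Ici_self))

end Gluing

/-- The real part is multiplicative for the dual numbers. -/
def reHom {c : ℝ} (h : c = 0) : ShapeAlg c →+* ℝ where
  toFun a := a.re
  map_one' := QuadraticAlgebra.re_one
  map_mul' a b := by
    simp only [QuadraticAlgebra.re_mul]
    linear_combination (a.im * b.im) * h
  map_zero' := rfl
  map_add' _ _ := rfl

theorem norm_eq_re_sq {c : ℝ} (h : c = 0) (a : ShapeAlg c) : QuadraticAlgebra.norm a = a.re ^ 2 := by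
  subst h
  rw [QuadraticAlgebra.norm_def]
  ring

theorem reHom_apply {c : ℝ} (h : c = 0) (a : ShapeAlg c) : reHom h a = a.re := rfl

/-! ### The family of solutions through the half-pipe limit -/

namespace IdealTriangulation

variable {N : ℕ} {T : IdealTriangulation N}

/-- The transition parameter at y = 0 equals 0 only by computation; a variable c lets the equality
be substituted in the types. -/
theorem exists_halfPipe {c : ℝ} (hc : c = 0) {w : Fin N → ShapeAlg c}
    (hw : T.IsPositiveSolution w) : ∃ (Q : HPStructure T.Space) (w' : Fin N → ShapeAlg 0),
      T.IsTriangulatedWithShapes Q w' ∧ IsConjugate (projStructure hw) Q := by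
  subst hc
  exact ⟨modelStructure hw, w, isTriangulatedWithShapes_modelStructure hw,
    isConjugate_modelStructure hw⟩

theorem isConjugate_of_eq_scale {c c' t : ℝ} {w : Fin N → ShapeAlg c} {w' : Fin N → ShapeAlg c'}
    (hw : T.IsPositiveSolution w) (hw' : T.IsPositiveSolution w') (h : c = t ^ 2 * c') (ht : 0 < t)
    (e : w' = fun j => scaleHom h (w j)) : IsConjugate (projStructure hw') (modelStructure hw) := by
  subst e
  exact isConjugate_scale hw h ht hw'

section Transition

variable (z v : Fin N → ℝ) (ζ : ℝ → Fin N → ShapeAlg (-1)) (ξ : ℝ → Fin N → ShapeAlg 1)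

/-- The square of `κ` in the transition. -/
def transitionParam (y : ℝ) : ℝ := -(y * |y|)

/-- The shape parameters in the transition. -/
def transitionShape (y : ℝ) (j : Fin N) : ShapeAlg (transitionParam y) :=
  ⟨glueAtZero (fun t => (ζ t j).re) (fun t => (ξ t j).re) y,
    glueAtZero (quotientAtZero (fun t => (ζ t j).im) (v j))
      (quotientAtZero (fun t => (ξ t j).im) (v j)) y⟩

theorem continuous_transitionParam : Continuous transitionParam := by
  unfold transitionParam
  fun_prop

/-- In the form required by `scaleHom`: sending i to y⁻¹κ divides the imaginary part by y. -/
theorem transitionParam_pos {y : ℝ} (hy : 0 < y) : -1 = y⁻¹ ^ 2 * transitionParam y := by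
  rw [transitionParam, abs_of_pos hy]
  field_simp

theorem transitionParam_neg {y : ℝ} (hy : y < 0) : 1 = |y|⁻¹ ^ 2 * transitionParam y := by
  rw [transitionParam, abs_of_neg hy]
  have := hy.ne
  field_simp

theorem transitionParam_zero : transitionParam 0 = 0 := by simp [transitionParam]

variable {z v ζ ξ} {δ : ℝ}

theorem transitionShape_re (y : ℝ) (j : Fin N) : (transitionShape v ζ ξ y j).re =
    glueAtZero (fun t => (ζ t j).re) (fun t => (ξ t j).re) y := rfl

theorem transitionShape_im (y : ℝ) (j : Fin N) : (transitionShape v ζ ξ y j).im =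
    glueAtZero (quotientAtZero (fun t => (ζ t j).im) (v j))
      (quotientAtZero (fun t => (ξ t j).im) (v j)) y := rfl

theorem transitionShape_pos (hζ : T.IsRegeneration z v δ ζ) (hξ : T.IsRegeneration z v δ ξ) {y : ℝ}
    (hy : 0 < y) :
    transitionShape v ζ ξ y = fun j => scaleHom (transitionParam_pos hy) (ζ y j) := by
  funext j
  ext
  · rw [transitionShape_re, glueAtZero_of_nonneg _ hy.le]
    · rfl
    · simp only [hζ.start, hξ.start]
  · rw [transitionShape_im, glueAtZero_of_nonneg _ hy.le, quotientAtZero_of_ne hy.ne']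
    · rfl
    · rw [quotientAtZero_zero, quotientAtZero_zero]

theorem transitionShape_neg {y : ℝ} (hy : y < 0) :
    transitionShape v ζ ξ y = fun j => scaleHom (transitionParam_neg hy) (ξ |y| j) := by
  have e : -y = |y| := (abs_of_neg hy).symm
  funext j
  ext
  · rw [transitionShape_re, glueAtZero_of_nonpos hy.le, e]
    rfl
  · rw [transitionShape_im, glueAtZero_of_nonpos hy.le, e,
      quotientAtZero_of_ne (abs_pos.mpr hy.ne).ne']
    rfl

theorem transitionShape_zero_re (hζ : T.IsRegeneration z v δ ζ) (hξ : T.IsRegeneration z v δ ξ)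
    (j : Fin N) : (transitionShape v ζ ξ 0 j).re = z j := by
  rw [transitionShape_re, glueAtZero_of_nonneg _ le_rfl] <;> simp only [hζ.start, hξ.start]

theorem transitionShape_zero_im (j : Fin N) : (transitionShape v ζ ξ 0 j).im = v j := by
  rw [transitionShape_im, glueAtZero_of_nonneg _ le_rfl] <;> simp only [quotientAtZero_zero]

theorem continuousFamily_transitionShape (hδ : 0 < δ) (hζ : T.IsRegeneration z v δ ζ)
    (hξ : T.IsRegeneration z v δ ξ) (j : Fin N) :
    ContinuousFamily fun y : Set.Ioo (-δ) δ => transitionShape v ζ ξ y j where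
  re := continuous_glueAtZero hδ (hζ.continuousOn_re j) (hξ.continuousOn_re j)
  im := continuous_glueAtZero hδ
    (continuousOn_quotientAtZero (hζ.continuousOn_im j) (by rw [hζ.start]) (hζ.hasDeriv_im j))
    (continuousOn_quotientAtZero (hξ.continuousOn_im j) (by rw [hξ.start]) (hξ.hasDeriv_im j))

theorem isPositiveSolution_transitionShape_of_ne (hζ : T.IsRegeneration z v δ ζ)
    (hξ : T.IsRegeneration z v δ ξ) {y : ℝ} (hy : y ∈ Set.Ioo (-δ) δ) (h : y ≠ 0) :
    T.IsPositiveSolution (transitionShape v ζ ξ y) := by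
  rcases h.lt_or_gt with h | h
  · rw [transitionShape_neg h]
    exact (hξ.solution _ ⟨abs_pos.mpr h.ne, abs_lt.mpr hy⟩).scale _ (inv_pos.mpr (abs_pos.mpr h.ne))
  · rw [transitionShape_pos hζ hξ h]
    exact (hζ.solution _ ⟨h, hy.2⟩).scale _ (inv_pos.mpr h)

/-- Over the dual numbers the norm is the square of the real part, so the conditions become z_j ≠ 0,
1 and v_j > 0. -/
theorem isPositiveShape_transitionShape_zero (hζ : T.IsRegeneration z v δ ζ)
    (hξ : T.IsRegeneration z v δ ξ) (hz : z ∈ T.realDeformationVariety) (hv : ∀ j, 0 < v j)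
    (j : Fin N) : IsPositiveShape (transitionShape v ζ ξ 0 j) := by
  have hre := transitionShape_zero_re hζ hξ j
  refine ⟨?_, ?_, (transitionShape_zero_im (ζ := ζ) (ξ := ξ) (v := v) j).symm ▸ hv j⟩
  · rw [norm_eq_re_sq transitionParam_zero, hre]
    exact sq_pos_of_ne_zero (hz.1 j).1
  · rw [norm_eq_re_sq transitionParam_zero, QuadraticAlgebra.re_sub, QuadraticAlgebra.re_one, hre]
    exact sq_pos_of_ne_zero (sub_ne_zero.mpr (hz.1 j).2.symm)

/-- The real part is a ring homomorphism on the dual numbers, so the edge parameters have the real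
edge parameters of z as real parts, and exactly two of these are negative. -/
theorem sum_dihedralAngle_transitionShape_zero (hζ : T.IsRegeneration z v δ ζ)
    (hξ : T.IsRegeneration z v δ ξ) (hz : z ∈ T.realDeformationVariety) (hv : ∀ j, 0 < v j)
    (e : TetEdge N) : ∑ x ∈ T.edgeClass e,
      dihedralAngle (edgeShape (transitionShape v ζ ξ 0 x.1) x.2.1) = 2 * Real.pi := by
  have hs := isPositiveShape_transitionShape_zero hζ hξ hz hv
  have hangle : ∀ x : TetEdge N, dihedralAngle (edgeShape (transitionShape v ζ ξ 0 x.1) x.2.1) =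
      if edgeShape (z x.1) x.2.1 < 0 then Real.pi else 0 := by
    intro x
    have h1 := map_edgeShape (reHom transitionParam_zero) (isUnit_of_norm_pos (hs x.1).1)
      (isUnit_of_norm_pos (hs x.1).2.1) x.2.1
    rw [reHom_apply, reHom_apply, transitionShape_zero_re hζ hξ] at h1
    rw [dihedralAngle, if_neg (by rw [transitionParam_zero]; exact lt_irrefl 0), h1]
  rw [Finset.sum_congr rfl fun x _ => hangle x, ← Finset.sum_filter, Finset.sum_const,
    (hz.2 e).2, nsmul_eq_mul]
  norm_num

/-- At y = 0 the edge products equal 1 as limits from the dense set y ≠ 0, where the family is a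
rescaled solution; the angle condition there comes from the real solution z. -/
theorem isPositiveSolution_transitionShape (hδ : 0 < δ) (hζ : T.IsRegeneration z v δ ζ)
    (hξ : T.IsRegeneration z v δ ξ) (hz : z ∈ T.realDeformationVariety) (hv : ∀ j, 0 < v j)
    (y : Set.Ioo (-δ) δ) : T.IsPositiveSolution (transitionShape v ζ ξ y) := by
  have hs : ∀ (y : Set.Ioo (-δ) δ) j, IsPositiveShape (transitionShape v ζ ξ y j) := by
    intro y j
    by_cases h : (y : ℝ) = 0
    · rw [h]
      exact isPositiveShape_transitionShape_zero hζ hξ hz hv j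
    · exact (isPositiveSolution_transitionShape_of_ne hζ hξ y.2 h).isPositiveShape j
  by_cases h : (y : ℝ) = 0
  swap
  · exact isPositiveSolution_transitionShape_of_ne hζ hξ y.2 h
  refine ⟨hs y, fun e => ⟨?_, ?_⟩⟩
  swap
  · rw [h]
    exact sum_dihedralAngle_transitionShape_zero hζ hξ hz hv e
  have hC : Continuous fun y : Set.Ioo (-δ) δ => transitionParam y :=
    continuous_transitionParam.comp continuous_subtype_val
  have hprod := ContinuousFamily.prod hC (T.edgeClass e) fun x : TetEdge N =>
    (continuousFamily_transitionShape hδ hζ hξ x.1).edgeShape hC (fun y => hs y x.1) x.2.1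
  have hdense : Dense {y : Set.Ioo (-δ) δ | (y : ℝ) ≠ 0} :=
    (dense_compl_singleton (0 : ℝ)).preimage isOpen_Ioo.isOpenEmbedding_subtypeVal.isOpenMap
  have h1 : ∀ y ∈ {y : Set.Ioo (-δ) δ | (y : ℝ) ≠ 0}, ∏ x ∈ T.edgeClass e,
      edgeShape (transitionShape v ζ ξ y x.1) x.2.1 = 1 := fun y hy =>
    ((isPositiveSolution_transitionShape_of_ne hζ hξ y.2 hy).2 e).1
  ext
  · exact congrFun (hprod.re.ext_on hdense continuous_const fun y hy =>
      congrArg QuadraticAlgebra.re (h1 y hy)) y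
  · exact congrFun (hprod.im.ext_on hdense continuous_const fun y hy =>
      congrArg QuadraticAlgebra.im (h1 y hy)) y

/-- The geometric transition of structures that belongs to a pair of regenerations. -/
theorem exists_transition (hδ : 0 < δ) (hζ : T.IsRegeneration z v δ ζ)
    (hξ : T.IsRegeneration z v δ ξ) (hz : z ∈ T.realDeformationVariety) (hv : ∀ j, 0 < v j) :
    ∃ P : ℝ → ProjStructure T.Space,
      IsContinuousPath (Set.Ioo (-δ) δ) P ∧
      (∀ t ∈ Set.Ioo 0 δ, ∃ H : HypStructure T.Space,
        T.IsTriangulatedWithShapes H (ζ t) ∧ IsConjugate (P t) H) ∧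
      (∀ t ∈ Set.Ioo (-δ) 0, ∃ A : AdSStructure T.Space,
        T.IsTriangulatedWithShapes A (ξ |t|) ∧ IsConjugate (P t) A) ∧
      (∃ (Q : HPStructure T.Space) (w : Fin N → ShapeAlg 0),
        T.IsTriangulatedWithShapes Q w ∧ IsConjugate (P 0) Q) ∧
      ∀ t ∈ Set.Ioo (-δ) δ, T.IsPositivelyRealized (P t) := by
  classical
  have hw := isPositiveSolution_transitionShape hδ hζ hξ hz hv
  have h0 : (0 : ℝ) ∈ Set.Ioo (-δ) δ := ⟨neg_lt_zero.mpr hδ, hδ⟩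
  let P : ℝ → ProjStructure T.Space := fun t =>
    if h : t ∈ Set.Ioo (-δ) δ then projStructure (hw ⟨t, h⟩) else projStructure (hw ⟨0, h0⟩)
  have hP : ∀ (t) (h : t ∈ Set.Ioo (-δ) δ), P t = projStructure (hw ⟨t, h⟩) := fun t h => dif_pos h
  refine ⟨P, ?_, fun t ht => ?_, fun t ht => ?_, ?_, fun t ht => ?_⟩
  · exact isContinuousPath_projStructure isOpen_Ioo
      (continuous_transitionParam.comp continuous_subtype_val) hw
      (continuousFamily_transitionShape hδ hζ hξ) fun y => hP y y.2
  · have ht' : t ∈ Set.Ioo (-δ) δ := ⟨by linarith [ht.1], ht.2⟩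
    refine ⟨modelStructure (hζ.solution t ht), isTriangulatedWithShapes_modelStructure _, ?_⟩
    rw [hP t ht']
    exact isConjugate_of_eq_scale _ _ _ (inv_pos.mpr ht.1) (transitionShape_pos hζ hξ ht.1)
  · have ht' : t ∈ Set.Ioo (-δ) δ := ⟨ht.1, by linarith [ht.2]⟩
    have habs : 0 < |t| := abs_pos.mpr ht.2.ne
    refine ⟨modelStructure (hξ.solution |t| ⟨habs, abs_lt.mpr ht'⟩),
      isTriangulatedWithShapes_modelStructure _, ?_⟩
    rw [hP t ht']
    exact isConjugate_of_eq_scale _ _ _ (inv_pos.mpr habs) (transitionShape_neg ht.2)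
  · rw [hP 0 h0]
    exact exists_halfPipe transitionParam_zero _
  · rw [hP t ht]
    exact isPositivelyRealized_projStructure _

end Transition

end IdealTriangulation

/-! ## Analytic curves in the real deformation variety -/

section AnalyticCurves

/-- A real-analytic function extends to a holomorphic function. -/
theorem exists_complexification {f : ℝ → ℝ} (hf : AnalyticAt ℝ f 0) :
    ∃ g : ℂ → ℂ, AnalyticAt ℂ g 0 ∧ ∀ᶠ s : ℝ in 𝓝 0, g s = f s := by
  obtain ⟨p, hp⟩ := hf
  -- The same Taylor coefficients, read as complex numbers; equal norms give a positive radius of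
  -- convergence.
  let q : FormalMultilinearSeries ℂ ℂ ℂ :=
    FormalMultilinearSeries.ofScalars ℂ fun n => (p.coeff n : ℂ)
  have hnorm : ∀ n, ‖q n‖ = ‖p n‖ := fun n => by
    rw [FormalMultilinearSeries.ofScalars_norm, Complex.norm_real, p.norm_apply_eq_norm_coef]
  obtain ⟨r, hr0, hr⟩ := ENNReal.lt_iff_exists_nnreal_btwn.mp hp.radius_pos
  obtain ⟨C, -, hC⟩ := p.norm_mul_pow_le_of_lt_radius hr
  have hq : 0 < q.radius :=
    hr0.trans_le (q.le_radius_of_bound C fun n => by rw [hnorm]; exact hC n)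
  refine ⟨q.sum, (q.hasFPowerSeriesOnBall hq).analyticAt, ?_⟩
  have h0 : Filter.Tendsto (fun s : ℝ => (s : ℂ)) (𝓝 0) (𝓝 0) := by
    simpa using Complex.continuous_ofReal.tendsto 0
  filter_upwards [hasFPowerSeriesAt_iff.mp hp,
    h0.eventually (hasFPowerSeriesAt_iff.mp (q.hasFPowerSeriesOnBall hq).hasFPowerSeriesAt)]
    with s h1 h2
  rw [zero_add] at h1 h2
  have h3 := h1.mapL Complex.ofRealCLM
  have e : ∀ n, q.coeff n = p.coeff n := fun n => FormalMultilinearSeries.coeff_ofScalars ..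
  refine h2.unique (HasSum.congr_fun h3 fun n => ?_)
  simp [e]

/-- Through a smooth point of `D` there is an analytic curve in `D` with a given tangent vector. -/
theorem IsSmoothAt.exists_analyticAt {n : ℕ} {D : Set (Fin n → ℝ)} {z v : Fin n → ℝ}
    (hz : IsSmoothAt D z) (hv : IsTangentVector D z v) :
    ∃ γ : ℝ → Fin n → ℝ, γ 0 = z ∧ (∀ᶠ s in 𝓝 0, γ s ∈ D) ∧ HasDerivAt γ v 0 ∧
      AnalyticAt ℝ γ 0 := by
  obtain ⟨hzD, Φ, W, hzΦ, hΦ, hΦ', hW⟩ := hz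
  obtain ⟨η, hη0, hηD, hηv⟩ := hv
  have hdΦ : DifferentiableAt ℝ Φ z :=
    (hΦ.contDiffAt (Φ.open_source.mem_nhds hzΦ)).differentiableAt (by simp)
  have hcΦ' : ContDiffAt ℝ ω Φ.symm (Φ z) :=
    hΦ'.contDiffAt (Φ.open_target.mem_nhds (Φ.map_source hzΦ))
  have hdΦ' := hcΦ'.differentiableAt (by simp)
  set d := fderiv ℝ Φ z v with hd
  have hηsource : ∀ᶠ t in 𝓝 0, η t ∈ Φ.source :=
    hηv.continuousAt.eventually_mem (Φ.open_source.mem_nhds (hη0.symm ▸ hzΦ))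
  have hΦη : HasDerivAt (fun t => Φ (η t)) d 0 := by
    have h : HasFDerivAt Φ (fderiv ℝ Φ z) (η 0) := hη0.symm ▸ hdΦ.hasFDerivAt
    exact h.comp_hasDerivAt 0 hηv
  have hΦz : Φ z ∈ W := (hW z hzΦ).mp hzD
  -- The difference quotients of the flattened curve lie in W, which is closed.
  have hdW : d ∈ W := by
    refine W.closed_of_finiteDimensional.mem_of_tendsto (hasDerivAt_iff_tendsto_slope.mp hΦη) ?_
    filter_upwards [hηsource.filter_mono nhdsWithin_le_nhds, hηD.filter_mono nhdsWithin_le_nhds]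
      with t h1 h2
    rw [slope_def_module]
    exact W.smul_mem _ (W.sub_mem ((hW _ h1).mp h2) (hη0.symm ▸ hΦz))
  have hline : HasDerivAt (fun s : ℝ => Φ z + s • d) d 0 := by
    simpa using ((hasDerivAt_id (0 : ℝ)).smul_const d).const_add (Φ z)
  have hline0 : Φ z + (0 : ℝ) • d = Φ z := by simp
  have hlineT : ∀ᶠ s : ℝ in 𝓝 0, Φ z + s • d ∈ Φ.target := by
    refine hline.continuousAt.eventually_mem (Φ.open_target.mem_nhds ?_)
    rw [hline0]
    exact Φ.map_source hzΦ
  -- A straight line in W, carried back by the analytic inverse of the flattening chart.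
  refine ⟨fun s => Φ.symm (Φ z + s • d), ?_, ?_, ?_, ?_⟩
  · simp only [hline0, Φ.left_inv hzΦ]
  · filter_upwards [hlineT] with s hs
    rw [hW _ (Φ.map_target hs), Φ.right_inv hs]
    exact W.add_mem hΦz (W.smul_mem _ hdW)
  · have h1 : HasFDerivAt Φ.symm (fderiv ℝ Φ.symm (Φ z)) (Φ z + (0 : ℝ) • d) := by
      rw [hline0]
      exact hdΦ'.hasFDerivAt
    have h2 : (fderiv ℝ Φ.symm (Φ z)).comp (fderiv ℝ Φ z) = ContinuousLinearMap.id ℝ _ := by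
      refine (hdΦ'.hasFDerivAt.comp z hdΦ.hasFDerivAt).unique
        ((hasFDerivAt_id z).congr_of_eventuallyEq ?_)
      filter_upwards [Φ.open_source.mem_nhds hzΦ] with x hx
      exact Φ.left_inv hx
    have h3 := h1.comp_hasDerivAt 0 hline
    have h4 : fderiv ℝ Φ.symm (Φ z) d = v := DFunLike.congr_fun h2 v
    rwa [h4] at h3
  · have h2 : AnalyticAt ℝ (fun s : ℝ => Φ z + s • d) 0 :=
      analyticAt_const.add (analyticAt_id.smul analyticAt_const)
    exact hcΦ'.analyticAt.comp_of_eq h2 hline0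

theorem edgeShape_ne_zero {K : Type} [Field K] {x : K} (h0 : x ≠ 0) (h1 : x ≠ 1)
    (s : Finset (Fin 4)) : edgeShape x s ≠ 0 := by
  unfold edgeShape
  rw [Ring.inverse_eq_inv']
  split_ifs
  · exact h0
  · exact inv_ne_zero (sub_ne_zero.mpr h1.symm)
  · exact mul_ne_zero (sub_ne_zero.mpr h1) (inv_ne_zero h0)

theorem AnalyticAt.edgeShape {f : ℂ → ℂ} {x : ℂ} (hf : AnalyticAt ℂ f x) (h0 : f x ≠ 0)
    (h1 : f x ≠ 1) (s : Finset (Fin 4)) : AnalyticAt ℂ (fun y => _root_.edgeShape (f y) s) x := by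
  unfold _root_.edgeShape
  simp only [Ring.inverse_eq_inv']
  split_ifs
  · exact hf
  · exact (analyticAt_const.sub hf).inv (sub_ne_zero.mpr h1.symm)
  · exact (hf.sub analyticAt_const).mul (hf.inv h0)

theorem ContinuousAt.edgeShape {X : Type} [TopologicalSpace X] {f : X → ℝ} {x : X}
    (hf : ContinuousAt f x) (h0 : f x ≠ 0) (h1 : f x ≠ 1) (s : Finset (Fin 4)) :
    ContinuousAt (fun y => _root_.edgeShape (f y) s) x := by
  unfold _root_.edgeShape
  simp only [Ring.inverse_eq_inv']
  split_ifs
  · exact hf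
  · exact (continuousAt_const.sub hf).inv₀ (sub_ne_zero.mpr h1.symm)
  · exact (hf.sub continuousAt_const).mul (hf.inv₀ h0)

/-- Complex numbers near non-zero real numbers, with positive imaginary parts and with product `1`,
have arguments with sum `2π` if exactly two of the real numbers are negative. -/
theorem eventually_sum_arg_eq {α ι : Type} {l : Filter α} {S : Finset ι} {u : ι → α → ℂ}
    {e : ι → ℝ} (he : ∀ x ∈ S, e x ≠ 0) (hu : ∀ x ∈ S, Filter.Tendsto (u x) l (𝓝 (e x : ℂ)))
    (him : ∀ᶠ t in l, ∀ x ∈ S, 0 < (u x t).im) (hprod : ∀ᶠ t in l, ∏ x ∈ S, u x t = 1)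
    (hcard : (S.filter fun x => e x < 0).card = 2) :
    ∀ᶠ t in l, ∑ x ∈ S, (u x t).arg = 2 * Real.pi := by
  have harg : ∀ x ∈ S, Filter.Tendsto (fun t => (u x t).arg) l
      (𝓝 (if e x < 0 then Real.pi else 0)) := by
    intro x hx
    split_ifs with h
    -- At a negative real number the argument is continuous only from the upper half-plane, where
    -- the numbers lie by assumption.
    · have h1 := Complex.continuousWithinAt_arg_of_re_neg_of_im_zero (z := (e x : ℂ))
        (by simpa using h) (by simp)
      rw [ContinuousWithinAt, Complex.arg_ofReal_of_neg h] at h1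
      refine h1.comp (tendsto_nhdsWithin_iff.mpr ⟨hu x hx, ?_⟩)
      filter_upwards [him] with t ht
      exact (ht x hx).le
    · have hpos : 0 < e x := lt_of_le_of_ne (not_lt.mp h) (he x hx).symm
      have h1 := Complex.continuousAt_arg (x := (e x : ℂ)) (Or.inl (by simpa using hpos))
      rw [ContinuousAt, Complex.arg_ofReal_of_nonneg hpos.le] at h1
      exact h1.comp (hu x hx)
  have hsum : Filter.Tendsto (fun t => ∑ x ∈ S, (u x t).arg) l (𝓝 (2 * Real.pi)) := by
    have h := tendsto_finsetSum S harg
    rwa [← Finset.sum_filter, Finset.sum_const, hcard, nsmul_eq_mul, Nat.cast_ofNat] at h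
  have h0 : (0 : ℝ) < 2 * Real.pi := by positivity
  filter_upwards [hsum.eventually (Ioo_mem_nhds h0 (by linarith : 2 * Real.pi < 4 * Real.pi)),
    hprod] with t ht hp
  -- The product being 1, the sum of the arguments is a multiple of 2π, and it is already known to
  -- lie in (0, 4π).
  have hexp : Complex.exp ((∑ x ∈ S, (u x t).arg : ℝ) * Complex.I) = 1 := by
    have hnorm : ∏ x ∈ S, (‖u x t‖ : ℂ) = 1 := by
      rw [← Complex.ofReal_prod, ← norm_prod, hp, norm_one, Complex.ofReal_one]
    rw [Complex.ofReal_sum, Finset.sum_mul, Complex.exp_sum, ← hp]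
    conv_rhs => rw [Finset.prod_congr rfl fun x _ => (Complex.norm_mul_exp_arg_mul_I (u x t)).symm,
      Finset.prod_mul_distrib, hnorm, one_mul]
  obtain ⟨n, hn⟩ := Complex.exp_eq_one_iff.mp hexp
  have hn' : ∑ x ∈ S, (u x t).arg = n * (2 * Real.pi) := by
    have := congrArg Complex.im hn
    simpa using this
  rw [hn'] at ht ⊢
  have hn1 : 0 < n := by
    have : (0 : ℝ) < n := pos_of_mul_pos_left ht.1 h0.le
    exact_mod_cast this
  have hn2 : n < 2 := by
    have : (n : ℝ) < 2 := by nlinarith [ht.2]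
    exact_mod_cast this
  obtain rfl : n = 1 := by lia
  norm_num

end AnalyticCurves

theorem eventually_pos_of_hasDerivAt {f : ℝ → ℝ} {v : ℝ} (hf : HasDerivAt f v 0) (h0 : f 0 = 0)
    (hv : 0 < v) : ∀ᶠ t in 𝓝[>] 0, 0 < f t := by
  have h := (hasDerivAt_iff_tendsto_slope.mp hf).mono_left
    (nhdsWithin_mono 0 fun t (ht : 0 < t) => ht.ne')
  filter_upwards [h.eventually (lt_mem_nhds hv), self_mem_nhdsWithin] with t h1 h2
  rw [slope_def_field, h0, sub_zero, sub_zero] at h1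
  exact (div_pos_iff_of_pos_right h2).mp h1

/-! ## Existence of regenerations -/

/-- The complex numbers as the algebra `ℝ + ℝκ` with `κ² = -1`. -/
def complexHom : ℂ →+* ShapeAlg (-1) where
  toFun a := ⟨a.re, a.im⟩
  map_one' := by ext <;> simp [QuadraticAlgebra.re_one, QuadraticAlgebra.im_one]
  map_mul' a b := by
    ext
    · simp only [QuadraticAlgebra.re_mul, Complex.mul_re]; ring
    · simp only [QuadraticAlgebra.im_mul, Complex.mul_im]; ring
  map_zero' := by ext <;> simp
  map_add' a b := by ext <;> simp

/-- The algebra `ℝ × ℝ` as the algebra `ℝ + ℝτ` with `τ² = 1`. -/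
def splitHom : ℝ × ℝ →+* ShapeAlg 1 where
  toFun a := ⟨(a.1 + a.2) / 2, (a.1 - a.2) / 2⟩
  map_one' := by ext <;> simp [QuadraticAlgebra.re_one, QuadraticAlgebra.im_one]
  map_mul' a b := by
    ext
    · simp only [QuadraticAlgebra.re_mul, Prod.fst_mul, Prod.snd_mul]; ring
    · simp only [QuadraticAlgebra.im_mul, Prod.fst_mul, Prod.snd_mul]; ring
  map_zero' := by ext <;> simp
  map_add' a b := by
    ext
    · simp only [QuadraticAlgebra.re_add, Prod.fst_add, Prod.snd_add]; ring
    · simp only [QuadraticAlgebra.im_add, Prod.fst_add, Prod.snd_add]; ring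

theorem complexHom_re (a : ℂ) : (complexHom a).re = a.re := rfl

theorem complexHom_im (a : ℂ) : (complexHom a).im = a.im := rfl

theorem splitHom_re (a : ℝ × ℝ) : (splitHom a).re = (a.1 + a.2) / 2 := rfl

theorem splitHom_im (a : ℝ × ℝ) : (splitHom a).im = (a.1 - a.2) / 2 := rfl

theorem dihedralAngle_complexHom (a : ℂ) : dihedralAngle (complexHom a) = a.arg := by
  rw [dihedralAngle, if_pos (by norm_num), complexHom_re, complexHom_im, neg_neg, Real.sqrt_one,
    one_mul]

theorem isUnit_pair {a b : ℝ} (ha : a ≠ 0) (hb : b ≠ 0) : IsUnit (a, b) :=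
  Prod.isUnit_iff.mpr ⟨ha.isUnit, hb.isUnit⟩

theorem edgeShape_pair {a b : ℝ} (ha : a ≠ 0) (ha' : a ≠ 1) (hb : b ≠ 0) (hb' : b ≠ 1)
    (s : Finset (Fin 4)) : edgeShape (a, b) s = (edgeShape a s, edgeShape b s) := by
  have h1 : IsUnit (a, b) := isUnit_pair ha hb
  have h2 : IsUnit (1 - (a, b)) :=
    isUnit_pair (sub_ne_zero.mpr ha'.symm) (sub_ne_zero.mpr hb'.symm)
  exact Prod.ext (map_edgeShape (RingHom.fst ℝ ℝ) h1 h2 s) (map_edgeShape (RingHom.snd ℝ ℝ) h1 h2 s)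

theorem edgeShape_ofReal {a : ℝ} (ha : a ≠ 0) (ha' : a ≠ 1) (s : Finset (Fin 4)) :
    edgeShape (a : ℂ) s = (edgeShape a s : ℝ) :=
  (map_edgeShape Complex.ofRealHom ha.isUnit (sub_ne_zero.mpr ha'.symm).isUnit s).symm

theorem eventually_lt_zero_iff {e : ℝ} (he : e ≠ 0) : ∀ᶠ x in 𝓝 e, x < 0 ↔ e < 0 := by
  rcases he.lt_or_gt with h | h
  · filter_upwards [gt_mem_nhds h] with x hx
    exact iff_of_true hx h
  · filter_upwards [lt_mem_nhds h] with x hx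
    exact iff_of_false hx.not_gt h.not_gt

namespace IdealTriangulation

variable {N : ℕ} {T : IdealTriangulation N} {z v : Fin N → ℝ}

section

variable {c : ℝ} {w : ℝ → Fin N → ShapeAlg c}

/-- All smaller intervals are allowed so that the hyperbolic and the AdS path can later share one δ.
-/
theorem exists_isRegeneration (hre : ∀ j, ∀ᶠ t in 𝓝 0, ContinuousAt (fun t => (w t j).re) t)
    (him : ∀ j, ∀ᶠ t in 𝓝 0, ContinuousAt (fun t => (w t j).im) t) (start : ∀ j, w 0 j = ⟨z j, 0⟩)
    (dre : ∀ j, HasDerivAt (fun t => (w t j).re) 0 0)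
    (dim : ∀ j, HasDerivAt (fun t => (w t j).im) (v j) 0)
    (hsol : ∀ᶠ t in 𝓝[>] 0, T.IsPositiveSolution (w t)) :
    ∃ δ > 0, ∀ δ' ≤ δ, T.IsRegeneration z v δ' w := by
  obtain ⟨ε, hε, h1⟩ := Metric.eventually_nhds_iff.mp
    ((Filter.eventually_all.mpr hre).and (Filter.eventually_all.mpr him))
  obtain ⟨ε', hε', h2⟩ := mem_nhdsGT_iff_exists_Ioo_subset.mp hsol
  have hε'' : 0 < ε' := hε'
  refine ⟨min ε ε', lt_min hε hε'', fun δ hδ => ?_⟩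
  have hmem : ∀ t ∈ Set.Ico 0 δ, dist t 0 < ε := fun t ht => by
    rw [Real.dist_0_eq_abs, abs_of_nonneg ht.1]
    exact ht.2.trans_le (hδ.trans (min_le_left _ _))
  exact ⟨fun j t ht => ((h1 (hmem t ht)).1 j).continuousWithinAt,
    fun j t ht => ((h1 (hmem t ht)).2 j).continuousWithinAt, start,
    fun j => (dre j).hasDerivWithinAt, fun j => (dim j).hasDerivWithinAt,
    fun t ht => h2 ⟨ht.1, ht.2.trans_le (hδ.trans (min_le_right _ _))⟩⟩

/-- The norms start at z_j² and (1 - z_j)², and the imaginary part leaves 0 with positive velocity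
v_j. -/
theorem eventually_isPositiveShape (hz : ∀ j, z j ≠ 0 ∧ z j ≠ 1) (hv : ∀ j, 0 < v j)
    (start : ∀ j, w 0 j = ⟨z j, 0⟩) (dre : ∀ j, HasDerivAt (fun t => (w t j).re) 0 0)
    (dim : ∀ j, HasDerivAt (fun t => (w t j).im) (v j) 0) :
    ∀ᶠ t in 𝓝[>] 0, ∀ j, IsPositiveShape (w t j) := by
  refine Filter.eventually_all.mpr fun j => ?_
  have hre := (dre j).continuousAt
  have him := (dim j).continuousAt
  have h1 : ContinuousAt (fun t => QuadraticAlgebra.norm (w t j)) 0 := by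
    simp only [QuadraticAlgebra.norm_def]
    fun_prop
  have h2 : ContinuousAt (fun t => QuadraticAlgebra.norm (1 - w t j)) 0 := by
    simp only [QuadraticAlgebra.norm_def, QuadraticAlgebra.re_sub, QuadraticAlgebra.im_sub,
      QuadraticAlgebra.re_one, QuadraticAlgebra.im_one]
    fun_prop
  have e1 : 0 < QuadraticAlgebra.norm (w 0 j) := by
    rw [start, QuadraticAlgebra.norm_def]
    have := sq_pos_of_ne_zero (hz j).1
    simp only
    linarith
  have e2 : 0 < QuadraticAlgebra.norm (1 - w 0 j) := by
    rw [start, QuadraticAlgebra.norm_def, QuadraticAlgebra.re_sub, QuadraticAlgebra.im_sub,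
      QuadraticAlgebra.re_one, QuadraticAlgebra.im_one]
    have := sq_pos_of_ne_zero (sub_ne_zero.mpr (hz j).2.symm)
    simp only
    linarith
  filter_upwards [(h1.eventually (lt_mem_nhds e1)).filter_mono nhdsWithin_le_nhds,
    (h2.eventually (lt_mem_nhds e2)).filter_mono nhdsWithin_le_nhds,
    eventually_pos_of_hasDerivAt (dim j) (by rw [start]) (hv j)] with t h1 h2 h3
  exact ⟨h1, h2, h3⟩

end

/-- The path is the holomorphic extension of γ evaluated at it, so its velocity is iv. The edge
equations extend from the real axis by the identity theorem, and `eventually_sum_arg_eq` supplies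
the angles. -/
theorem exists_hyperbolic_regeneration {γ : ℝ → Fin N → ℝ} (hz : z ∈ T.realDeformationVariety)
    (hv : ∀ j, 0 < v j) (hγ0 : γ 0 = z) (hγ : ∀ᶠ s in 𝓝 0, γ s ∈ T.realDeformationVariety)
    (hγv : HasDerivAt γ v 0) (hγa : AnalyticAt ℝ γ 0) :
    ∃ ζ : ℝ → Fin N → ShapeAlg (-1), ∃ δ > 0, ∀ δ' ≤ δ, T.IsRegeneration z v δ' ζ := by
  have hcomp : ∀ j, ∃ g : ℂ → ℂ, AnalyticAt ℂ g 0 ∧ ∀ᶠ s : ℝ in 𝓝 0, g s = γ s j := fun j =>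
    exists_complexification (((ContinuousLinearMap.proj (R := ℝ) (φ := fun _ : Fin N => ℝ)
      j).analyticAt _).comp hγa)
  choose g hg hgγ using hcomp
  have hg0 : ∀ j, g j 0 = z j := fun j => by
    have := (hgγ j).self_of_nhds
    rwa [Complex.ofReal_zero, hγ0] at this
  have hne0 : ∀ j, g j 0 ≠ 0 := fun j => by
    rw [hg0]
    exact_mod_cast (hz.1 j).1
  have hne1 : ∀ j, g j 0 ≠ 1 := fun j => by
    rw [hg0]
    exact_mod_cast (hz.1 j).2
  have hgd : ∀ j, HasDerivAt (g j) (v j : ℂ) 0 := fun j => by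
    have h1 : HasDerivAt (fun s : ℝ => g j s) (deriv (g j) 0) 0 := by
      have h := (hg j).differentiableAt.hasDerivAt
      rw [← Complex.ofReal_zero] at h
      simpa using h.comp_ofReal
    have h2 : HasDerivAt (fun s : ℝ => (γ s j : ℂ)) (v j : ℂ) 0 :=
      (hasDerivAt_pi.mp hγv j).ofReal_comp
    rw [← h1.unique (h2.congr_of_eventuallyEq (hgγ j))]
    exact (hg j).differentiableAt.hasDerivAt
  have hshape : ∀ x : TetEdge N, AnalyticAt ℂ (fun y => edgeShape (g x.1 y) x.2.1) 0 := fun x =>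
    (hg x.1).edgeShape (hne0 _) (hne1 _) _
  have hprod : ∀ e : TetEdge N, ∀ᶠ y : ℂ in 𝓝 0,
      ∏ x ∈ T.edgeClass e, edgeShape (g x.1 y) x.2.1 = 1 := by
    intro e
    have han : AnalyticAt ℂ (fun y => ∏ x ∈ T.edgeClass e, edgeShape (g x.1 y) x.2.1) 0 :=
      Finset.analyticAt_fun_prod _ fun x _ => hshape x
    -- Identity theorem: the equation holds at real points accumulating at 0, because γ stays in the
    -- deformation variety.
    refine (han.frequently_eq_iff_eventually_eq analyticAt_const).mp ?_
    have hreal : ∀ᶠ s : ℝ in 𝓝[≠] 0,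
        ∏ x ∈ T.edgeClass e, edgeShape (g x.1 s) x.2.1 = 1 := by
      filter_upwards [(Filter.eventually_all.mpr hgγ).filter_mono nhdsWithin_le_nhds,
        hγ.filter_mono nhdsWithin_le_nhds] with s h1 h2
      have := (h2.2 e).1
      rw [Finset.prod_congr rfl fun x _ => by
        rw [h1 x.1, edgeShape_ofReal (h2.1 _).1 (h2.1 _).2], ← Complex.ofReal_prod, this,
        Complex.ofReal_one]
    have htend : Filter.Tendsto (fun s : ℝ => (s : ℂ)) (𝓝[≠] 0) (𝓝[≠] 0) := by
      refine tendsto_nhdsWithin_iff.mpr ⟨?_, ?_⟩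
      · simpa using (Complex.continuous_ofReal.tendsto 0).mono_left nhdsWithin_le_nhds
      · filter_upwards [self_mem_nhdsWithin] with s hs
        simpa using hs
    exact htend.frequently hreal.frequently
  have hI : Filter.Tendsto (fun t : ℝ => (t : ℂ) * Complex.I) (𝓝 0) (𝓝 0) := by
    have : Continuous fun t : ℝ => (t : ℂ) * Complex.I := by fun_prop
    simpa using this.tendsto 0
  have hI' : ∀ t, HasDerivAt (fun t : ℝ => (t : ℂ) * Complex.I) Complex.I t := fun t => by
    simpa using ((hasDerivAt_id t).ofReal_comp).mul_const Complex.I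
  let ζ : ℝ → Fin N → ShapeAlg (-1) := fun t j => complexHom (g j (t * Complex.I))
  have hcont : ∀ j, ∀ᶠ t : ℝ in 𝓝 0, ContinuousAt (fun t : ℝ => g j (t * Complex.I)) t := by
    intro j
    filter_upwards [hI.eventually (hg j).eventually_continuousAt] with t ht
    exact ContinuousAt.comp (f := fun t : ℝ => (t : ℂ) * Complex.I) ht (hI' t).continuousAt
  have hderiv : ∀ j, HasDerivAt (fun t : ℝ => g j (t * Complex.I)) (v j * Complex.I) 0 := by
    intro j
    have h : HasDerivAt (g j) (v j : ℂ) (((0 : ℝ) : ℂ) * Complex.I) := by simpa using hgd j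
    exact h.comp (0 : ℝ) (hI' 0)
  have start : ∀ j, ζ 0 j = ⟨z j, 0⟩ := fun j => by
    change complexHom (g j ((0 : ℝ) * Complex.I)) = _
    rw [Complex.ofReal_zero, zero_mul, hg0]
    rfl
  have dre : ∀ j, HasDerivAt (fun t => (ζ t j).re) 0 0 := fun j => by
    have h := Complex.reCLM.hasFDerivAt.comp_hasDerivAt (0 : ℝ) (hderiv j)
    have e : Complex.reCLM ((v j : ℂ) * Complex.I) = 0 := by simp
    rw [e] at h
    exact h
  have dim : ∀ j, HasDerivAt (fun t => (ζ t j).im) (v j) 0 := fun j => by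
    have h := Complex.imCLM.hasFDerivAt.comp_hasDerivAt (0 : ℝ) (hderiv j)
    have e : Complex.imCLM ((v j : ℂ) * Complex.I) = v j := by simp
    rw [e] at h
    exact h
  have hpos := eventually_isPositiveShape hz.1 hv start dre dim
  have hne : ∀ᶠ t : ℝ in 𝓝 0, ∀ j, g j (t * Complex.I) ≠ 0 ∧ g j (t * Complex.I) ≠ 1 :=
    Filter.eventually_all.mpr fun j => hI.eventually
      (((hg j).continuousAt.eventually_ne (hne0 j)).and ((hg j).continuousAt.eventually_ne (hne1 j)))
  have hmap : ∀ᶠ t : ℝ in 𝓝[>] 0, ∀ x : TetEdge N,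
      edgeShape (ζ t x.1) x.2.1 = complexHom (edgeShape (g x.1 (t * Complex.I)) x.2.1) := by
    filter_upwards [hne.filter_mono nhdsWithin_le_nhds] with t ht x
    exact (map_edgeShape complexHom (ht x.1).1.isUnit
      (sub_ne_zero.mpr (ht x.1).2.symm).isUnit _).symm
  have hI'' : Filter.Tendsto (fun t : ℝ => (t : ℂ) * Complex.I) (𝓝[>] 0) (𝓝 0) :=
    hI.mono_left nhdsWithin_le_nhds
  have hangle : ∀ e : TetEdge N, ∀ᶠ t : ℝ in 𝓝[>] 0,
      ∑ x ∈ T.edgeClass e, (edgeShape (g x.1 (t * Complex.I)) x.2.1).arg = 2 * Real.pi := by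
    intro e
    refine eventually_sum_arg_eq (e := fun x => edgeShape (z x.1) x.2.1)
      (u := fun (x : TetEdge N) (t : ℝ) => edgeShape (g x.1 (t * Complex.I)) x.2.1)
      (fun x _ => edgeShape_ne_zero (hz.1 _).1 (hz.1 _).2 _) (fun x _ => ?_) ?_
      (hI''.eventually (hprod e)) (hz.2 e).2
    · have h := (hshape x).continuousAt.tendsto.comp hI''
      rwa [hg0, edgeShape_ofReal (hz.1 _).1 (hz.1 _).2] at h
    · filter_upwards [hpos, hmap] with t h1 h2 x _
      rw [← complexHom_im, ← h2]
      exact im_edgeShape_pos (h1 _) _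
  refine ⟨ζ, exists_isRegeneration (fun j => ?_) (fun j => ?_) start dre dim ?_⟩
  · exact (hcont j).mono fun t ht => Complex.continuous_re.continuousAt.comp ht
  · exact (hcont j).mono fun t ht => Complex.continuous_im.continuousAt.comp ht
  · filter_upwards [hpos, hmap, Filter.eventually_all.mpr hangle,
      Filter.eventually_all.mpr fun e => hI''.eventually (hprod e)] with t h1 h2 h3 h4
    refine ⟨h1, fun e => ⟨?_, ?_⟩⟩
    · rw [Finset.prod_congr rfl fun x _ => h2 x, ← map_prod, h4 e, map_one]
    · rw [← h3 e]
      exact Finset.sum_congr rfl fun x _ => by rw [h2 x, dihedralAngle_complexHom]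

/-- Over ℝ × ℝ an edge equation is a pair of real edge equations, and these hold for γ(t) and γ(-t)
separately. -/
theorem exists_antiDeSitter_regeneration {γ : ℝ → Fin N → ℝ} (hz : z ∈ T.realDeformationVariety)
    (hv : ∀ j, 0 < v j) (hγ0 : γ 0 = z) (hγ : ∀ᶠ s in 𝓝 0, γ s ∈ T.realDeformationVariety)
    (hγv : HasDerivAt γ v 0) (hγa : AnalyticAt ℝ γ 0) :
    ∃ ξ : ℝ → Fin N → ShapeAlg 1, ∃ δ > 0, ∀ δ' ≤ δ, T.IsRegeneration z v δ' ξ := by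
  have hneg : Filter.Tendsto (fun t : ℝ => -t) (𝓝 0) (𝓝 0) := by
    simpa using (continuous_neg (G := ℝ)).tendsto 0
  -- This stands for γ(τt), as τ corresponds to the pair (1, -1).
  let ξ : ℝ → Fin N → ShapeAlg 1 := fun t j => splitHom (γ t j, γ (-t) j)
  have hcont : ∀ᶠ t in 𝓝 0, ContinuousAt γ t ∧ ContinuousAt (fun t => γ (-t)) t := by
    filter_upwards [hγa.eventually_continuousAt, hneg.eventually hγa.eventually_continuousAt]
      with t h1 h2
    exact ⟨h1, ContinuousAt.comp (f := fun t : ℝ => -t) h2 continuous_neg.continuousAt⟩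
  have hd : ∀ j, HasDerivAt (fun t => γ t j) (v j) 0 := hasDerivAt_pi.mp hγv
  have hd' : ∀ j, HasDerivAt (fun t => γ (-t) j) (-v j) 0 := fun j => by
    have h : HasDerivAt (fun t => γ t j) (v j) (-0) := by simpa using hd j
    have h' := h.scomp (0 : ℝ) (hasDerivAt_neg 0)
    rw [neg_one_smul] at h'
    exact h'
  have start : ∀ j, ξ 0 j = ⟨z j, 0⟩ := fun j => by
    change splitHom (γ 0 j, γ (-0) j) = _
    rw [neg_zero, hγ0]
    ext
    · rw [splitHom_re]; ring
    · rw [splitHom_im]; ring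
  have dre : ∀ j, HasDerivAt (fun t => (ξ t j).re) 0 0 := fun j => by
    have h := ((hd j).add (hd' j)).div_const 2
    rwa [add_neg_cancel, zero_div] at h
  have dim : ∀ j, HasDerivAt (fun t => (ξ t j).im) (v j) 0 := fun j => by
    have h := ((hd j).sub (hd' j)).div_const 2
    rwa [sub_neg_eq_add, add_self_div_two] at h
  have hpos := eventually_isPositiveShape hz.1 hv start dre dim
  have hmem : ∀ᶠ t in 𝓝 0,
      γ t ∈ T.realDeformationVariety ∧ γ (-t) ∈ T.realDeformationVariety :=
    hγ.and (hneg.eventually hγ)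
  have hmap : ∀ᶠ t in 𝓝 0, ∀ x : TetEdge N, edgeShape (ξ t x.1) x.2.1 =
      splitHom (edgeShape (γ t x.1) x.2.1, edgeShape (γ (-t) x.1) x.2.1) := by
    filter_upwards [hmem] with t ht x
    obtain ⟨h1, h2⟩ := ht.1.1 x.1
    obtain ⟨h3, h4⟩ := ht.2.1 x.1
    rw [← edgeShape_pair h1 h2 h3 h4]
    exact (map_edgeShape splitHom (isUnit_pair h1 h3)
      (isUnit_pair (sub_ne_zero.mpr h2.symm) (sub_ne_zero.mpr h4.symm)) _).symm
  -- The real part of an edge parameter is the mean of its values along γ(t) and γ(-t), so it is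
  -- close to the nonzero parameter of z and has the same sign.
  have hsign : ∀ᶠ t in 𝓝 0, ∀ x : TetEdge N,
      (edgeShape (ξ t x.1) x.2.1).re < 0 ↔ edgeShape (z x.1) x.2.1 < 0 := by
    have hlim : ∀ x : TetEdge N, Filter.Tendsto (fun t =>
        (edgeShape (γ t x.1) x.2.1 + edgeShape (γ (-t) x.1) x.2.1) / 2) (𝓝 0)
        (𝓝 (edgeShape (z x.1) x.2.1)) := by
      intro x
      have h1 : ContinuousAt (fun t => edgeShape (γ t x.1) x.2.1) 0 :=
        (hd x.1).continuousAt.edgeShape (by rw [hγ0]; exact (hz.1 _).1)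
          (by rw [hγ0]; exact (hz.1 _).2) _
      have h2 : Filter.Tendsto (fun t => edgeShape (γ t x.1) x.2.1) (𝓝 0)
          (𝓝 (edgeShape (z x.1) x.2.1)) := by
        simpa [ContinuousAt, hγ0] using h1
      simpa using (h2.add (h2.comp hneg)).div_const 2
    filter_upwards [hmap, Filter.eventually_all.mpr fun x : TetEdge N =>
      (hlim x).eventually (eventually_lt_zero_iff
        (edgeShape_ne_zero (hz.1 x.1).1 (hz.1 x.1).2 x.2.1))] with t h1 h2 x
    rw [h1, splitHom_re]
    exact h2 x
  refine ⟨ξ, exists_isRegeneration (fun j => ?_) (fun j => ?_) start dre dim ?_⟩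
  · filter_upwards [hcont] with t ht
    exact ((continuousAt_pi.mp ht.1 j).add (continuousAt_pi.mp ht.2 j)).div_const 2
  · filter_upwards [hcont] with t ht
    exact ((continuousAt_pi.mp ht.1 j).sub (continuousAt_pi.mp ht.2 j)).div_const 2
  · filter_upwards [hpos, hmap.filter_mono nhdsWithin_le_nhds, hsign.filter_mono nhdsWithin_le_nhds,
      hmem.filter_mono nhdsWithin_le_nhds] with t h1 h2 h3 h4
    refine ⟨h1, fun e => ⟨?_, ?_⟩⟩
    · rw [Finset.prod_congr rfl fun x _ => h2 x, ← map_prod, ← map_one splitHom]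
      congr 1
      ext
      · rw [Prod.fst_prod]
        exact (h4.1.2 e).1
      · rw [Prod.snd_prod]
        exact (h4.2.2 e).1
    · have hangle : ∀ x : TetEdge N, dihedralAngle (edgeShape (ξ t x.1) x.2.1) =
          if edgeShape (z x.1) x.2.1 < 0 then Real.pi else 0 := fun x => by
        rw [dihedralAngle, if_neg (by norm_num)]
        exact if_congr (h3 x) rfl rfl
      rw [Finset.sum_congr rfl fun x _ => hangle x, ← Finset.sum_filter, Finset.sum_const,
        (hz.2 e).2, nsmul_eq_mul]
      norm_num

/-- A positive tangent vector at a smooth point of the real deformation variety is the initial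
velocity of hyperbolic and of anti de Sitter regenerations. -/
theorem exists_regenerations (hz : IsSmoothAt T.realDeformationVariety z)
    (hv : IsTangentVector T.realDeformationVariety z v) (hpos : ∀ j, 0 < v j) :
    ∃ (δ : ℝ) (ζ : ℝ → Fin N → ShapeAlg (-1)) (ξ : ℝ → Fin N → ShapeAlg 1),
      0 < δ ∧ T.IsRegeneration z v δ ζ ∧ T.IsRegeneration z v δ ξ := by
  obtain ⟨γ, hγ0, hγ, hγv, hγa⟩ := hz.exists_analyticAt hv
  obtain ⟨ζ, δ, hδ, h⟩ := exists_hyperbolic_regeneration hz.1 hpos hγ0 hγ hγv hγa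
  obtain ⟨ξ, δ', hδ', h'⟩ := exists_antiDeSitter_regeneration hz.1 hpos hγ0 hγ hγv hγa
  exact ⟨min δ δ', ζ, ξ, lt_min hδ hδ', h _ (min_le_left _ _), h' _ (min_le_right _ _)⟩

end IdealTriangulation

end

theorem proposition6p1 {N : ℕ} (T : IdealTriangulation N) (z v : Fin N → ℝ)
    (hz : IsSmoothAt T.realDeformationVariety z)
    (hv : IsTangentVector T.realDeformationVariety z v)
    (hpos : ∀ j, 0 < v j) :
    (∃ (δ : ℝ) (ζ : ℝ → Fin N → ShapeAlg (-1)) (ξ : ℝ → Fin N → ShapeAlg 1),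
      0 < δ ∧ T.IsRegeneration z v δ ζ ∧ T.IsRegeneration z v δ ξ) ∧
    ∀ (δ : ℝ) (ζ : ℝ → Fin N → ShapeAlg (-1)) (ξ : ℝ → Fin N → ShapeAlg 1),
      0 < δ → T.IsRegeneration z v δ ζ → T.IsRegeneration z v δ ξ →
      ∃ P : ℝ → ProjStructure T.Space,
        IsContinuousPath (Set.Ioo (-δ) δ) P ∧
        (∀ t ∈ Set.Ioo 0 δ, ∃ H : HypStructure T.Space,
          T.IsTriangulatedWithShapes H (ζ t) ∧ IsConjugate (P t) H) ∧
        (∀ t ∈ Set.Ioo (-δ) 0, ∃ A : AdSStructure T.Space,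
          T.IsTriangulatedWithShapes A (ξ |t|) ∧ IsConjugate (P t) A) ∧
        (∃ (Q : HPStructure T.Space) (w : Fin N → ShapeAlg 0),
          T.IsTriangulatedWithShapes Q w ∧ IsConjugate (P 0) Q) ∧
        ∀ t ∈ Set.Ioo (-δ) δ, T.IsPositivelyRealized (P t) :=
  ⟨IdealTriangulation.exists_regenerations hz hv hpos, fun _ _ _ hδ hζ hξ =>
    IdealTriangulation.exists_transition hδ hζ hξ hz.1 hpos⟩
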